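/- Consider makespan minimization on $m\ge 1$ identical machines: an instance $I$ consists of $n\ge 1$ jobs with processing times $p_1,\dots,p_n>0$, a schedule assigns every job to a machine, its makespan is the largest total processing time on a machine, and $OPT(I)$ is the minimum makespan. The algorithm knows $m$, an accuracy $\epsilon\in(0,1)$ and a failure rate $\gamma\in(0,1)$, but not $n$. It accesses the jobs only by adaptive weighted random sampling: each sample is independent of the others and returns, in one step, the label and the processing time of job $j$ with probability $p_j/\sum_i p_i$ (labels are distinct natural numbers, otherwise arbitrary). It runs on a real RAM (unit-cost addition, truncated subtraction and comparison of natural numbers, which serve as array indices; unit-cost field operations and comparison of real numbers; no rounding). It may call as a black box any scheme $A$ that, for every $\alpha\in(0,1)$, computes a schedule on $m$ machines with makespan at most $1+\alpha$ times the optimum; $A(N,\alpha)$ denotes a bound on the running time of the scheme on at most $N$ jobs. A sketch schedule consists of numbers $w>0$, $\delta\in(0,1)$, $t\in\mathbb N$ and $\tilde n_{i,k}\in\mathbb N$ for $1\le i\le m$, $1\le k\le t$; $\tilde n_{i,k}$ jobs of estimated processing time $\tilde p_k=w(1-\delta)^{k-1}$ are assigned to machine $i$. Put $\tilde n_k=\sum_i\tilde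 n_{i,k}$, $I_k=(\tilde p_{k+1},\tilde p_k]$, and let $n_k$ be the number of jobs with $p_j\in I_k$. A schedule of $I$ is generated from the sketch schedule if, for every $k$ with $\tilde n_k>0$, there is a machine $i_0$ with the largest $\tilde n_{i,k}$ such that machine $i_0$ gets at most $\tilde n_{i_0,k}+\max(n_k-\tilde n_k,0)$ of the jobs of $I_k$ and every other machine $i$ at most $\tilde n_{i,k}$ of them; all remaining jobs may be on any machine. Theorem. There are one algorithm and absolute constants $C>0$, $c\ge 1$, $d\in\mathbb N$ such that for all $m$, $\epsilon$, $\gamma$, every approximation scheme with time bound $A$, and every instance $I$, the following holds with probability at least $1-\gamma$: (1) the algorithm halts after at most $$C\Big(\frac{m^5}{\epsilon^4}\sqrt n+A\big(\lceil c\,m/\epsilon\rceil,\ \epsilon/c\big)\Big)\log^d\Big(2+\frac{nm}{\epsilon\gamma}\Big)$$ steps (i.e. in time $\tilde O(\frac{m^5}{\epsilon^4}\sqrt n+A(\lceil\frac m\epsilon\rceil,\epsilon))$, up to constant factors in the arguments of $A$); (2) it outputs a value $T$ with $OPT(I)\le T\le(1+\epsilon)\,OPT(I)$; (3) it also outputs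 a sketch schedule that consists of at most $C\,\frac{m^2}{\epsilon^2}\log(2+\frac{nm}{\epsilon})$ numbers, and schedules generated from it exist and all have makespan at most $(1+3\epsilon)\,OPT(I)$. -/

import Mathlib

/-! ### Makespan minimization on identical machines -/

/-- The makespan of the schedule that assigns job `j` to machine `S j`. All jobs are available at
time `0` and every machine runs its jobs one after the other without idle time, so a machine is
busy exactly until the sum of the processing times of its jobs. -/
noncomputable def makespan {n m : ℕ} (p : Fin n → ℝ) (S : Fin n → Fin m) : ℝ :=
  ⨆ i : Fin m, ∑ j with S j = i, p j

/-- The optimal makespan of the jobs `p` on `m` machines (a minimum over finitely many schedules). -/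
noncomputable def optMakespan (m : ℕ) {n : ℕ} (p : Fin n → ℝ) : ℝ :=
  ⨅ S : Fin n → Fin m, makespan p S

/-- An input of the problem: `n ≥ 1` jobs with positive processing times. -/
structure JobInstance where
  n : ℕ
  p : Fin n → ℝ
  n_pos : 1 ≤ n
  p_pos : ∀ j, 0 < p j

namespace JobInstance

/-- The total processing time. -/
def total (I : JobInstance) : ℝ := ∑ j, I.p j

theorem total_pos (I : JobInstance) : 0 < I.total :=
  Finset.sum_pos (fun j _ => I.p_pos j) ⟨⟨0, I.n_pos⟩, Finset.mem_univ _⟩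

/-- Weighted random sampling: job `j` is drawn with probability `p j / ∑ i, p i`. -/
noncomputable def weightedSample (I : JobInstance) : PMF (Fin I.n) :=
  PMF.ofFintype (fun j => ENNReal.ofReal (I.p j / I.total)) (by
    rw [← ENNReal.ofReal_sum_of_nonneg
      (fun j _ => div_nonneg (I.p_pos j).le I.total_pos.le), ← Finset.sum_div]
    change ENNReal.ofReal (I.total / I.total) = 1
    rw [div_self I.total_pos.ne', ENNReal.ofReal_one])

/-- The law of an infinite sequence of independent weighted random samples (with replacement). -/
noncomputable def sampleLaw (I : JobInstance) : MeasureTheory.Measure (ℕ → Fin I.n) :=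
  MeasureTheory.Measure.infinitePi (fun _ : ℕ => I.weightedSample.toMeasure)

end JobInstance

/-! ### Black-box approximation schemes -/

/-- A procedure for makespan minimization on `m` machines: on `N` jobs and an accuracy `α` it
returns a schedule, after the given number of steps. -/
structure BlackBox (m : ℕ) where
  schedule : (N : ℕ) → (Fin N → ℝ) → ℝ → Fin N → Fin m
  steps : (N : ℕ) → (Fin N → ℝ) → ℝ → ℕ

/-- For every accuracy `α` the schedule is within a factor `1 + α` of the optimum. -/
def BlackBox.IsApproxScheme {m : ℕ} (A : BlackBox m) : Prop :=
  ∀ (N : ℕ) (q : Fin N → ℝ) (α : ℝ), (∀ j, 0 < q j) → 0 < α → α < 1 →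
    makespan q (A.schedule N q α) ≤ (1 + α) * optMakespan m q

/-- `tA N α` bounds the running time on at most `N` jobs with accuracy `α`. -/
def BlackBox.RunsInTime {m : ℕ} (A : BlackBox m) (tA : ℕ → ℝ → ℝ) : Prop :=
  ∀ (N N' : ℕ) (q : Fin N' → ℝ) (α : ℝ), N' ≤ N → (∀ j, 0 < q j) → 0 < α → α < 1 →
    (A.steps N' q α : ℝ) ≤ tA N α

/-! ### The machine model: a real RAM with a sampling instruction and a black-box subroutine

Natural numbers (addition, truncated subtraction, comparison, array indices) and real numbers
(field operations, comparison; no rounding) are kept apart. A program is a finite object, and its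
only constants are natural numbers. -/

/-- The memory, and the number of samples that were drawn so far. -/
structure MachineState where
  nvar : ℕ → ℕ
  rvar : ℕ → ℝ
  narr : ℕ → ℕ → ℕ
  rarr : ℕ → ℕ → ℝ
  drawn : ℕ

/-- Expressions for natural numbers: constants, variables, array entries, `+` and `-`. -/
inductive NExp where
  | const (k : ℕ)
  | var (x : ℕ)
  | entry (a : ℕ) (i : NExp)
  | add (e₁ e₂ : NExp)
  | sub (e₁ e₂ : NExp)

namespace NExp

def eval (s : MachineState) : NExp → ℕ
  | const k => k
  | var x => s.nvar x
  | entry a i => s.narr a (i.eval s)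
  | add e₁ e₂ => e₁.eval s + e₂.eval s
  | sub e₁ e₂ => e₁.eval s - e₂.eval s

/-- The number of operations. -/
def cost : NExp → ℕ
  | const _ => 1
  | var _ => 1
  | entry _ i => i.cost + 1
  | add e₁ e₂ => e₁.cost + e₂.cost + 1
  | sub e₁ e₂ => e₁.cost + e₂.cost + 1

end NExp

/-- Expressions for real numbers: natural numbers, variables, array entries, field operations. -/
inductive RExp where
  | ofNat (e : NExp)
  | var (x : ℕ)
  | entry (a : ℕ) (i : NExp)
  | add (e₁ e₂ : RExp)
  | sub (e₁ e₂ : RExp)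
  | mul (e₁ e₂ : RExp)
  | div (e₁ e₂ : RExp)

namespace RExp

noncomputable def eval (s : MachineState) : RExp → ℝ
  | ofNat e => (e.eval s : ℝ)
  | var x => s.rvar x
  | entry a i => s.rarr a (i.eval s)
  | add e₁ e₂ => e₁.eval s + e₂.eval s
  | sub e₁ e₂ => e₁.eval s - e₂.eval s
  | mul e₁ e₂ => e₁.eval s * e₂.eval s
  | div e₁ e₂ => e₁.eval s / e₂.eval s

/-- The number of operations. -/
def cost : RExp → ℕ
  | ofNat e => e.cost + 1
  | var _ => 1
  | entry _ i => i.cost + 1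
  | add e₁ e₂ => e₁.cost + e₂.cost + 1
  | sub e₁ e₂ => e₁.cost + e₂.cost + 1
  | mul e₁ e₂ => e₁.cost + e₂.cost + 1
  | div e₁ e₂ => e₁.cost + e₂.cost + 1

end RExp

/-- Tests: comparisons of natural and of real numbers, and their Boolean combinations. -/
inductive Test where
  | nle (e₁ e₂ : NExp)
  | rle (e₁ e₂ : RExp)
  | neg (b : Test)
  | conj (b₁ b₂ : Test)

namespace Test

def Holds (s : MachineState) : Test → Prop
  | nle e₁ e₂ => e₁.eval s ≤ e₂.eval s
  | rle e₁ e₂ => e₁.eval s ≤ e₂.eval s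
  | neg b => ¬ b.Holds s
  | conj b₁ b₂ => b₁.Holds s ∧ b₂.Holds s

/-- The number of operations. -/
def cost : Test → ℕ
  | nle e₁ e₂ => e₁.cost + e₂.cost + 1
  | rle e₁ e₂ => e₁.cost + e₂.cost + 1
  | neg b => b.cost + 1
  | conj b₁ b₂ => b₁.cost + b₂.cost + 1

end Test

/-- Programs. `sample x y` draws a weighted random sample and puts the label of the job into the
natural variable `x` and its processing time into the real variable `y`. `call a N α b` runs the
black box with accuracy `α` on the first `N` entries of the real array `a` and writes the machines
of these jobs to the first `N` entries of the natural array `b`. -/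
inductive Prog where
  | skip
  | nset (x : ℕ) (e : NExp)
  | rset (x : ℕ) (e : RExp)
  | nstore (a : ℕ) (i e : NExp)
  | rstore (a : ℕ) (i : NExp) (e : RExp)
  | sample (x y : ℕ)
  | call (a : ℕ) (N : NExp) (α : RExp) (b : ℕ)
  | seq (c₁ c₂ : Prog)
  | branch (b : Test) (c₁ c₂ : Prog)
  | loop (b : Test) (c : Prog)

namespace MachineState

def nset (s : MachineState) (x v : ℕ) : MachineState :=
  { s with nvar := Function.update s.nvar x v }

noncomputable def rset (s : MachineState) (x : ℕ) (v : ℝ) : MachineState :=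
  { s with rvar := Function.update s.rvar x v }

def nstore (s : MachineState) (a i v : ℕ) : MachineState :=
  { s with narr := Function.update s.narr a (Function.update (s.narr a) i v) }

noncomputable def rstore (s : MachineState) (a i : ℕ) (v : ℝ) : MachineState :=
  { s with rarr := Function.update s.rarr a (Function.update (s.rarr a) i v) }

def countSample (s : MachineState) : MachineState :=
  { s with drawn := s.drawn + 1 }

/-- The first `N` entries of the natural array `b` are overwritten by `f`. -/
def nfill (s : MachineState) (b N : ℕ) (f : Fin N → ℕ) : MachineState :=
  { s with
    narr := Function.update s.narr b (fun i => if h : i < N then f ⟨i, h⟩ else s.narr b i) }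

/-- The first `N` entries of the real array `a`. -/
def rprefix (s : MachineState) (a N : ℕ) : Fin N → ℝ := fun i => s.rarr a i

end MachineState

/-- `Exec A samples c s s' k`: the program `c`, started in the state `s`, halts in the state `s'`
after `k` steps, where `A` is the black box and `samples i` is the label and the processing time
of the job that the `i`-th sample returns. -/
inductive Exec {m : ℕ} (A : BlackBox m) (samples : ℕ → ℕ × ℝ) :
    Prog → MachineState → MachineState → ℕ → Prop where
  | skip (s : MachineState) : Exec A samples Prog.skip s s 1
  | nset (s : MachineState) (x : ℕ) (e : NExp) :
      Exec A samples (Prog.nset x e) s (s.nset x (e.eval s)) (e.cost + 1)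
  | rset (s : MachineState) (x : ℕ) (e : RExp) :
      Exec A samples (Prog.rset x e) s (s.rset x (e.eval s)) (e.cost + 1)
  | nstore (s : MachineState) (a : ℕ) (i e : NExp) :
      Exec A samples (Prog.nstore a i e) s (s.nstore a (i.eval s) (e.eval s))
        (i.cost + e.cost + 1)
  | rstore (s : MachineState) (a : ℕ) (i : NExp) (e : RExp) :
      Exec A samples (Prog.rstore a i e) s (s.rstore a (i.eval s) (e.eval s))
        (i.cost + e.cost + 1)
  | sample (s : MachineState) (x y : ℕ) :
      Exec A samples (Prog.sample x y) s
        ((s.nset x (samples s.drawn).1).rset y (samples s.drawn).2).countSample 1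
  | call (s : MachineState) (a : ℕ) (N : NExp) (α : RExp) (b : ℕ) :
      Exec A samples (Prog.call a N α b) s
        (s.nfill b (N.eval s)
          (fun i => (A.schedule (N.eval s) (s.rprefix a (N.eval s)) (α.eval s) i : ℕ)))
        (N.cost + α.cost + N.eval s + A.steps (N.eval s) (s.rprefix a (N.eval s)) (α.eval s) + 1)
  | seq {c₁ c₂ : Prog} {s s₁ s₂ : MachineState} {k₁ k₂ : ℕ} :
      Exec A samples c₁ s s₁ k₁ → Exec A samples c₂ s₁ s₂ k₂ →
      Exec A samples (Prog.seq c₁ c₂) s s₂ (k₁ + k₂)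
  | branchTrue {b : Test} {c₁ c₂ : Prog} {s s₁ : MachineState} {k : ℕ} :
      b.Holds s → Exec A samples c₁ s s₁ k →
      Exec A samples (Prog.branch b c₁ c₂) s s₁ (b.cost + k)
  | branchFalse {b : Test} {c₁ c₂ : Prog} {s s₁ : MachineState} {k : ℕ} :
      ¬ b.Holds s → Exec A samples c₂ s s₁ k →
      Exec A samples (Prog.branch b c₁ c₂) s s₁ (b.cost + k)
  | loopTrue {b : Test} {c : Prog} {s s₁ s₂ : MachineState} {k₁ k₂ : ℕ} :
      b.Holds s → Exec A samples c s s₁ k₁ → Exec A samples (Prog.loop b c) s₁ s₂ k₂ →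
      Exec A samples (Prog.loop b c) s s₂ (b.cost + k₁ + k₂)
  | loopFalse {b : Test} {c : Prog} {s : MachineState} :
      ¬ b.Holds s → Exec A samples (Prog.loop b c) s s b.cost

/-- The initial state: the number of machines `m`, the accuracy `ε` and the failure rate `γ` are
given, and everything else is `0`. In particular nothing tells the number of jobs. -/
noncomputable def inputState (m : ℕ) (ε γ : ℝ) : MachineState where
  nvar := fun x => if x = 0 then m else 0
  rvar := fun x => if x = 0 then ε else if x = 1 then γ else 0
  narr := fun _ _ => 0
  rarr := fun _ _ => 0
  drawn := 0

/-! ### Sketch schedules -/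

/-- A sketch schedule on `m` machines. With `k` counted from `0`, the `k`-th interval is
`(top * (1 - δ) ^ (k + 1), top * (1 - δ) ^ k]`, its jobs get the estimated processing time
`top * (1 - δ) ^ k`, and `count i k` of them are assigned to machine `i`. -/
structure SketchSchedule (m : ℕ) where
  top : ℝ
  δ : ℝ
  len : ℕ
  count : Fin m → Fin len → ℕ

namespace SketchSchedule

variable {m : ℕ} (σ : SketchSchedule m)

/-- The number of numbers that are stored. -/
def size : ℕ := m * σ.len + 3

/-- The estimated number of jobs in the `k`-th interval. -/
def estimate (k : Fin σ.len) : ℕ := ∑ i, σ.count i k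

/-- The jobs with processing time in the `k`-th interval. -/
noncomputable def jobsIn {n : ℕ} (p : Fin n → ℝ) (k : Fin σ.len) : Finset (Fin n) :=
  {j | σ.top * (1 - σ.δ) ^ ((k : ℕ) + 1) < p j ∧ p j ≤ σ.top * (1 - σ.δ) ^ (k : ℕ)}

/-- The schedule `S` of the jobs `p` is generated from the sketch schedule: in every interval of
the sketch, each machine `i` gets at most `count i k` of the jobs, except that the surplus jobs
(if there are more jobs than estimated) all go to a machine `i₀` with the largest `count i₀ k`.
The jobs outside of the intervals with a positive estimate may be on any machine. -/
def Generates {n : ℕ} (p : Fin n → ℝ) (S : Fin n → Fin m) : Prop :=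
  ∀ k : Fin σ.len, 0 < σ.estimate k →
    ∃ i₀ : Fin m, (∀ i, σ.count i k ≤ σ.count i₀ k) ∧
      ∀ i, ((σ.jobsIn p k).filter (fun j => S j = i)).card ≤
        σ.count i k + (if i = i₀ then (σ.jobsIn p k).card - σ.estimate k else 0)

end SketchSchedule

/-- The sketch schedule that a program leaves in its memory: the number of intervals is natural
variable `0`, `top` and `δ` are real variables `1` and `2`, and the counts are the rows of a
matrix in natural array `0`. -/
def MachineState.sketch (s : MachineState) (m : ℕ) : SketchSchedule m where
  top := s.rvar 1
  δ := s.rvar 2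
  len := s.nvar 0
  count := fun i k => s.narr 0 ((i : ℕ) * s.nvar 0 + k)

/-- The approximate value of the optimal makespan that a program leaves in its memory. -/
def MachineState.value (s : MachineState) : ℝ := s.rvar 0

/-!
# A sampling algorithm for makespan minimization

The algorithm works with the granularity `β = ε / (100 * m)`. An optimal makespan is at least the
average load, so `β * I.total ≤ ε / 100 * OPT`: errors of a few multiples of `β * I.total` are
harmless on a single machine.

*First stage.* Samples are drawn until `K` repetitions (samples of a job that was seen before) have
occurred, where `K` is of the order of `log (1 / (β * γ)) / β ^ 2`. By a birthday argument this
takes `O(√n * K)` samples. The probability of a repetition is the seen part of the total processing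
time, so dividing the sum of the seen parts by the number of repetitions estimates the total
processing time up to a factor `1 + O(β)`. All jobs of size at least `β ^ 2 / 2 * I.total` have been
seen, and the samples show where a geometric grid of ratio `1 - β` may end: the jobs below its last
interval have mass at most `4 * β`, and the grid has `O(log (n / β) / β)` intervals
(`JobInstance.Typical.exists_firstStage`).

*Schedule.* The jobs above `β ^ 2` times the estimated total are known individually; the rest is
replaced by sand, that is, by items of size `θ = β` times the estimated total, and small known jobs
are bundled. This leaves `O(1 / β)` items, whose optimum exceeds that of the jobs by `O(β)` times
the total only (`Packing.opt_le`). The black box schedules the items. List scheduling of the unknown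
jobs on top of this schedule shows that its makespan, slightly enlarged, is an upper bound for the
optimum (`SketchData.Computed.opt_le`).

*Sketch.* A second stage estimates, for every interval of the grid, the mass of its jobs, with
relative error `β` and a small additive error. A machine gets its known jobs, and of each later
interval a number of jobs proportional to its share of the sand. The surplus jobs of all intervals
together have size `O(β)` times the total, so that every generated schedule is nearly as good as the
schedule of the items (`SketchData.Computed.load_le`).

All deviation bounds come from one exponential supermartingale for families of sets that depend on
the earlier samples only (`JobInstance.sampleLaw_not_concentrated_le`); their union is the event
`JobInstance.Typical`. That the program computes these quantities within the claimed number of steps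
is derived with a total-correctness calculus of preconditions (`Wp`), whose loop rule bounds the
number of rounds and tracks which variables a program can write (`Frame`); the result is
`wp_sketchProg`.
-/

/-! ### Loads, makespans and greedy schedules -/

theorem load_le_makespan {n m : ℕ} (p : Fin n → ℝ) (S : Fin n → Fin m) (i : Fin m) :
    ∑ j with S j = i, p j ≤ makespan p S :=
  le_ciSup (f := fun i => ∑ j with S j = i, p j) (Set.finite_range _).bddAbove i

theorem makespan_le {n m : ℕ} (hm : 0 < m) {p : Fin n → ℝ} {S : Fin n → Fin m} {B : ℝ}
    (h : ∀ i, ∑ j with S j = i, p j ≤ B) : makespan p S ≤ B := by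
  have : Nonempty (Fin m) := ⟨⟨0, hm⟩⟩
  exact ciSup_le h

theorem optMakespan_le {n m : ℕ} (p : Fin n → ℝ) (S : Fin n → Fin m) :
    optMakespan m p ≤ makespan p S :=
  ciInf_le (Set.finite_range _).bddBelow S

theorem exists_makespan_eq_opt {n m : ℕ} (hm : 0 < m) (p : Fin n → ℝ) :
    ∃ S : Fin n → Fin m, makespan p S = optMakespan m p := by
  have : Nonempty (Fin m) := ⟨⟨0, hm⟩⟩
  exact exists_eq_ciInf_of_finite

theorem sum_le_mul_makespan {n m : ℕ} (p : Fin n → ℝ) (S : Fin n → Fin m) :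
    ∑ j, p j ≤ m * makespan p S := by
  rw [← Finset.sum_fiberwise (s := Finset.univ) (g := S) (f := p)]
  refine (Finset.sum_le_card_nsmul _ _ _ fun i _ => load_le_makespan p S i).trans ?_
  simp

theorem JobInstance.total_le_mul_opt (I : JobInstance) {m : ℕ} (hm : 0 < m) :
    I.total ≤ m * optMakespan m I.p := by
  obtain ⟨S, hS⟩ := exists_makespan_eq_opt hm I.p
  rw [← hS]
  exact sum_le_mul_makespan I.p S

/-- List scheduling: a partial schedule with loads at most `B` extends to further items of size
at most `η` without exceeding `B`, provided that the average load plus `η` is at most `B`. -/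
theorem exists_greedy_extension {ι : Type*} [DecidableEq ι] {m : ℕ} (hm : 0 < m) (q : ι → ℝ)
    (base : Finset ι) (f : ι → Fin m) (η B : ℝ)
    (hbase : ∀ i, ∑ e ∈ base with f e = i, q e ≤ B) (s : Finset ι) (hdisj : Disjoint base s)
    (hs : ∀ e ∈ s, q e ≤ η) (hq : ∀ e ∈ s, 0 ≤ q e)
    (htot : ∑ e ∈ base ∪ s, q e + m * η ≤ m * B) :
    ∃ g : ι → Fin m, (∀ e ∈ base, g e = f e) ∧ ∀ i, ∑ e ∈ base ∪ s with g e = i, q e ≤ B := by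
  induction s using Finset.induction_on with
  | empty => exact ⟨f, fun _ _ => rfl, by simpa using hbase⟩
  | insert a s ha ih =>
    rw [Finset.disjoint_insert_right] at hdisj
    have hau : a ∉ base ∪ s := by simp [hdisj.1, ha]
    rw [Finset.union_insert, Finset.sum_insert hau] at htot
    have ha0 := hq a (Finset.mem_insert_self a s)
    obtain ⟨g, hg, hl⟩ := ih hdisj.2 (fun e he => hs e (Finset.mem_insert_of_mem he))
      (fun e he => hq e (Finset.mem_insert_of_mem he)) (by linarith)
    have : Nonempty (Fin m) := ⟨⟨0, hm⟩⟩
    -- the least loaded machine has at most the average load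
    obtain ⟨i₀, hi₀⟩ : ∃ i₀ : Fin m, ∑ e ∈ base ∪ s with g e = i₀, q e + η ≤ B := by
      by_contra! hcon
      have h1 : ∑ _i : Fin m, (B - η) < ∑ i : Fin m, ∑ e ∈ base ∪ s with g e = i, q e :=
        Finset.sum_lt_sum_of_nonempty Finset.univ_nonempty fun i _ => by linarith [hcon i]
      rw [Finset.sum_fiberwise] at h1
      simp only [Finset.sum_const, Finset.card_univ, Fintype.card_fin, nsmul_eq_mul] at h1
      linarith
    refine ⟨Function.update g a i₀, fun e he => ?_, fun i => ?_⟩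
    · rw [Function.update_of_ne (by rintro rfl; exact hdisj.1 he), hg e he]
    · have hfil : ∀ e ∈ base ∪ s, (Function.update g a i₀ e = i ↔ g e = i) := fun e he => by
        rw [Function.update_of_ne (by rintro rfl; exact hau he)]
      rw [Finset.union_insert, Finset.filter_insert, Finset.filter_congr hfil,
        Function.update_self]
      split_ifs with h
      · subst h
        rw [Finset.sum_insert (by simp [hau])]
        linarith [hs a (Finset.mem_insert_self a s)]
      · exact hl i

/-! ### Concentration for predictable families of sets of jobs -/

/-- A family of sets, one per sampling step, each depending on the earlier samples only. -/
def Predictable {α : Type*} (F : ℕ → (ℕ → α) → Finset α) : Prop :=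
  ∀ i ω ω', (∀ j < i, ω j = ω' j) → F i ω = F i ω'

namespace JobInstance

variable (I : JobInstance)

/-- The probability that a sample hits a set of jobs. -/
noncomputable def mass (S : Finset (Fin I.n)) : ℝ := ∑ j ∈ S, I.p j / I.total

theorem mass_nonneg (S : Finset (Fin I.n)) : 0 ≤ I.mass S :=
  Finset.sum_nonneg fun j _ => div_nonneg (I.p_pos j).le I.total_pos.le

theorem mass_mono {S T : Finset (Fin I.n)} (h : S ⊆ T) : I.mass S ≤ I.mass T :=
  Finset.sum_le_sum_of_subset_of_nonneg h fun j _ _ => div_nonneg (I.p_pos j).le I.total_pos.le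

theorem sum_prob : ∑ j, I.p j / I.total = 1 := by
  rw [← Finset.sum_div]
  exact div_self I.total_pos.ne'

theorem mass_le_one (S : Finset (Fin I.n)) : I.mass S ≤ 1 :=
  (I.mass_mono (Finset.subset_univ S)).trans I.sum_prob.le

theorem mass_eq (S : Finset (Fin I.n)) : I.mass S = (∑ j ∈ S, I.p j) / I.total := by
  rw [mass, Finset.sum_div]

/-- How often the first `N` samples fall into the sets of the family. -/
noncomputable def hitCount (F : ℕ → (ℕ → Fin I.n) → Finset (Fin I.n)) (N : ℕ)
    (ω : ℕ → Fin I.n) : ℝ := ∑ i ∈ Finset.range N, if ω i ∈ F i ω then 1 else 0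

/-- The compensator of `hitCount`. -/
noncomputable def hitMass (F : ℕ → (ℕ → Fin I.n) → Finset (Fin I.n)) (N : ℕ)
    (ω : ℕ → Fin I.n) : ℝ := ∑ i ∈ Finset.range N, I.mass (F i ω)

/-- The number of hits is close to its compensator, up to a relative error `lam` and an additive
error `L / lam`. -/
def Concentrated (F : ℕ → (ℕ → Fin I.n) → Finset (Fin I.n)) (N : ℕ) (lam : ℝ) (L : ℕ)
    (ω : ℕ → Fin I.n) : Prop :=
  |I.hitCount F N ω - I.hitMass F N ω| ≤ lam * I.hitMass F N ω + L / lam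

theorem hitMass_nonneg (F : ℕ → (ℕ → Fin I.n) → Finset (Fin I.n)) (N : ℕ) (ω : ℕ → Fin I.n) :
    0 ≤ I.hitMass F N ω := Finset.sum_nonneg fun _ _ => I.mass_nonneg _

/-- The continuation of a finite word by the job `0`. -/
def extend {N : ℕ} (u : Fin N → Fin I.n) : ℕ → Fin I.n :=
  fun i => if h : i < N then u ⟨i, h⟩ else ⟨0, I.n_pos⟩

theorem extend_snoc_of_lt {N : ℕ} (u : Fin N → Fin I.n) (a : Fin I.n) {i : ℕ} (hi : i < N) :
    I.extend (Fin.snoc u a : Fin (N + 1) → Fin I.n) i = I.extend u i := by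
  have h : (⟨i, by omega⟩ : Fin (N + 1)) = Fin.castSucc ⟨i, hi⟩ := rfl
  rw [extend, extend, dif_pos (by omega), dif_pos hi, h]
  simp only [Fin.snoc_castSucc]

theorem extend_snoc_self {N : ℕ} (u : Fin N → Fin I.n) (a : Fin I.n) :
    I.extend (Fin.snoc u a : Fin (N + 1) → Fin I.n) N = a := by
  have h : (⟨N, by omega⟩ : Fin (N + 1)) = Fin.last N := rfl
  rw [extend, dif_pos (by omega), h]
  simp only [Fin.snoc_last]

variable {I}

theorem hitCount_congr {F : ℕ → (ℕ → Fin I.n) → Finset (Fin I.n)} (hF : Predictable F) {N : ℕ}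
    {ω ω' : ℕ → Fin I.n} (h : ∀ i < N, ω i = ω' i) : I.hitCount F N ω = I.hitCount F N ω' :=
  Finset.sum_congr rfl fun i hi => by
    have hi := Finset.mem_range.1 hi
    rw [hF i ω ω' fun j hj => h j (by omega), h i hi]

theorem hitMass_congr {F : ℕ → (ℕ → Fin I.n) → Finset (Fin I.n)} (hF : Predictable F) {N : ℕ}
    {ω ω' : ℕ → Fin I.n} (h : ∀ i < N, ω i = ω' i) : I.hitMass F N ω = I.hitMass F N ω' :=
  Finset.sum_congr rfl fun i hi => by
    have hi := Finset.mem_range.1 hi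
    rw [hF i ω ω' fun j hj => h j (by omega)]

/-- The exponential supermartingale of the process that counts the hits. -/
theorem sum_exp_hits_le_one {F : ℕ → (ℕ → Fin I.n) → Finset (Fin I.n)} (hF : Predictable F)
    (lam : ℝ) (N : ℕ) :
    ∑ u : Fin N → Fin I.n, (∏ i, I.p (u i) / I.total) *
      Real.exp (lam * I.hitCount F N (I.extend u)
        - (Real.exp lam - 1) * I.hitMass F N (I.extend u)) ≤ 1 := by
  induction N with
  | zero => simp [hitCount, hitMass]
  | succ N ih =>
    refine le_trans ?_ ih
    rw [← (Fin.snocEquiv (fun _ : Fin (N + 1) => Fin I.n)).sum_comp, Fintype.sum_prod_type_right]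
    refine Finset.sum_le_sum fun u _ => ?_
    have hpre : ∀ a : Fin I.n, ∀ i < N,
        I.extend (Fin.snoc u a : Fin (N + 1) → Fin I.n) i = I.extend u i :=
      fun a i hi => I.extend_snoc_of_lt u a hi
    have key : ∀ a : Fin I.n,
        (∏ i, I.p ((Fin.snoc u a : Fin (N + 1) → Fin I.n) i) / I.total) *
          Real.exp (lam * I.hitCount F (N + 1) (I.extend (Fin.snoc u a : Fin (N + 1) → Fin I.n))
            - (Real.exp lam - 1) *
              I.hitMass F (N + 1) (I.extend (Fin.snoc u a : Fin (N + 1) → Fin I.n))) =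
        ((∏ i, I.p (u i) / I.total) * Real.exp (lam * I.hitCount F N (I.extend u)
          - (Real.exp lam - 1) * I.hitMass F N (I.extend u)) *
          Real.exp (-((Real.exp lam - 1) * I.mass (F N (I.extend u))))) *
        (I.p a / I.total * Real.exp (lam * if a ∈ F N (I.extend u) then 1 else 0)) := by
      intro a
      rw [Fin.prod_univ_castSucc]
      simp only [Fin.snoc_castSucc, Fin.snoc_last]
      have h1 : I.hitCount F (N + 1) (I.extend (Fin.snoc u a : Fin (N + 1) → Fin I.n)) =
          I.hitCount F N (I.extend u) + if a ∈ F N (I.extend u) then 1 else 0 := by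
        rw [← hitCount_congr hF (hpre a), hitCount, Finset.sum_range_succ, extend_snoc_self,
          hF N _ _ (hpre a)]
        rfl
      have h2 : I.hitMass F (N + 1) (I.extend (Fin.snoc u a : Fin (N + 1) → Fin I.n)) =
          I.hitMass F N (I.extend u) + I.mass (F N (I.extend u)) := by
        rw [← hitMass_congr hF (hpre a), hitMass, Finset.sum_range_succ, hF N _ _ (hpre a)]
        rfl
      rw [h1, h2, show lam * (I.hitCount F N (I.extend u) +
          if a ∈ F N (I.extend u) then 1 else 0) - (Real.exp lam - 1) *
          (I.hitMass F N (I.extend u) + I.mass (F N (I.extend u))) =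
          (lam * I.hitCount F N (I.extend u)
          - (Real.exp lam - 1) * I.hitMass F N (I.extend u)) +
          -((Real.exp lam - 1) * I.mass (F N (I.extend u))) +
          lam * (if a ∈ F N (I.extend u) then 1 else 0) by ring, Real.exp_add, Real.exp_add]
      ring
    have hstep : ∑ a, (I.p a / I.total *
        Real.exp (lam * if a ∈ F N (I.extend u) then 1 else 0)) ≤
        Real.exp ((Real.exp lam - 1) * I.mass (F N (I.extend u))) := by
      have h3 : ∀ a, I.p a / I.total *
          Real.exp (lam * if a ∈ F N (I.extend u) then 1 else 0) =
          I.p a / I.total + (Real.exp lam - 1) *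
            (if a ∈ F N (I.extend u) then I.p a / I.total else 0) := by
        intro a
        split_ifs
        · simp only [mul_one]; ring
        · simp
      rw [Finset.sum_congr rfl fun a _ => h3 a, Finset.sum_add_distrib, I.sum_prob,
        ← Finset.mul_sum, Finset.sum_ite_mem, Finset.univ_inter]
      have := Real.add_one_le_exp ((Real.exp lam - 1) * I.mass (F N (I.extend u)))
      rw [mass] at this ⊢
      linarith
    have hw : 0 ≤ (∏ i, I.p (u i) / I.total) * Real.exp (lam * I.hitCount F N (I.extend u)
          - (Real.exp lam - 1) * I.hitMass F N (I.extend u)) :=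
      mul_nonneg (Finset.prod_nonneg fun i _ => div_nonneg (I.p_pos _).le I.total_pos.le)
        (Real.exp_pos _).le
    calc _ = ∑ a, _ := Finset.sum_congr rfl fun a _ => key a
      _ = _ := (Finset.mul_sum _ _ _).symm
      _ ≤ _ := mul_le_mul_of_nonneg_left hstep (mul_nonneg hw (Real.exp_pos _).le)
      _ = _ := by rw [mul_assoc, ← Real.exp_add, neg_add_cancel, Real.exp_zero, mul_one]

theorem weightedSample_apply (j : Fin I.n) :
    I.weightedSample.toMeasure {j} = ENNReal.ofReal (I.p j / I.total) := by
  rw [PMF.toMeasure_apply_singleton _ _ (MeasurableSet.singleton j)]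
  rfl

theorem sampleLaw_cylinder {N : ℕ} (u : Fin N → Fin I.n) :
    I.sampleLaw {ω | ∀ i : Fin N, ω i = u i} =
      ENNReal.ofReal (∏ i, I.p (u i) / I.total) := by
  have h : {ω : ℕ → Fin I.n | ∀ i : Fin N, ω i = u i} =
      Set.pi (Finset.range N) (fun i => {I.extend u i}) := by
    ext ω
    simp only [Set.mem_ofPred_eq, Set.mem_pi, Finset.coe_range, Set.mem_Iio,
      Set.mem_singleton_iff]
    constructor
    · intro h i hi
      rw [extend, dif_pos hi]
      exact h ⟨i, hi⟩
    · intro h i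
      have := h i i.2
      rwa [extend, dif_pos i.2] at this
  rw [h, sampleLaw, MeasureTheory.Measure.infinitePi_pi _ fun i _ => MeasurableSet.singleton _]
  simp only [weightedSample_apply]
  rw [← ENNReal.ofReal_prod_of_nonneg fun i _ => div_nonneg (I.p_pos _).le I.total_pos.le,
    ← Fin.prod_univ_eq_prod_range (fun i => I.p (I.extend u i) / I.total)]
  simp [extend]

/-- Markov's inequality for the exponential supermartingale. -/
theorem sampleLaw_exp_tail {F : ℕ → (ℕ → Fin I.n) → Finset (Fin I.n)} (hF : Predictable F)
    (lam : ℝ) (N L : ℕ) :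
    I.sampleLaw {ω | (L : ℝ) ≤ lam * I.hitCount F N ω - (Real.exp lam - 1) * I.hitMass F N ω} ≤
      ENNReal.ofReal ((1 / 2) ^ L) := by
  classical
  set T : (ℕ → Fin I.n) → ℝ := fun ω =>
    lam * I.hitCount F N ω - (Real.exp lam - 1) * I.hitMass F N ω with hT
  set bad : Finset (Fin N → Fin I.n) := {u | (L : ℝ) ≤ T (I.extend u)}
  have hsub : {ω | (L : ℝ) ≤ T ω} ⊆ ⋃ u ∈ bad, {ω : ℕ → Fin I.n | ∀ i : Fin N, ω i = u i} := by
    intro ω hω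
    have hpre : ∀ i < N, ω i = I.extend (fun i : Fin N => ω i) i := fun i hi => by
      rw [extend, dif_pos hi]
    have hTe : T ω = T (I.extend fun i : Fin N => ω i) := by
      simp only [hT, hitCount_congr hF hpre, hitMass_congr hF hpre]
    refine Set.mem_biUnion (x := fun i : Fin N => ω i) ?_ (fun i => rfl)
    simp only [bad, Finset.mem_coe, Finset.mem_filter, Finset.mem_univ, true_and]
    rw [← hTe]
    exact hω
  refine (MeasureTheory.measure_mono hsub).trans
    ((MeasureTheory.measure_biUnion_finset_le _ _).trans ?_)
  simp only [sampleLaw_cylinder]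
  have hw : ∀ u : Fin N → Fin I.n, 0 ≤ ∏ i, I.p (u i) / I.total := fun u =>
    Finset.prod_nonneg fun i _ => div_nonneg (I.p_pos _).le I.total_pos.le
  rw [← ENNReal.ofReal_sum_of_nonneg fun u _ => hw u]
  refine ENNReal.ofReal_le_ofReal ?_
  have h1 : Real.exp L * ∑ u ∈ bad, ∏ i, I.p (u i) / I.total ≤ 1 := by
    rw [Finset.mul_sum]
    refine le_trans ?_ (sum_exp_hits_le_one hF lam N)
    refine le_trans (Finset.sum_le_sum fun u hu => ?_)
      (Finset.sum_le_sum_of_subset_of_nonneg (Finset.subset_univ bad)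
        fun u _ _ => mul_nonneg (hw u) (Real.exp_pos _).le)
    rw [mul_comm]
    refine mul_le_mul_of_nonneg_left (Real.exp_le_exp.2 ?_) (hw u)
    exact (Finset.mem_filter.1 hu).2
  have h2 : (2 : ℝ) ^ L ≤ Real.exp L := by
    rw [← mul_one (L : ℝ), Real.exp_nat_mul]
    exact pow_le_pow_left₀ (by norm_num) (by linarith [Real.add_one_le_exp (1 : ℝ)]) L
  have h3 : 0 ≤ ∑ u ∈ bad, ∏ i, I.p (u i) / I.total := Finset.sum_nonneg fun u _ => hw u
  rw [one_div, inv_pow, ← one_div, le_div_iff₀ (by positivity), mul_comm]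
  exact (mul_le_mul_of_nonneg_right h2 h3).trans h1

theorem sampleLaw_not_concentrated_le {F : ℕ → (ℕ → Fin I.n) → Finset (Fin I.n)}
    (hF : Predictable F) (N L : ℕ) {lam : ℝ} (h0 : 0 < lam) (h1 : lam ≤ 1) :
    I.sampleLaw {ω | ¬ I.Concentrated F N lam L ω} ≤ ENNReal.ofReal (2 * (1 / 2) ^ L) := by
  have hsub : {ω | ¬ I.Concentrated F N lam L ω} ⊆
      {ω | (L : ℝ) ≤ lam * I.hitCount F N ω - (Real.exp lam - 1) * I.hitMass F N ω} ∪
      {ω | (L : ℝ) ≤ -lam * I.hitCount F N ω - (Real.exp (-lam) - 1) * I.hitMass F N ω} := by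
    intro ω hω
    simp only [Set.mem_ofPred_eq, Concentrated, not_le] at hω
    have hV := I.hitMass_nonneg F N ω
    have e1 := (abs_le.1 (Real.abs_exp_sub_one_sub_id_le (x := lam) (by rwa [abs_of_pos h0]))).2
    have e2 := (abs_le.1 (Real.abs_exp_sub_one_sub_id_le (x := -lam)
      (by rwa [abs_neg, abs_of_pos h0]))).2
    have hL : lam * (L / lam) = L := by field_simp
    have m1 := mul_le_mul_of_nonneg_right e1 hV
    have m2 := mul_le_mul_of_nonneg_right e2 hV
    rcases lt_abs.1 hω with h | h
    · left
      have := mul_lt_mul_of_pos_left h h0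
      simp only [Set.mem_ofPred_eq]
      nlinarith
    · right
      have := mul_lt_mul_of_pos_left h h0
      simp only [Set.mem_ofPred_eq]
      nlinarith
  refine (MeasureTheory.measure_mono hsub).trans ((MeasureTheory.measure_union_le _ _).trans ?_)
  rw [two_mul, ENNReal.ofReal_add (by positivity) (by positivity)]
  exact add_le_add (sampleLaw_exp_tail hF lam N L) (sampleLaw_exp_tail hF (-lam) N L)

end JobInstance

/-! ### The quantities that the algorithm computes from the samples -/

/-- The least `L` with `x ≤ γ * 2 ^ L`. -/
noncomputable def confidence (γ x : ℝ) : ℕ := ⌈Real.logb 2 (x / γ)⌉₊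

theorem le_mul_two_pow_iff {γ x : ℝ} (hγ : 0 < γ) (hx : 0 < x) (L : ℕ) :
    x ≤ 2 ^ L * γ ↔ confidence γ x ≤ L := by
  rw [confidence, Nat.ceil_le, Real.logb_le_iff_le_rpow (by norm_num) (by positivity),
    Real.rpow_natCast, div_le_iff₀ hγ]

theorem half_pow_confidence_le {γ x : ℝ} (hγ : 0 < γ) (hx : 0 < x) :
    (1 / 2 : ℝ) ^ confidence γ x ≤ γ / x := by
  have := (le_mul_two_pow_iff hγ hx _).2 le_rfl
  rw [one_div, inv_pow, ← one_div, div_le_div_iff₀ (by positivity) hx]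
  linarith

theorem confidence_mono {γ x y : ℝ} (hγ : 0 < γ) (hx : 0 < x) (hxy : x ≤ y) :
    confidence γ x ≤ confidence γ y :=
  (le_mul_two_pow_iff hγ hx _).1
    (hxy.trans ((le_mul_two_pow_iff hγ (hx.trans_le hxy) _).2 le_rfl))

theorem one_le_confidence {γ x : ℝ} (hγ : 0 < γ) (hγ1 : γ < 1) (hx : 1 ≤ x) :
    1 ≤ confidence γ x := by
  by_contra! h
  have := (le_mul_two_pow_iff hγ (by linarith : 0 < x) 0).2 (by omega)
  simp at this
  linarith

/-- The confidence parameter of the first sampling stage. -/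
noncomputable def firstConfidence (β γ : ℝ) : ℕ := confidence γ (32 / β ^ 2)

/-- The number of repetitions after which the first sampling stage stops. -/
noncomputable def repetitionGoal (β γ : ℝ) : ℝ := 32 * firstConfidence β γ / β ^ 2

/-- The confidence parameter of the second sampling stage, for `t` intervals and a first stage
of length `τ`. -/
noncomputable def secondConfidence (γ : ℝ) (t τ : ℕ) : ℕ :=
  confidence γ (16 * ((t : ℝ) + 1) ^ 2 * ((τ : ℝ) + 1) ^ 2)

/-- The number of intervals of relative width `β` that cover the range from `1` to `β ^ 2`. -/
noncomputable def knownLength (β : ℝ) : ℕ := sInf {k | (1 - β) ^ k ≤ β ^ 2}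

namespace JobInstance

variable (I : JobInstance)

/-- The jobs that appear among the first `i` samples. -/
def seen (ω : ℕ → Fin I.n) (i : ℕ) : Finset (Fin I.n) := (Finset.range i).image ω

/-- The number of repetitions among the first `i` samples. -/
def hits (ω : ℕ → Fin I.n) (i : ℕ) : ℕ := ((Finset.range i).filter fun j => ω j ∈ I.seen ω j).card

/-- The sum, over the first `i` samples, of the total size of the jobs that were seen before. -/
noncomputable def weightSum (ω : ℕ → Fin I.n) (i : ℕ) : ℝ :=
  ∑ j ∈ Finset.range i, ∑ a ∈ I.seen ω j, I.p a

/-- The estimate of the total processing time after `i` samples: each sample is a repetition with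
a probability equal to the share of the jobs that were seen before. The factor `1 + 3 * β` makes
the estimate an upper bound. -/
noncomputable def totalEstimate (β : ℝ) (ω : ℕ → Fin I.n) (i : ℕ) : ℝ :=
  I.weightSum ω i / I.hits ω i * (1 + 3 * β)

/-- The jobs of size at most `s`. -/
noncomputable def below (s : ℝ) : Finset (Fin I.n) := {j | I.p j ≤ s}

/-- The number of intervals of the sketch: the mass below the last interval is estimated to be at
most `β`. -/
noncomputable def sketchLength (β : ℝ) (ω : ℕ → Fin I.n) (i : ℕ) : ℕ :=
  sInf {k | knownLength β < k ∧
    (((Finset.range i).filter fun j =>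
      I.p (ω j) ≤ I.totalEstimate β ω i * (1 - β) ^ k).card : ℝ) ≤ β * i}

/-- The number of samples in the second stage, after a first stage of length `i`. -/
noncomputable def secondCount (β γ : ℝ) (ω : ℕ → Fin I.n) (i : ℕ) : ℕ :=
  ⌈(I.sketchLength β ω i : ℝ) * secondConfidence γ (I.sketchLength β ω i) i / β ^ 2⌉₊

/-- The jobs of the `k`-th interval of the geometric grid below `top`. -/
noncomputable def interval (top β : ℝ) (k : ℕ) : Finset (Fin I.n) :=
  {j | top * (1 - β) ^ (k + 1) < I.p j ∧ I.p j ≤ top * (1 - β) ^ k}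

/-- The family that coincides with `G` until there are `K` repetitions and is empty from then
on. -/
noncomputable def stopped (K : ℝ) (G : ℕ → (ℕ → Fin I.n) → Finset (Fin I.n)) (i : ℕ)
    (ω : ℕ → Fin I.n) : Finset (Fin I.n) :=
  if (I.hits ω i : ℝ) < K then G i ω else ∅

/-- The `k`-th interval, as the target of the samples of a second stage that follows a first stage
of length `τ`. -/
noncomputable def secondStage (β γ : ℝ) (τ k : ℕ) (i : ℕ) (ω : ℕ → Fin I.n) :
    Finset (Fin I.n) :=
  if τ ≤ i ∧ i < τ + I.secondCount β γ ω τ then I.interval (I.totalEstimate β ω τ) β k else ∅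

variable {I}

/-! ### Predictability -/

theorem seen_congr {ω ω' : ℕ → Fin I.n} {i : ℕ} (h : ∀ j < i, ω j = ω' j) :
    I.seen ω i = I.seen ω' i :=
  Finset.image_congr fun j hj => h j (by simpa using hj)

theorem hits_congr {ω ω' : ℕ → Fin I.n} {i : ℕ} (h : ∀ j < i, ω j = ω' j) :
    I.hits ω i = I.hits ω' i := by
  rw [hits, hits]
  congr 1
  refine Finset.filter_congr fun j hj => ?_
  have hj := Finset.mem_range.1 hj
  rw [seen_congr fun l hl => h l (by omega), h j hj]

theorem totalEstimate_congr (β : ℝ) {ω ω' : ℕ → Fin I.n} {i : ℕ} (h : ∀ j < i, ω j = ω' j) :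
    I.totalEstimate β ω i = I.totalEstimate β ω' i := by
  rw [totalEstimate, totalEstimate, hits_congr h, weightSum, weightSum]
  congr 2
  refine Finset.sum_congr rfl fun j hj => ?_
  have hj := Finset.mem_range.1 hj
  rw [seen_congr fun l hl => h l (by omega)]

theorem sketchLength_congr (β : ℝ) {ω ω' : ℕ → Fin I.n} {i : ℕ} (h : ∀ j < i, ω j = ω' j) :
    I.sketchLength β ω i = I.sketchLength β ω' i := by
  have h1 : ∀ s : ℝ, ((Finset.range i).filter fun j => I.p (ω j) ≤ s) =
      (Finset.range i).filter fun j => I.p (ω' j) ≤ s := fun s =>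
    Finset.filter_congr fun j hj => by rw [h j (Finset.mem_range.1 hj)]
  rw [sketchLength, sketchLength, totalEstimate_congr β h]
  simp only [h1]

theorem predictable_seen : Predictable fun i (ω : ℕ → Fin I.n) => I.seen ω i :=
  fun _ _ _ h => seen_congr h

theorem predictable_const (S : Finset (Fin I.n)) :
    Predictable fun (_ : ℕ) (_ : ℕ → Fin I.n) => S := fun _ _ _ _ => rfl

theorem predictable_stopped {G : ℕ → (ℕ → Fin I.n) → Finset (Fin I.n)} (hG : Predictable G)
    (K : ℝ) : Predictable (I.stopped K G) := fun i ω ω' h => by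
  rw [JobInstance.stopped, JobInstance.stopped, hits_congr h, hG i ω ω' h]

theorem predictable_secondStage (β γ : ℝ) (τ k : ℕ) : Predictable (I.secondStage β γ τ k) := by
  intro i ω ω' h
  rw [secondStage, secondStage]
  by_cases hi : τ ≤ i
  · have h' : ∀ j < τ, ω j = ω' j := fun j hj => h j (by omega)
    rw [secondCount, secondCount, sketchLength_congr β h', totalEstimate_congr β h']
  · rw [if_neg (by tauto), if_neg (by tauto)]

variable (I)

/-! ### Typical samples -/

/-- A bound for the length of the first stage: with high probability it has at most twice this
many samples. -/
noncomputable def halfHorizon (β γ : ℝ) : ℕ := ⌈8 * √(I.n : ℝ) * repetitionGoal β γ⌉₊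

/-- The jobs that are lighter than half the average. -/
noncomputable def light : Finset (Fin I.n) := {j | I.p j / I.total < 1 / (2 * I.n)}

/-- The deviation bounds that are used in the analysis. `T` is a set of small jobs of noticeable
mass, and `H` bounds the length of the whole sampling process. -/
structure Typical (β γ : ℝ) (T : Finset (Fin I.n)) (H : ℕ) (ω : ℕ → Fin I.n) : Prop where
  repetitions : I.Concentrated (I.stopped (repetitionGoal β γ) fun i ω => I.seen ω i)
    (2 * I.halfHorizon β γ) β (firstConfidence β γ) ω
  repetitions_coarse : I.Concentrated (I.stopped (repetitionGoal β γ) fun i ω => I.seen ω i)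
    (2 * I.halfHorizon β γ) (1 / 2) (firstConfidence β γ) ω
  light : I.Concentrated (fun _ _ => I.light) (I.halfHorizon β γ) (1 / 4) (firstConfidence β γ) ω
  tiny : I.Concentrated (I.stopped (repetitionGoal β γ) fun _ _ =>
    I.below (β * I.total / (2 * I.n))) (2 * I.halfHorizon β γ) (1 / 2) (firstConfidence β γ) ω
  tail : I.Concentrated (I.stopped (repetitionGoal β γ) fun _ _ => T)
    (2 * I.halfHorizon β γ) (1 / 2) (firstConfidence β γ) ω
  single : ∀ j, β ^ 2 / 2 ≤ I.p j / I.total →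
    I.Concentrated (I.stopped (repetitionGoal β γ) fun _ _ => {j})
      (2 * I.halfHorizon β γ) (1 / 2) (firstConfidence β γ) ω
  second : ∀ τ < H, ∀ k < H,
    I.Concentrated (I.secondStage β γ τ k) H β (secondConfidence γ k τ) ω

theorem sum_inv_sq_le (N : ℕ) : ∑ k ∈ Finset.range N, 1 / ((k : ℝ) + 1) ^ 2 ≤ 2 := by
  have h : ∀ N : ℕ, ∑ k ∈ Finset.range (N + 1), 1 / ((k : ℝ) + 1) ^ 2 ≤
      2 - 1 / ((N : ℝ) + 1) := by
    intro N
    induction N with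
    | zero => norm_num
    | succ N ih =>
      rw [Finset.sum_range_succ]
      have hN : (0 : ℝ) ≤ N := Nat.cast_nonneg N
      have h2 : 1 / ((N : ℝ) + 1 + 1) ^ 2 ≤ 1 / ((N : ℝ) + 1) - 1 / ((N : ℝ) + 1 + 1) := by
        rw [div_sub_div _ _ (by positivity) (by positivity),
          div_le_div_iff₀ (by positivity) (by positivity)]
        nlinarith
      push_cast
      linarith
  cases N with
  | zero => simp
  | succ N =>
    have : 0 ≤ 1 / ((N : ℝ) + 1) := by positivity
    linarith [h N]

theorem card_single_le {β : ℝ} (hβ : 0 < β) :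
    ((Finset.univ.filter fun j => β ^ 2 / 2 ≤ I.p j / I.total).card : ℝ) ≤ 2 / β ^ 2 := by
  have h := I.mass_le_one (Finset.univ.filter fun j => β ^ 2 / 2 ≤ I.p j / I.total)
  have h2 := Finset.card_nsmul_le_sum (Finset.univ.filter fun j => β ^ 2 / 2 ≤ I.p j / I.total)
    (fun j => I.p j / I.total) (β ^ 2 / 2) fun j hj => (Finset.mem_filter.1 hj).2
  rw [nsmul_eq_mul] at h2
  rw [le_div_iff₀ (by positivity)]
  rw [mass] at h
  linarith

theorem sampleLaw_not_typical_le {β γ : ℝ} (hβ : 0 < β) (hβ1 : β ≤ 1 / 100) (hγ : 0 < γ)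
    (T : Finset (Fin I.n)) (H : ℕ) :
    I.sampleLaw {ω | ¬ I.Typical β γ T H ω} ≤ ENNReal.ofReal γ := by
  set r : ℝ := 2 * (1 / 2) ^ firstConfidence β γ with hr
  have hr0 : 0 ≤ r := by positivity
  have hrle : r ≤ γ * β ^ 2 / 16 := by
    have h := half_pow_confidence_le hγ (x := 32 / β ^ 2) (by positivity)
    rw [← firstConfidence] at h
    rw [hr]
    calc _ ≤ 2 * (γ / (32 / β ^ 2)) := by linarith
      _ = _ := by field_simp; norm_num
  set D : Finset (Fin I.n) := Finset.univ.filter fun j => β ^ 2 / 2 ≤ I.p j / I.total with hD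
  set K := repetitionGoal β γ
  set M := I.halfHorizon β γ
  set L := firstConfidence β γ
  have hsub : {ω | ¬ I.Typical β γ T H ω} ⊆
      {ω | ¬ I.Concentrated (I.stopped K fun i ω => I.seen ω i) (2 * M) β L ω} ∪
      ({ω | ¬ I.Concentrated (I.stopped K fun i ω => I.seen ω i) (2 * M) (1 / 2) L ω} ∪
      ({ω | ¬ I.Concentrated (fun _ _ => I.light) M (1 / 4) L ω} ∪
      ({ω | ¬ I.Concentrated (I.stopped K fun _ _ => I.below (β * I.total / (2 * I.n)))
        (2 * M) (1 / 2) L ω} ∪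
      ({ω | ¬ I.Concentrated (I.stopped K fun _ _ => T) (2 * M) (1 / 2) L ω} ∪
      ((⋃ j ∈ D, {ω | ¬ I.Concentrated (I.stopped K fun _ _ => {j}) (2 * M) (1 / 2) L ω}) ∪
      (⋃ q ∈ Finset.range H ×ˢ Finset.range H, {ω | ¬ I.Concentrated
        (I.secondStage β γ q.1 q.2) H β (secondConfidence γ q.2 q.1) ω})))))) := by
    intro ω hω
    by_contra hcon
    simp only [Set.mem_union, Set.mem_iUnion, not_or, not_exists, Set.mem_ofPred_eq,
      not_not] at hcon
    obtain ⟨h1, h2, h3, h4, h5, h6, h7⟩ := hcon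
    exact hω ⟨h1, h2, h3, h4, h5, fun j hj => h6 j (by simp [hD, hj]),
      fun τ hτ k hk => h7 (τ, k) (by simp [hτ, hk])⟩
  have hS : Predictable fun i (ω : ℕ → Fin I.n) => I.seen ω i := predictable_seen
  have hu : ∀ {A B : Set (ℕ → Fin I.n)} {a b : ℝ}, 0 ≤ a → 0 ≤ b →
      I.sampleLaw A ≤ ENNReal.ofReal a → I.sampleLaw B ≤ ENNReal.ofReal b →
      I.sampleLaw (A ∪ B) ≤ ENNReal.ofReal (a + b) := fun ha hb hA hB => by
    rw [ENNReal.ofReal_add ha hb]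
    exact (MeasureTheory.measure_union_le _ _).trans (add_le_add hA hB)
  have hD0 : I.sampleLaw (⋃ j ∈ D, {ω | ¬ I.Concentrated (I.stopped K fun _ _ => {j})
      (2 * M) (1 / 2) L ω}) ≤ ENNReal.ofReal (D.card * r) := by
    refine (MeasureTheory.measure_biUnion_finset_le _ _).trans ?_
    refine (Finset.sum_le_card_nsmul _ _ (ENNReal.ofReal r) fun j _ =>
      sampleLaw_not_concentrated_le (predictable_stopped (predictable_const _) K) _ _ (by norm_num)
        (by norm_num)).trans ?_
    rw [nsmul_eq_mul, ENNReal.ofReal_mul (Nat.cast_nonneg _), ENNReal.ofReal_natCast]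
  set w : ℕ × ℕ → ℝ := fun q =>
    γ / 8 * (1 / ((q.1 : ℝ) + 1) ^ 2 * (1 / ((q.2 : ℝ) + 1) ^ 2)) with hw
  have hw0 : ∀ q, 0 ≤ w q := fun q => by positivity
  have hQ : I.sampleLaw (⋃ q ∈ Finset.range H ×ˢ Finset.range H, {ω | ¬ I.Concentrated
        (I.secondStage β γ q.1 q.2) H β (secondConfidence γ q.2 q.1) ω}) ≤
      ENNReal.ofReal (γ / 2) := by
    refine (MeasureTheory.measure_biUnion_finset_le _ _).trans ?_
    have h1 : ∀ q : ℕ × ℕ, I.sampleLaw {ω | ¬ I.Concentrated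
        (I.secondStage β γ q.1 q.2) H β (secondConfidence γ q.2 q.1) ω} ≤
        ENNReal.ofReal (w q) := fun q => by
      refine (sampleLaw_not_concentrated_le (predictable_secondStage β γ q.1 q.2) _ _ hβ
        (by linarith)).trans (ENNReal.ofReal_le_ofReal ?_)
      have h := half_pow_confidence_le hγ
        (x := 16 * ((q.2 : ℝ) + 1) ^ 2 * ((q.1 : ℝ) + 1) ^ 2) (by positivity)
      rw [← secondConfidence] at h
      calc _ ≤ 2 * (γ / (16 * ((q.2 : ℝ) + 1) ^ 2 * ((q.1 : ℝ) + 1) ^ 2)) := by linarith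
        _ = _ := by rw [hw]; field_simp; norm_num
    refine (Finset.sum_le_sum fun q _ => h1 q).trans ?_
    rw [← ENNReal.ofReal_sum_of_nonneg fun q _ => hw0 q]
    refine ENNReal.ofReal_le_ofReal ?_
    rw [hw, ← Finset.mul_sum, Finset.sum_product]
    simp only [← Finset.mul_sum]
    rw [← Finset.sum_mul]
    have h2 := sum_inv_sq_le H
    have h3 : 0 ≤ ∑ k ∈ Finset.range H, 1 / ((k : ℝ) + 1) ^ 2 :=
      Finset.sum_nonneg fun k _ => by positivity
    nlinarith [mul_le_mul h2 h2 h3 (by norm_num)]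
  have c1 : ∀ lam : ℝ, 0 < lam → lam ≤ 1 → ∀ G : ℕ → (ℕ → Fin I.n) → Finset (Fin I.n),
      Predictable G → I.sampleLaw {ω | ¬ I.Concentrated (I.stopped K G) (2 * M) lam L ω} ≤
      ENNReal.ofReal r := fun lam h0 h1 G hG =>
    sampleLaw_not_concentrated_le (predictable_stopped hG K) _ _ h0 h1
  have hDr : 0 ≤ (D.card : ℝ) * r := by positivity
  have hfin := hu hr0 (by positivity) (c1 β hβ (by linarith) _ hS)
    (hu hr0 (by positivity) (c1 (1 / 2) (by norm_num) (by norm_num) _ hS)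
    (hu hr0 (by positivity) (sampleLaw_not_concentrated_le (predictable_const I.light) M L
      (lam := 1 / 4) (by norm_num) (by norm_num))
    (hu hr0 (by positivity) (c1 (1 / 2) (by norm_num) (by norm_num) _
      (predictable_const (I.below (β * I.total / (2 * I.n)))))
    (hu hr0 (by positivity) (c1 (1 / 2) (by norm_num) (by norm_num) _ (predictable_const T))
    (hu hDr (by positivity) hD0 hQ)))))
  refine (MeasureTheory.measure_mono hsub).trans (hfin.trans (ENNReal.ofReal_le_ofReal ?_))
  have hc := mul_le_mul (I.card_single_le hβ) hrle hr0 (by positivity)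
  rw [← hD] at hc
  have e1 : 2 / β ^ 2 * (γ * β ^ 2 / 16) = γ / 8 := by field_simp; norm_num
  have e2 : γ * β ^ 2 ≤ γ * 1 := mul_le_mul_of_nonneg_left (by nlinarith) hγ.le
  linarith

end JobInstance

/-! ### What typical samples reveal -/

namespace JobInstance

variable {I : JobInstance}

theorem seen_mono (ω : ℕ → Fin I.n) {i j : ℕ} (h : i ≤ j) : I.seen ω i ⊆ I.seen ω j :=
  Finset.image_subset_image (Finset.range_mono h)

theorem hits_mono (ω : ℕ → Fin I.n) {i j : ℕ} (h : i ≤ j) : I.hits ω i ≤ I.hits ω j :=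
  Finset.card_le_card (Finset.filter_subset_filter _ (Finset.range_mono h))

theorem hits_le (ω : ℕ → Fin I.n) (i : ℕ) : I.hits ω i ≤ i :=
  (Finset.card_filter_le _ _).trans (Finset.card_range i).le

theorem hits_succ (ω : ℕ → Fin I.n) (i : ℕ) :
    I.hits ω (i + 1) = I.hits ω i + if ω i ∈ I.seen ω i then 1 else 0 := by
  rw [hits, hits, Finset.range_add_one, Finset.filter_insert]
  split_ifs <;> simp

theorem hits_eq_sum (ω : ℕ → Fin I.n) (i : ℕ) :
    (I.hits ω i : ℝ) = ∑ j ∈ Finset.range i, if ω j ∈ I.seen ω j then 1 else 0 := by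
  rw [hits, Finset.card_filter]
  push_cast
  rfl

theorem hitCount_stopped {K : ℝ} {G : ℕ → (ℕ → Fin I.n) → Finset (Fin I.n)} {ω : ℕ → Fin I.n}
    {τ N : ℕ} (h1 : K ≤ I.hits ω τ) (h2 : ∀ i < τ, (I.hits ω i : ℝ) < K) (h3 : τ ≤ N) :
    I.hitCount (I.stopped K G) N ω = ∑ i ∈ Finset.range τ, if ω i ∈ G i ω then 1 else 0 := by
  rw [hitCount, ← Finset.sum_subset (Finset.range_mono h3)]
  · refine Finset.sum_congr rfl fun i hi => ?_
    rw [stopped, if_pos (h2 i (Finset.mem_range.1 hi))]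
  · intro i _ hi
    have hi : τ ≤ i := by simpa using hi
    have : (I.hits ω τ : ℝ) ≤ I.hits ω i := Nat.cast_le.2 (hits_mono ω hi)
    simp [stopped, not_lt.2 (h1.trans this)]

theorem hitMass_stopped {K : ℝ} {G : ℕ → (ℕ → Fin I.n) → Finset (Fin I.n)} {ω : ℕ → Fin I.n}
    {τ N : ℕ} (h1 : K ≤ I.hits ω τ) (h2 : ∀ i < τ, (I.hits ω i : ℝ) < K) (h3 : τ ≤ N) :
    I.hitMass (I.stopped K G) N ω = ∑ i ∈ Finset.range τ, I.mass (G i ω) := by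
  rw [hitMass, ← Finset.sum_subset (Finset.range_mono h3)]
  · refine Finset.sum_congr rfl fun i hi => ?_
    rw [stopped, if_pos (h2 i (Finset.mem_range.1 hi))]
  · intro i _ hi
    have hi : τ ≤ i := by simpa using hi
    have : (I.hits ω τ : ℝ) ≤ I.hits ω i := Nat.cast_le.2 (hits_mono ω hi)
    simp [stopped, not_lt.2 (h1.trans this), mass]

theorem mem_below {s : ℝ} {j : Fin I.n} : j ∈ I.below s ↔ I.p j ≤ s := by simp [below]

theorem below_mono {s s' : ℝ} (h : s ≤ s') : I.below s ⊆ I.below s' := fun _ hj =>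
  mem_below.2 ((mem_below.1 hj).trans h)

variable (I) in
/-- The smallest initial segment, in the order of the sizes, with a mass of more than `c`. -/
theorem exists_tail {c : ℝ} (h0 : 0 ≤ c) (hc : c < 1) :
    ∃ T : Finset (Fin I.n), c < I.mass T ∧ ∀ s, c < I.mass (I.below s) → T ⊆ I.below s := by
  set D : Finset (Fin I.n) := {j | c < I.mass (I.below (I.p j))} with hD
  have htop : ∀ s, c < I.mass (I.below s) → ∃ j ∈ D, I.p j ≤ s := by
    intro s hs
    have hne : (I.below s).Nonempty := by
      rw [Finset.nonempty_iff_ne_empty]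
      intro h
      rw [h] at hs
      simp [mass] at hs
      linarith
    obtain ⟨j, hj, hmax⟩ := Finset.exists_max_image (I.below s) I.p hne
    refine ⟨j, ?_, mem_below.1 hj⟩
    simp only [hD, Finset.mem_filter, Finset.mem_univ, true_and]
    exact hs.trans_le (I.mass_mono fun l hl => mem_below.2 (hmax l hl))
  obtain ⟨j, hj, hmin⟩ := Finset.exists_min_image D I.p (by
    obtain ⟨j, hj, -⟩ := htop (∑ j, I.p j) (by
      have : I.below (∑ j, I.p j) = Finset.univ := by
        ext j
        simp only [mem_below, Finset.mem_univ, iff_true]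
        exact Finset.single_le_sum (f := I.p) (fun l _ => (I.p_pos l).le) (Finset.mem_univ j)
      rw [this, mass, I.sum_prob]
      exact hc)
    exact ⟨j, hj⟩)
  refine ⟨I.below (I.p j), (Finset.mem_filter.1 hj).2, fun s hs => ?_⟩
  obtain ⟨l, hl, hls⟩ := htop s hs
  exact below_mono ((hmin l hl).trans hls)

theorem firstConfidence_pos {β γ : ℝ} (hβ : 0 < β) (hβ1 : β ≤ 1 / 100) (hγ : 0 < γ)
    (hγ1 : γ < 1) : 1 ≤ firstConfidence β γ :=
  one_le_confidence hγ hγ1 (by rw [le_div_iff₀ (by positivity)]; nlinarith)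

theorem repetitionGoal_ge {β γ : ℝ} (hβ : 0 < β) (hβ1 : β ≤ 1 / 100) :
    32 * (firstConfidence β γ : ℝ) ≤ repetitionGoal β γ := by
  rw [repetitionGoal, le_div_iff₀ (by positivity)]
  have : (0 : ℝ) ≤ firstConfidence β γ := Nat.cast_nonneg _
  have h : β ^ 2 ≤ 1 := by nlinarith
  nlinarith

/-- By the pigeonhole principle, `M` samples either contain many repetitions or show many jobs of
at least half the average size; in the latter case the next `M` samples contain many
repetitions. -/
theorem Typical.hits_ge {β γ : ℝ} (hβ : 0 < β) (hβ1 : β ≤ 1 / 100) (hγ : 0 < γ) (hγ1 : γ < 1)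
    {T : Finset (Fin I.n)} {H : ℕ} {ω : ℕ → Fin I.n} (h : I.Typical β γ T H ω) :
    repetitionGoal β γ ≤ I.hits ω (2 * I.halfHorizon β γ) := by
  by_contra! hlt
  have hL1 : (1 : ℝ) ≤ firstConfidence β γ := by
    exact_mod_cast firstConfidence_pos hβ hβ1 hγ hγ1
  have hK := repetitionGoal_ge (γ := γ) hβ hβ1
  set K := repetitionGoal β γ
  set L := firstConfidence β γ
  set M := I.halfHorizon β γ with hM
  have hn : (1 : ℝ) ≤ I.n := by exact_mod_cast I.n_pos
  have hsq : (1 : ℝ) ≤ √(I.n : ℝ) := by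
    rw [show (1 : ℝ) = √1 by simp]
    exact Real.sqrt_le_sqrt hn
  have hK0 : 0 ≤ K := by linarith
  have hMK : 8 * √(I.n : ℝ) * K ≤ M := Nat.le_ceil _
  have hMK1 : 8 * K ≤ M := by nlinarith
  have hMn : 64 * I.n * K ≤ (M : ℝ) ^ 2 := by
    have h1 : (8 * √(I.n : ℝ) * K) ^ 2 ≤ (M : ℝ) ^ 2 :=
      pow_le_pow_left₀ (by positivity) hMK 2
    have h2 : (8 * √(I.n : ℝ) * K) ^ 2 = 64 * I.n * K * K := by
      rw [mul_pow, mul_pow, Real.sq_sqrt (by linarith)]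
      ring
    have h3 : 64 * I.n * K * 1 ≤ 64 * I.n * K * K :=
      mul_le_mul_of_nonneg_left (by linarith) (by nlinarith)
    linarith
  have hall : ∀ i ≤ 2 * M, (I.hits ω i : ℝ) < K := fun i hi =>
    (Nat.cast_le.2 (hits_mono ω hi)).trans_lt hlt
  -- at least a quarter of the first `M` samples are heavy
  have hlight := h.light
  rw [Concentrated, hitCount, hitMass, Finset.sum_const, Finset.card_range, nsmul_eq_mul]
    at hlight
  have hlm : I.mass I.light ≤ 1 / 2 := by
    refine (Finset.sum_le_card_nsmul _ _ (1 / (2 * I.n : ℝ)) fun j hj =>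
      (Finset.mem_filter.1 hj).2.le).trans ?_
    rw [nsmul_eq_mul, mul_one_div, div_le_div_iff₀ (by positivity) (by norm_num)]
    have : (I.light.card : ℝ) ≤ I.n := by
      exact_mod_cast (Finset.card_le_univ _).trans (Fintype.card_fin _).le
    linarith
  have hlc : ∑ i ∈ Finset.range M, (if ω i ∈ I.light then (1 : ℝ) else 0) ≤ 3 / 4 * M := by
    have h1 := (abs_le.1 hlight).2
    have h2 : (M : ℝ) * I.mass I.light ≤ M * (1 / 2) :=
      mul_le_mul_of_nonneg_left hlm (Nat.cast_nonneg _)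
    linarith
  have hheavy : (M : ℝ) / 4 ≤ ((Finset.range M).filter fun i => ω i ∉ I.light).card := by
    have h1 := Finset.card_filter_add_card_filter_not (s := Finset.range M)
      (fun i => ω i ∈ I.light)
    rw [Finset.card_range] at h1
    have h2 : (((Finset.range M).filter fun i => ω i ∈ I.light).card : ℝ) ≤ 3 / 4 * M := by
      rw [Finset.card_filter]
      push_cast
      exact hlc
    have h3 : (((Finset.range M).filter fun i => ω i ∈ I.light).card : ℝ) +
        ((Finset.range M).filter fun i => ω i ∉ I.light).card = M := by exact_mod_cast h1
    linarith
  -- so that many heavy jobs are seen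
  have hdist : ((Finset.range M).filter fun i => ω i ∉ I.light).card ≤
      I.hits ω M + ((I.seen ω M).filter fun j => j ∉ I.light).card := by
    have h1 : ((Finset.range M).filter fun i => ω i ∉ I.light) ⊆
        ((Finset.range M).filter fun i => ω i ∈ I.seen ω i) ∪
        ((Finset.range M).filter fun i => ω i ∉ I.light ∧ ω i ∉ I.seen ω i) := by
      intro i hi
      simp only [Finset.mem_filter, Finset.mem_union] at hi ⊢
      tauto
    refine (Finset.card_le_card h1).trans ((Finset.card_union_le _ _).trans ?_)
    refine Nat.add_le_add_left (Finset.card_le_card_of_injOn ω ?_ ?_) _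
    · intro i hi
      simp only [Finset.coe_filter, Finset.mem_range, Set.mem_ofPred_eq] at hi ⊢
      exact ⟨Finset.mem_image_of_mem ω (Finset.mem_range.2 hi.1), hi.2.1⟩
    · intro i hi j hj hij
      simp only [Finset.coe_filter, Finset.mem_range, Set.mem_ofPred_eq] at hi hj
      rcases lt_trichotomy i j with hlt' | he | hlt'
      · exact absurd (hij ▸ Finset.mem_image_of_mem ω (Finset.mem_range.2 hlt')) hj.2.2
      · exact he
      · exact absurd (hij ▸ Finset.mem_image_of_mem ω (Finset.mem_range.2 hlt')) hi.2.2
  have hmass : (M : ℝ) / (16 * I.n) ≤ I.mass (I.seen ω M) := by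
    have h1 := Finset.card_nsmul_le_sum ((I.seen ω M).filter fun j => j ∉ I.light)
      (fun j => I.p j / I.total) (1 / (2 * I.n : ℝ)) (fun j hj => by
        have := (Finset.mem_filter.1 hj).2
        simpa only [JobInstance.light, Finset.mem_filter, Finset.mem_univ, true_and, not_lt]
          using this)
    have h2 := I.mass_mono (Finset.filter_subset (fun j => j ∉ I.light) (I.seen ω M))
    rw [mass] at h2
    rw [nsmul_eq_mul] at h1
    refine le_trans ?_ (h1.trans h2)
    rw [mul_one_div, div_le_div_iff₀ (by positivity) (by positivity)]
    have h3 : (((Finset.range M).filter fun i => ω i ∉ I.light).card : ℝ) ≤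
      I.hits ω M + ((I.seen ω M).filter fun j => j ∉ I.light).card := by exact_mod_cast hdist
    have h4 := hall M (by omega)
    have h5 : (M : ℝ) / 8 ≤ ((I.seen ω M).filter fun j => j ∉ I.light).card := by linarith
    nlinarith
  -- and that the following samples are often repetitions
  have hco := h.repetitions_coarse
  have hX : I.hitCount (I.stopped K fun i ω => I.seen ω i) (2 * M) ω = I.hits ω (2 * M) := by
    rw [hits_eq_sum, hitCount]
    refine Finset.sum_congr rfl fun i hi => ?_
    rw [stopped, if_pos (hall i (Finset.mem_range.1 hi).le)]
  have hV : (M : ℝ) * (M / (16 * I.n)) ≤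
      I.hitMass (I.stopped K fun i ω => I.seen ω i) (2 * M) ω := by
    have h1 : ∑ i ∈ Finset.Ico M (2 * M), ((M : ℝ) / (16 * I.n)) ≤
        ∑ i ∈ Finset.Ico M (2 * M), I.mass (I.stopped K (fun i ω => I.seen ω i) i ω) := by
      refine Finset.sum_le_sum fun i hi => ?_
      rw [Finset.mem_Ico] at hi
      rw [stopped, if_pos (hall i hi.2.le)]
      exact hmass.trans (I.mass_mono (seen_mono ω hi.1))
    rw [Finset.sum_const, Nat.card_Ico, nsmul_eq_mul, show 2 * M - M = M by omega] at h1
    refine h1.trans (Finset.sum_le_sum_of_subset_of_nonneg ?_ fun _ _ _ => I.mass_nonneg _)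
    intro i hi
    rw [Finset.mem_Ico] at hi
    exact Finset.mem_range.2 hi.2
  rw [Concentrated, hX] at hco
  have h1 := (abs_le.1 hco).1
  have h2 : 4 * K ≤ (M : ℝ) * (M / (16 * I.n)) := by
    rw [← mul_div_assoc, le_div_iff₀ (by positivity)]
    nlinarith
  have h3 : (0 : ℝ) ≤ L := Nat.cast_nonneg _
  linarith

/-- The outcome of the first sampling stage, of length `τ`. -/
structure FirstStage (I : JobInstance) (β γ : ℝ) (ω : ℕ → Fin I.n) (τ : ℕ) : Prop where
  reached : repetitionGoal β γ ≤ I.hits ω τ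
  before : ∀ i < τ, (I.hits ω i : ℝ) < repetitionGoal β γ
  le_horizon : τ ≤ 2 * I.halfHorizon β γ
  total_le : I.total ≤ I.totalEstimate β ω τ
  le_total : I.totalEstimate β ω τ ≤ (1 + 6 * β) * I.total
  mem_seen : ∀ j, β ^ 2 / 2 * I.total ≤ I.p j → j ∈ I.seen ω τ
  length_gt : knownLength β < I.sketchLength β ω τ
  length_count : (((Finset.range τ).filter fun j =>
      I.p (ω j) ≤ I.totalEstimate β ω τ * (1 - β) ^ I.sketchLength β ω τ).card : ℝ) ≤ β * τ
  length_le : β ^ 2 / (4 * I.n) ≤ (1 - β) ^ (I.sketchLength β ω τ - 2)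
  mass_rest : I.mass (I.below (I.totalEstimate β ω τ * (1 - β) ^ I.sketchLength β ω τ)) ≤ 4 * β

theorem knownLength_spec {β : ℝ} (hβ : 0 < β) :
    (1 - β) ^ knownLength β ≤ β ^ 2 := by
  obtain ⟨k, hk⟩ := exists_pow_lt_of_lt_one (x := β ^ 2) (y := 1 - β) (by positivity)
    (by linarith)
  exact Nat.sInf_mem (s := {k | (1 - β) ^ k ≤ β ^ 2}) ⟨k, hk.le⟩

theorem lt_pow_of_lt_knownLength {β : ℝ} {k : ℕ} (h : k < knownLength β) :
    β ^ 2 < (1 - β) ^ k := by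
  have := Nat.notMem_of_lt_sInf h
  simpa using this

theorem knownLength_pos {β : ℝ} (hβ : 0 < β) (hβ1 : β ≤ 1 / 100) : 0 < knownLength β := by
  by_contra! h
  have h1 := knownLength_spec hβ
  rw [Nat.le_zero.1 h] at h1
  nlinarith

theorem estimate_bounds {β V h : ℝ} (hβ : 0 < β) (hβ1 : β ≤ 1 / 100) (hh : 0 < h)
    (hc : |h - V| ≤ β * V + β * h / 32) :
    1 ≤ V * (1 + 3 * β) / h ∧ V * (1 + 3 * β) / h ≤ 1 + 6 * β := by
  obtain ⟨c1, c2⟩ := abs_le.1 hc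
  constructor
  · rw [le_div_iff₀ hh, one_mul]
    refine le_of_mul_le_mul_left (a := 1 + β) ?_ (by linarith)
    have h1 : h * (1 - β / 32) ≤ V * (1 + β) := by linarith
    have h2 : h * (1 - β / 32) * (1 + 3 * β) ≤ V * (1 + β) * (1 + 3 * β) :=
      mul_le_mul_of_nonneg_right h1 (by linarith)
    have h3 : (1 + β) ≤ (1 - β / 32) * (1 + 3 * β) := by nlinarith
    have h4 := mul_le_mul_of_nonneg_left h3 hh.le
    linarith
  · rw [div_le_iff₀ hh]
    refine le_of_mul_le_mul_left (a := 1 - β) ?_ (by linarith)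
    have h1 : V * (1 - β) ≤ h * (1 + β / 32) := by linarith
    have h2 : V * (1 - β) * (1 + 3 * β) ≤ h * (1 + β / 32) * (1 + 3 * β) :=
      mul_le_mul_of_nonneg_right h1 (by linarith)
    have h3 : (1 + β / 32) * (1 + 3 * β) ≤ (1 - β) * (1 + 6 * β) := by nlinarith
    have h4 := mul_le_mul_of_nonneg_left h3 hh.le
    linarith

theorem Typical.exists_firstStage {β γ : ℝ} (hβ : 0 < β) (hβ1 : β ≤ 1 / 100) (hγ : 0 < γ)
    (hγ1 : γ < 1) {T : Finset (Fin I.n)} (hT : 4 * β < I.mass T)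
    (hT' : ∀ s, 4 * β < I.mass (I.below s) → T ⊆ I.below s)
    {H : ℕ} {ω : ℕ → Fin I.n} (h : I.Typical β γ T H ω) : ∃ τ, I.FirstStage β γ ω τ := by
  classical
  have hex : ∃ τ, repetitionGoal β γ ≤ I.hits ω τ := ⟨_, h.hits_ge hβ hβ1 hγ hγ1⟩
  set τ := Nat.find hex with hτ
  have hr : repetitionGoal β γ ≤ I.hits ω τ := Nat.find_spec hex
  have hb : ∀ i < τ, (I.hits ω i : ℝ) < repetitionGoal β γ := fun i hi =>
    not_le.1 (Nat.find_min hex hi)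
  have hle : τ ≤ 2 * I.halfHorizon β γ := Nat.find_min' hex (h.hits_ge hβ hβ1 hγ hγ1)
  have hL1 : (1 : ℝ) ≤ firstConfidence β γ := by
    exact_mod_cast firstConfidence_pos hβ hβ1 hγ hγ1
  have hK : repetitionGoal β γ * β ^ 2 = 32 * firstConfidence β γ := by
    rw [repetitionGoal]; field_simp
  have hτK : repetitionGoal β γ ≤ τ := hr.trans (Nat.cast_le.2 (hits_le ω τ))
  have hKL := repetitionGoal_ge (γ := γ) hβ hβ1
  have hP := I.total_pos
  -- the quality of the estimate of the total processing time
  have hest : I.total ≤ I.totalEstimate β ω τ ∧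
      I.totalEstimate β ω τ ≤ (1 + 6 * β) * I.total := by
    have hc := h.repetitions
    rw [Concentrated, hitCount_stopped hr hb hle, hitMass_stopped hr hb hle, ← hits_eq_sum] at hc
    have hW : I.weightSum ω τ = I.total * ∑ i ∈ Finset.range τ, I.mass (I.seen ω i) := by
      rw [weightSum, Finset.mul_sum]
      refine Finset.sum_congr rfl fun i _ => ?_
      rw [mass_eq, mul_div_cancel₀ _ hP.ne']
    rw [totalEstimate, hW]
    obtain ⟨e1, e2⟩ := estimate_bounds hβ hβ1 (by linarith : (0 : ℝ) < I.hits ω τ) (by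
      refine hc.trans (add_le_add_right ?_ _)
      rw [div_le_div_iff₀ hβ (by norm_num)]
      nlinarith)
    rw [show I.total * (∑ i ∈ Finset.range τ, I.mass (I.seen ω i)) / I.hits ω τ * (1 + 3 * β) =
      I.total * ((∑ i ∈ Finset.range τ, I.mass (I.seen ω i)) * (1 + 3 * β) / I.hits ω τ) by ring]
    exact ⟨le_mul_of_one_le_right hP.le e1, by
      rw [mul_comm (1 + 6 * β)]; exact mul_le_mul_of_nonneg_left e2 hP.le⟩
  have hn : (1 : ℝ) ≤ I.n := by exact_mod_cast I.n_pos
  set Ph := I.totalEstimate β ω τ with hPh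
  have hPh0 : 0 < Ph := hP.trans_le hest.1
  have hcount : ∀ s, (((Finset.range τ).filter fun j => I.p (ω j) ≤ s).card : ℝ) =
      ∑ i ∈ Finset.range τ, if ω i ∈ I.below s then 1 else 0 := fun s => by
    rw [Finset.card_filter]
    push_cast
    simp only [mem_below]
  have hβτ : 8 * (firstConfidence β γ : ℝ) ≤ β * τ := by
    have h1 : 32 * (firstConfidence β γ : ℝ) ≤ β * (β * τ) := by nlinarith
    nlinarith [show (0 : ℝ) ≤ β * τ by positivity]
  -- few samples are tiny
  have htiny : ∀ s ≤ β * I.total / (2 * I.n),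
      (((Finset.range τ).filter fun j => I.p (ω j) ≤ s).card : ℝ) ≤ β * τ := by
    intro s hs
    have hc := h.tiny
    rw [Concentrated, hitCount_stopped hr hb hle, hitMass_stopped hr hb hle, ← hcount,
      Finset.sum_const, Finset.card_range, nsmul_eq_mul] at hc
    have h1 : I.mass (I.below (β * I.total / (2 * I.n))) ≤ β / 2 := by
      refine (Finset.sum_le_card_nsmul _ _ (β / (2 * I.n)) fun j hj => ?_).trans ?_
      · rw [div_le_iff₀ hP]
        exact (mem_below.1 hj).trans (le_of_eq (by ring))
      · rw [nsmul_eq_mul, ← mul_div_assoc, div_le_div_iff₀ (by positivity) (by norm_num)]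
        have : ((I.below (β * I.total / (2 * I.n))).card : ℝ) ≤ I.n := by
          exact_mod_cast (Finset.card_le_univ _).trans (Fintype.card_fin _).le
        nlinarith
    have h2 : (((Finset.range τ).filter fun j => I.p (ω j) ≤ s).card : ℝ) ≤
        ((Finset.range τ).filter fun j => I.p (ω j) ≤ β * I.total / (2 * I.n)).card :=
      Nat.cast_le.2 (Finset.card_le_card (Finset.monotone_filter_right _ fun j _ hj =>
        hj.trans hs))
    have h3 := (abs_le.1 hc).2
    have h4 := mul_le_mul_of_nonneg_left h1 (Nat.cast_nonneg (α := ℝ) τ)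
    linarith
  have hmem : knownLength β < I.sketchLength β ω τ ∧ (((Finset.range τ).filter fun j =>
      I.p (ω j) ≤ Ph * (1 - β) ^ I.sketchLength β ω τ).card : ℝ) ≤ β * τ := by
    obtain ⟨k, hk⟩ := exists_pow_lt_of_lt_one (x := β * I.total / (2 * I.n) / Ph) (y := 1 - β)
      (by positivity) (by linarith)
    refine Nat.sInf_mem (s := {k | knownLength β < k ∧
      (((Finset.range τ).filter fun j => I.p (ω j) ≤ Ph * (1 - β) ^ k).card : ℝ) ≤ β * τ})
      ⟨k + knownLength β + 1, by omega, htiny _ ?_⟩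
    have h1 : (1 - β) ^ (k + knownLength β + 1) ≤ (1 - β) ^ k :=
      pow_le_pow_of_le_one (by linarith) (by linarith) (by omega)
    rw [lt_div_iff₀ hPh0] at hk
    nlinarith
  have hlen : β ^ 2 / (4 * I.n) ≤ (1 - β) ^ (I.sketchLength β ω τ - 2) := by
    have hkp := knownLength_pos hβ hβ1
    have hnot := Nat.notMem_of_lt_sInf (m := I.sketchLength β ω τ - 1)
      (s := {k | knownLength β < k ∧ (((Finset.range τ).filter fun j =>
        I.p (ω j) ≤ Ph * (1 - β) ^ k).card : ℝ) ≤ β * τ}) (by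
        change _ < I.sketchLength β ω τ
        omega)
    simp only [Set.mem_ofPred_eq, not_and_or, not_lt] at hnot
    rcases hnot with h1 | h1
    · have h2 := lt_pow_of_lt_knownLength (β := β) (k := I.sketchLength β ω τ - 2) (by omega)
      refine le_trans ?_ h2.le
      exact div_le_self (by positivity) (by linarith)
    · have h2 : β * I.total / (2 * I.n) < Ph * (1 - β) ^ (I.sketchLength β ω τ - 1) := by
        by_contra! h3
        exact h1 (htiny _ h3)
      have h3 : (1 - β) ^ (I.sketchLength β ω τ - 1) ≤ (1 - β) ^ (I.sketchLength β ω τ - 2) :=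
        pow_le_pow_of_le_one (by linarith) (by linarith) (by omega)
      set x := (1 - β) ^ (I.sketchLength β ω τ - 2)
      have h4 : β * I.total / (2 * I.n) < 2 * I.total * x := by
        have : Ph ≤ 2 * I.total := by nlinarith
        have hx : 0 ≤ (1 - β) ^ (I.sketchLength β ω τ - 1) := pow_nonneg (by linarith) _
        nlinarith
      rw [div_lt_iff₀ (by positivity)] at h4
      rw [div_le_iff₀ (by positivity)]
      have h5 : β < 2 * x * (2 * I.n) := by
        by_contra! h6
        nlinarith
      nlinarith
  refine ⟨τ, hr, hb, hle, hest.1, hest.2, fun j hj => ?_, hmem.1, hmem.2, hlen, ?_⟩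
  · by_contra hns
    have hc := h.single j (by rwa [le_div_iff₀ hP])
    rw [Concentrated, hitCount_stopped hr hb hle, hitMass_stopped hr hb hle,
      Finset.sum_eq_zero (fun i hi => if_neg (by
        rw [Finset.mem_singleton]
        rintro rfl
        exact hns (Finset.mem_image_of_mem ω hi))),
      Finset.sum_const, Finset.card_range, nsmul_eq_mul] at hc
    have h1 := (abs_le.1 hc).1
    have h2 : I.mass {j} = I.p j / I.total := by simp [mass]
    have h3 : β ^ 2 / 2 ≤ I.mass {j} := by rwa [h2, le_div_iff₀ hP]
    have h4 := mul_le_mul hτK h3 (by positivity) (Nat.cast_nonneg τ)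
    linarith
  · by_contra! hcon
    have hsub := hT' _ hcon
    have hc := h.tail
    rw [Concentrated, hitCount_stopped hr hb hle, hitMass_stopped hr hb hle,
      Finset.sum_const, Finset.card_range, nsmul_eq_mul] at hc
    have h1 : ∑ i ∈ Finset.range τ, (if ω i ∈ T then (1 : ℝ) else 0) ≤ β * τ := by
      refine le_trans ?_ hmem.2
      rw [hcount]
      refine Finset.sum_le_sum fun i _ => ?_
      by_cases hi : ω i ∈ T
      · rw [if_pos hi, if_pos (hsub hi)]
      · rw [if_neg hi]
        split_ifs <;> norm_num
    have h2 := (abs_le.1 hc).1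
    have hτ0 : (0 : ℝ) < τ := by linarith
    have h3 := mul_lt_mul_of_pos_left hT hτ0
    linarith

end JobInstance

/-! ### Reasoning about programs -/

namespace Prog

/-- Whether the program may write the natural variable. -/
def writesN : Prog → ℕ → Bool
  | nset x _, y => x == y
  | sample x _, y => x == y
  | seq c₁ c₂, y => c₁.writesN y || c₂.writesN y
  | branch _ c₁ c₂, y => c₁.writesN y || c₂.writesN y
  | loop _ c, y => c.writesN y
  | _, _ => false

/-- Whether the program may write the real variable. -/
def writesR : Prog → ℕ → Bool
  | rset x _, y => x == y
  | sample _ x, y => x == y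
  | seq c₁ c₂, y => c₁.writesR y || c₂.writesR y
  | branch _ c₁ c₂, y => c₁.writesR y || c₂.writesR y
  | loop _ c, y => c.writesR y
  | _, _ => false

/-- Whether the program may write the natural array. -/
def writesNArr : Prog → ℕ → Bool
  | nstore a _ _, y => a == y
  | call _ _ _ a, y => a == y
  | seq c₁ c₂, y => c₁.writesNArr y || c₂.writesNArr y
  | branch _ c₁ c₂, y => c₁.writesNArr y || c₂.writesNArr y
  | loop _ c, y => c.writesNArr y
  | _, _ => false

/-- Whether the program may write the real array. -/
def writesRArr : Prog → ℕ → Bool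
  | rstore a _ _, y => a == y
  | seq c₁ c₂, y => c₁.writesRArr y || c₂.writesRArr y
  | branch _ c₁ c₂, y => c₁.writesRArr y || c₂.writesRArr y
  | loop _ c, y => c.writesRArr y
  | _, _ => false

/-- Whether the program may draw samples. -/
def draws : Prog → Bool
  | sample _ _ => true
  | seq c₁ c₂ => c₁.draws || c₂.draws
  | branch _ c₁ c₂ => c₁.draws || c₂.draws
  | loop _ c => c.draws
  | _ => false

end Prog

/-- The states agree on everything that the program does not write. -/
structure Frame (c : Prog) (s s' : MachineState) : Prop where
  nvar : ∀ x, c.writesN x = false → s'.nvar x = s.nvar x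
  rvar : ∀ x, c.writesR x = false → s'.rvar x = s.rvar x
  narr : ∀ a, c.writesNArr a = false → s'.narr a = s.narr a
  rarr : ∀ a, c.writesRArr a = false → s'.rarr a = s.rarr a
  drawn : c.draws = false → s'.drawn = s.drawn

theorem Frame.refl (c : Prog) (s : MachineState) : Frame c s s :=
  ⟨fun _ _ => rfl, fun _ _ => rfl, fun _ _ => rfl, fun _ _ => rfl, fun _ => rfl⟩

theorem Frame.trans {c : Prog} {s₁ s₂ s₃ : MachineState} (h : Frame c s₁ s₂) (h' : Frame c s₂ s₃) :
    Frame c s₁ s₃ :=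
  ⟨fun x hx => (h'.nvar x hx).trans (h.nvar x hx), fun x hx => (h'.rvar x hx).trans (h.rvar x hx),
    fun x hx => (h'.narr x hx).trans (h.narr x hx), fun x hx => (h'.rarr x hx).trans (h.rarr x hx),
    fun hx => (h'.drawn hx).trans (h.drawn hx)⟩

theorem Frame.weaken {c c' : Prog} {s s' : MachineState} (h : Frame c s s')
    (h1 : ∀ x, c'.writesN x = false → c.writesN x = false)
    (h2 : ∀ x, c'.writesR x = false → c.writesR x = false)
    (h3 : ∀ x, c'.writesNArr x = false → c.writesNArr x = false)
    (h4 : ∀ x, c'.writesRArr x = false → c.writesRArr x = false)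
    (h5 : c'.draws = false → c.draws = false) : Frame c' s s' :=
  ⟨fun x hx => h.nvar x (h1 x hx), fun x hx => h.rvar x (h2 x hx),
    fun x hx => h.narr x (h3 x hx), fun x hx => h.rarr x (h4 x hx), fun hx => h.drawn (h5 hx)⟩

section

variable {m : ℕ} {A : BlackBox m} {samples : ℕ → ℕ × ℝ}

theorem Exec.frame {c : Prog} {s s' : MachineState} {k : ℕ} (h : Exec A samples c s s' k) :
    Frame c s s' := by
  induction h with
  | skip | loopFalse => exact Frame.refl _ _
  | nset s x e =>
    refine ⟨fun y hy => ?_, fun _ _ => rfl, fun _ _ => rfl, fun _ _ => rfl, fun _ => rfl⟩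
    simp only [Prog.writesN, beq_eq_false_iff_ne] at hy
    exact Function.update_of_ne hy.symm _ _
  | rset s x e =>
    refine ⟨fun _ _ => rfl, fun y hy => ?_, fun _ _ => rfl, fun _ _ => rfl, fun _ => rfl⟩
    simp only [Prog.writesR, beq_eq_false_iff_ne] at hy
    exact Function.update_of_ne hy.symm _ _
  | nstore s a i e =>
    refine ⟨fun _ _ => rfl, fun _ _ => rfl, fun y hy => ?_, fun _ _ => rfl, fun _ => rfl⟩
    simp only [Prog.writesNArr, beq_eq_false_iff_ne] at hy
    exact Function.update_of_ne hy.symm _ _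
  | rstore s a i e =>
    refine ⟨fun _ _ => rfl, fun _ _ => rfl, fun _ _ => rfl, fun y hy => ?_, fun _ => rfl⟩
    simp only [Prog.writesRArr, beq_eq_false_iff_ne] at hy
    exact Function.update_of_ne hy.symm _ _
  | sample s x y =>
    refine ⟨fun z hz => ?_, fun z hz => ?_, fun _ _ => rfl, fun _ _ => rfl, fun h => ?_⟩
    · simp only [Prog.writesN, beq_eq_false_iff_ne] at hz
      exact Function.update_of_ne hz.symm _ _
    · simp only [Prog.writesR, beq_eq_false_iff_ne] at hz
      exact Function.update_of_ne hz.symm _ _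
    · simp [Prog.draws] at h
  | call s a N α b =>
    refine ⟨fun _ _ => rfl, fun _ _ => rfl, fun y hy => ?_, fun _ _ => rfl, fun _ => rfl⟩
    simp only [Prog.writesNArr, beq_eq_false_iff_ne] at hy
    exact Function.update_of_ne hy.symm _ _
  | seq _ _ ih₁ ih₂ =>
    refine (ih₁.weaken ?_ ?_ ?_ ?_ ?_).trans (ih₂.weaken ?_ ?_ ?_ ?_ ?_) <;>
    simp +contextual [Prog.writesN, Prog.writesR, Prog.writesNArr, Prog.writesRArr, Prog.draws]
  | branchTrue _ _ ih | branchFalse _ _ ih =>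
    refine ih.weaken ?_ ?_ ?_ ?_ ?_ <;>
    simp +contextual [Prog.writesN, Prog.writesR, Prog.writesNArr, Prog.writesRArr, Prog.draws]
  | loopTrue _ _ _ ih₁ ih₂ =>
    refine (ih₁.weaken ?_ ?_ ?_ ?_ ?_).trans ih₂ <;>
    simp +contextual [Prog.writesN, Prog.writesR, Prog.writesNArr, Prog.writesRArr, Prog.draws]

variable (A samples) in
/-- The program halts, in a state and after a number of steps with the property `Q`. -/
def Wp (c : Prog) (s : MachineState) (Q : MachineState → ℕ → Prop) : Prop :=
  ∃ s' k, Exec A samples c s s' k ∧ Q s' k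

theorem Wp.mono {c : Prog} {s : MachineState} {Q Q' : MachineState → ℕ → Prop}
    (h : Wp A samples c s Q') (h' : ∀ s' k, Frame c s s' → Q' s' k → Q s' k) :
    Wp A samples c s Q := by
  obtain ⟨s', k, he, hq⟩ := h
  exact ⟨s', k, he, h' s' k he.frame hq⟩

variable {s : MachineState} {Q : MachineState → ℕ → Prop}

theorem wp_skip : Wp A samples .skip s Q ↔ Q s 1 :=
  ⟨fun ⟨_, _, h, hq⟩ => by cases h; exact hq, fun h => ⟨_, _, .skip s, h⟩⟩

theorem wp_nset {x : ℕ} {e : NExp} :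
    Wp A samples (.nset x e) s Q ↔ Q (s.nset x (e.eval s)) (e.cost + 1) :=
  ⟨fun ⟨_, _, h, hq⟩ => by cases h; exact hq, fun h => ⟨_, _, .nset s x e, h⟩⟩

theorem wp_rset {x : ℕ} {e : RExp} :
    Wp A samples (.rset x e) s Q ↔ Q (s.rset x (e.eval s)) (e.cost + 1) :=
  ⟨fun ⟨_, _, h, hq⟩ => by cases h; exact hq, fun h => ⟨_, _, .rset s x e, h⟩⟩

theorem wp_nstore {a : ℕ} {i e : NExp} : Wp A samples (.nstore a i e) s Q ↔
    Q (s.nstore a (i.eval s) (e.eval s)) (i.cost + e.cost + 1) :=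
  ⟨fun ⟨_, _, h, hq⟩ => by cases h; exact hq, fun h => ⟨_, _, .nstore s a i e, h⟩⟩

theorem wp_rstore {a : ℕ} {i : NExp} {e : RExp} : Wp A samples (.rstore a i e) s Q ↔
    Q (s.rstore a (i.eval s) (e.eval s)) (i.cost + e.cost + 1) :=
  ⟨fun ⟨_, _, h, hq⟩ => by cases h; exact hq, fun h => ⟨_, _, .rstore s a i e, h⟩⟩

theorem wp_sample {x y : ℕ} : Wp A samples (.sample x y) s Q ↔
    Q ((s.nset x (samples s.drawn).1).rset y (samples s.drawn).2).countSample 1 :=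
  ⟨fun ⟨_, _, h, hq⟩ => by cases h; exact hq, fun h => ⟨_, _, .sample s x y, h⟩⟩

theorem wp_seq {c₁ c₂ : Prog} : Wp A samples (.seq c₁ c₂) s Q ↔
    Wp A samples c₁ s fun s₁ k₁ => Wp A samples c₂ s₁ fun s₂ k₂ => Q s₂ (k₁ + k₂) := by
  constructor
  · rintro ⟨_, _, h, hq⟩
    cases h with
    | seq h₁ h₂ => exact ⟨_, _, h₁, _, _, h₂, hq⟩
  · rintro ⟨_, _, h₁, _, _, h₂, hq⟩
    exact ⟨_, _, .seq h₁ h₂, hq⟩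

theorem wp_branch {b : Test} {c₁ c₂ : Prog} : Wp A samples (.branch b c₁ c₂) s Q ↔
    (b.Holds s → Wp A samples c₁ s fun s' k => Q s' (b.cost + k)) ∧
    (¬ b.Holds s → Wp A samples c₂ s fun s' k => Q s' (b.cost + k)) := by
  constructor
  · rintro ⟨_, _, h, hq⟩
    cases h with
    | branchTrue hb h => exact ⟨fun _ => ⟨_, _, h, hq⟩, fun hn => absurd hb hn⟩
    | branchFalse hb h => exact ⟨fun hn => absurd hn hb, fun _ => ⟨_, _, h, hq⟩⟩
  · rintro ⟨h₁, h₂⟩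
    by_cases hb : b.Holds s
    · obtain ⟨_, _, h, hq⟩ := h₁ hb
      exact ⟨_, _, .branchTrue hb h, hq⟩
    · obtain ⟨_, _, h, hq⟩ := h₂ hb
      exact ⟨_, _, .branchFalse hb h, hq⟩

/-- A loop with `N` passes, each of at most `B` steps, that keep the invariant. -/
theorem wp_loop {b : Test} {c : Prog} (N B : ℕ) (Inv : ℕ → MachineState → Prop) (h0 : Inv 0 s)
    (step : ∀ i < N, ∀ s', Frame c s s' → Inv i s' →
      b.Holds s' ∧ Wp A samples c s' fun s'' k => k ≤ B ∧ Inv (i + 1) s'')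
    (last : ∀ s', Frame c s s' → Inv N s' → ¬ b.Holds s') :
    Wp A samples (.loop b c) s fun s' k => k ≤ N * (B + b.cost) + b.cost ∧ Inv N s' := by
  have key : ∀ d i s', i + d = N → Frame c s s' → Inv i s' →
      ∃ s'' k, Exec A samples (.loop b c) s' s'' k ∧ k ≤ d * (B + b.cost) + b.cost ∧
        Inv N s'' := by
    intro d
    induction d with
    | zero =>
      intro i s' hi hf hI
      obtain rfl : i = N := by omega
      exact ⟨s', _, .loopFalse (last s' hf hI), by omega, hI⟩
    | succ d ih =>
      intro i s' hi hf hI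
      obtain ⟨hb, s₁, k₁, he, hk, hI'⟩ := step i (by omega) s' hf hI
      obtain ⟨s₂, k₂, he₂, hk₂, hI₂⟩ := ih (i + 1) s₁ (by omega) (hf.trans he.frame) hI'
      refine ⟨s₂, _, .loopTrue hb he he₂, ?_, hI₂⟩
      rw [Nat.succ_mul]
      omega
  obtain ⟨s', k, he, hk, hI⟩ := key N 0 s (by omega) (Frame.refl _ _) h0
  exact ⟨s', k, he, hk, hI⟩

end

namespace MachineState

variable (s : MachineState)

theorem nset_nvar (x v y : ℕ) : (s.nset x v).nvar y = if y = x then v else s.nvar y :=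
  Function.update_apply ..
theorem nset_rvar (x v : ℕ) : (s.nset x v).rvar = s.rvar := rfl
theorem nset_narr (x v : ℕ) : (s.nset x v).narr = s.narr := rfl
theorem nset_rarr (x v : ℕ) : (s.nset x v).rarr = s.rarr := rfl
theorem nset_drawn (x v : ℕ) : (s.nset x v).drawn = s.drawn := rfl

theorem rset_rvar (x : ℕ) (v : ℝ) (y : ℕ) :
    (s.rset x v).rvar y = if y = x then v else s.rvar y := Function.update_apply ..
theorem rset_nvar (x : ℕ) (v : ℝ) : (s.rset x v).nvar = s.nvar := rfl
theorem rset_narr (x : ℕ) (v : ℝ) : (s.rset x v).narr = s.narr := rfl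
theorem rset_rarr (x : ℕ) (v : ℝ) : (s.rset x v).rarr = s.rarr := rfl
theorem rset_drawn (x : ℕ) (v : ℝ) : (s.rset x v).drawn = s.drawn := rfl

theorem nstore_narr (a i v b : ℕ) :
    (s.nstore a i v).narr b = if b = a then Function.update (s.narr a) i v else s.narr b :=
  Function.update_apply ..
theorem nstore_nvar (a i v : ℕ) : (s.nstore a i v).nvar = s.nvar := rfl
theorem nstore_rvar (a i v : ℕ) : (s.nstore a i v).rvar = s.rvar := rfl
theorem nstore_rarr (a i v : ℕ) : (s.nstore a i v).rarr = s.rarr := rfl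
theorem nstore_drawn (a i v : ℕ) : (s.nstore a i v).drawn = s.drawn := rfl

theorem rstore_rarr (a i : ℕ) (v : ℝ) (b : ℕ) :
    (s.rstore a i v).rarr b = if b = a then Function.update (s.rarr a) i v else s.rarr b :=
  Function.update_apply ..
theorem rstore_nvar (a i : ℕ) (v : ℝ) : (s.rstore a i v).nvar = s.nvar := rfl
theorem rstore_rvar (a i : ℕ) (v : ℝ) : (s.rstore a i v).rvar = s.rvar := rfl
theorem rstore_narr (a i : ℕ) (v : ℝ) : (s.rstore a i v).narr = s.narr := rfl
theorem rstore_drawn (a i : ℕ) (v : ℝ) : (s.rstore a i v).drawn = s.drawn := rfl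

theorem countSample_nvar : s.countSample.nvar = s.nvar := rfl
theorem countSample_rvar : s.countSample.rvar = s.rvar := rfl
theorem countSample_narr : s.countSample.narr = s.narr := rfl
theorem countSample_rarr : s.countSample.rarr = s.rarr := rfl
theorem countSample_drawn : s.countSample.drawn = s.drawn + 1 := rfl

end MachineState

/-- Increment of a natural variable. -/
def incr (x : ℕ) : Prog := .nset x (.add (.var x) (.const 1))

/-- `for x < e do c`. -/
def forLoop (x : ℕ) (e : NExp) (c : Prog) : Prog :=
  .seq (.nset x (.const 0)) (.loop (.neg (.nle e (.var x))) (.seq c (incr x)))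

/-- The number of values `x < e` that pass a test is assigned to the variable `q`. -/
def countLoop (x q : ℕ) (b : Test) (e : NExp) : Prog :=
  .seq (.nset q (.const 0)) (forLoop x e (.branch b (incr q) .skip))

section

variable {m : ℕ} {A : BlackBox m} {samples : ℕ → ℕ × ℝ} {s : MachineState}
  {Q : MachineState → ℕ → Prop}

theorem wp_incr {x : ℕ} : Wp A samples (incr x) s Q ↔ Q (s.nset x (s.nvar x + 1)) 4 := by
  rw [incr, wp_nset]
  rfl

theorem wp_forLoop {x : ℕ} {e : NExp} {c : Prog} (N B : ℕ) (Inv : ℕ → MachineState → Prop)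
    (hx : c.writesN x = false) (he : ∀ s', Frame (forLoop x e c) s s' → e.eval s' = N)
    (h0 : Inv 0 (s.nset x 0))
    (step : ∀ i < N, ∀ s', Frame (forLoop x e c) s s' → s'.nvar x = i → Inv i s' →
      Wp A samples c s' fun s'' k => k ≤ B ∧ Inv (i + 1) (s''.nset x (i + 1))) :
    Wp A samples (forLoop x e c) s fun s' k =>
      k ≤ N * (B + e.cost + 7) + e.cost + 5 ∧ s'.nvar x = N ∧ Inv N s' := by
  rw [forLoop, wp_seq, wp_nset]
  change Wp A samples _ (s.nset x 0) _
  have hf0 : ∀ s', Frame (.seq c (incr x)) (s.nset x 0) s' → Frame (forLoop x e c) s s' := by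
    intro s' h
    refine ⟨fun y hy => ?_, fun y hy => ?_, fun y hy => ?_, fun y hy => ?_, fun hy => ?_⟩
    · have hy' := hy
      simp only [forLoop, incr, Prog.writesN, Bool.or_eq_false_iff, beq_eq_false_iff_ne] at hy'
      rw [h.nvar y (by simp [incr, Prog.writesN, hy'.2.1, hy'.1]), MachineState.nset_nvar,
        if_neg (Ne.symm hy'.1)]
    · exact h.rvar y (by simpa [forLoop, incr, Prog.writesR] using hy)
    · exact h.narr y (by simpa [forLoop, incr, Prog.writesNArr] using hy)
    · exact h.rarr y (by simpa [forLoop, incr, Prog.writesRArr] using hy)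
    · exact h.drawn (by simpa [forLoop, incr, Prog.draws] using hy)
  refine (wp_loop N (B + 4) (fun i s' => s'.nvar x = i ∧ Inv i s') ⟨?_, h0⟩ ?_ ?_).mono ?_
  · simp [MachineState.nset_nvar]
  · rintro i hi s' hf ⟨hxi, hI⟩
    constructor
    · simp only [Test.Holds, NExp.eval, he s' (hf0 s' hf), hxi]
      omega
    · rw [wp_seq]
      refine (step i hi s' (hf0 s' hf) hxi hI).mono fun s'' k hf' ⟨hk, hI'⟩ => ?_
      have hx'' : s''.nvar x = i := (hf'.nvar x hx).trans hxi
      rw [wp_incr, hx'']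
      exact ⟨by omega, by simp [MachineState.nset_nvar], hI'⟩
  · rintro s' hf ⟨hxi, hI⟩
    simp only [Test.Holds, NExp.eval, he s' (hf0 s' hf), hxi]
    omega
  · rintro s' k hf ⟨hk, hx', hI⟩
    refine ⟨?_, hx', hI⟩
    have e1 : B + 4 + (Test.neg (.nle e (.var x))).cost = B + e.cost + 7 := by
      simp only [Test.cost, NExp.cost]; omega
    rw [e1] at hk
    simp only [Test.cost, NExp.cost] at hk ⊢
    omega

theorem wp_countLoop {x q : ℕ} (hxq : x ≠ q) {b : Test} {e : NExp} (N : ℕ) (P : ℕ → Prop)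
    [DecidablePred P] (he : ∀ s', Frame (countLoop x q b e) s s' → e.eval s' = N)
    (hb : ∀ s', Frame (countLoop x q b e) s s' → s'.nvar x < N →
      (b.Holds s' ↔ P (s'.nvar x))) :
    Wp A samples (countLoop x q b e) s fun s' k =>
      k ≤ N * (b.cost + e.cost + 11) + e.cost + 7 ∧
      s'.nvar q = ((Finset.range N).filter P).card := by
  have hf0 : ∀ s', Frame (forLoop x e (.branch b (incr q) .skip)) (s.nset q 0) s' →
      Frame (countLoop x q b e) s s' := by
    intro s' h
    refine ⟨fun y hy => ?_, fun y hy => h.rvar y (by simpa [countLoop, Prog.writesR] using hy),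
      fun y hy => h.narr y (by simpa [countLoop, Prog.writesNArr] using hy),
      fun y hy => h.rarr y (by simpa [countLoop, Prog.writesRArr] using hy),
      fun hy => h.drawn (by simpa [countLoop, Prog.draws] using hy)⟩
    simp only [countLoop, Prog.writesN, Bool.or_eq_false_iff, beq_eq_false_iff_ne] at hy
    rw [h.nvar y hy.2, MachineState.nset_nvar, if_neg (Ne.symm hy.1)]
  rw [countLoop, wp_seq, wp_nset]
  change Wp A samples _ (s.nset q 0) _
  refine (wp_forLoop N (b.cost + 4)
    (fun i s' => s'.nvar q = ((Finset.range i).filter P).card) ?_ (fun s' h => he s' (hf0 s' h))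
    ?_ ?_).mono ?_
  · simp [Prog.writesN, incr, hxq.symm]
  · simp [MachineState.nset_nvar, hxq.symm]
  · intro i hi s' hf hxi hq
    have hb' := hb s' (hf0 s' hf) (by omega)
    rw [hxi] at hb'
    rw [wp_branch, wp_incr, wp_skip]
    constructor
    · intro h
      refine ⟨le_rfl, ?_⟩
      rw [Finset.range_add_one, Finset.filter_insert, if_pos (hb'.1 h),
        Finset.card_insert_of_notMem (by simp)]
      simp [MachineState.nset_nvar, hxq.symm, hq]
    · intro h
      refine ⟨by omega, ?_⟩
      rw [Finset.range_add_one, Finset.filter_insert, if_neg (fun h' => h (hb'.2 h'))]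
      simp [MachineState.nset_nvar, hxq.symm, hq]
  · rintro s' k hf ⟨hk, -, hq⟩
    refine ⟨?_, hq⟩
    rw [show b.cost + 4 + e.cost + 7 = b.cost + e.cost + 11 by omega] at hk
    simp only [NExp.cost]
    omega

end

/-! ### The algorithm -/

infixr:60 " ;; " => Prog.seq

-- The names of the natural variables.
notation "nMachines" => (0 : ℕ)
notation "nSamples" => (1 : ℕ)
notation "nHits" => (2 : ℕ)
notation "nSeen" => (3 : ℕ)
notation "nLabel" => (4 : ℕ)
notation "nLength" => (5 : ℕ)
notation "nKnown" => (6 : ℕ)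
notation "nCount" => (7 : ℕ)
notation "nIndex" => (8 : ℕ)
notation "nConf" => (9 : ℕ)
notation "nSecond" => (10 : ℕ)
notation "nSand" => (11 : ℕ)
notation "nItems" => (12 : ℕ)
notation "nOpen" => (13 : ℕ)
notation "nMachine" => (14 : ℕ)
notation "nRow" => (15 : ℕ)
notation "nShare" => (16 : ℕ)
notation "nColumn" => (17 : ℕ)
notation "nCell" => (18 : ℕ)
notation "nDigit" => (19 : ℕ)
-- The names of the real variables.
notation "rEps" => (0 : ℕ)
notation "rGamma" => (1 : ℕ)
notation "rBeta" => (2 : ℕ)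
notation "rPower" => (3 : ℕ)
notation "rTarget" => (4 : ℕ)
notation "rSeen" => (5 : ℕ)
notation "rSum" => (6 : ℕ)
notation "rSize" => (7 : ℕ)
notation "rGoal" => (8 : ℕ)
notation "rTotal" => (9 : ℕ)
notation "rTop" => (10 : ℕ)
notation "rRest" => (11 : ℕ)
notation "rItem" => (12 : ℕ)
notation "rLoad" => (13 : ℕ)
notation "rMax" => (14 : ℕ)
notation "rQuot" => (15 : ℕ)
-- The names of the natural arrays.
notation "aCount" => (0 : ℕ)
notation "aMark" => (1 : ℕ)
notation "aLabel" => (2 : ℕ)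
notation "aEntry" => (3 : ℕ)
notation "aMachine" => (4 : ℕ)
notation "aPower" => (5 : ℕ)
-- The names of the real arrays.
notation "aFirst" => (0 : ℕ)
notation "aSize" => (1 : ℕ)
notation "aGrid" => (2 : ℕ)
notation "aSecond" => (3 : ℕ)
notation "aItem" => (4 : ℕ)

/-- The real constant `k`. -/
def RExp.lit (k : ℕ) : RExp := .ofNat (.const k)

/-- The natural variable `x` as a real number. -/
def RExp.nat (x : ℕ) : RExp := .ofNat (.var x)

/-- Equality of natural numbers. -/
def Test.neq (e₁ e₂ : NExp) : Test := .conj (.nle e₁ e₂) (.nle e₂ e₁)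

/-- Strict comparison of real numbers. -/
def Test.rlt (e₁ e₂ : RExp) : Test := .neg (.rle e₂ e₁)

/-- `nConf` becomes the least `L` with `rTarget ≤ rGamma * 2 ^ L`. -/
def logProg : Prog :=
  .rset rPower (.var rGamma) ;; .nset nConf (.const 0) ;;
  .loop (.rlt (.var rPower) (.var rTarget))
    (.rset rPower (.add (.var rPower) (.var rPower)) ;; incr nConf)

/-- The accuracy `β = ε / (100 * m)` and the number of repetitions for the first stage. -/
def setupProg : Prog :=
  .rset rBeta (.div (.var rEps) (.mul (.lit 100) (.nat nMachines))) ;;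
  .rset rTarget (.div (.lit 32) (.mul (.var rBeta) (.var rBeta))) ;;
  logProg ;;
  .rset rGoal (.div (.mul (.lit 32) (.nat nConf)) (.mul (.var rBeta) (.var rBeta)))

/-- One step of the first sampling stage: `rSum` accumulates the total size `rSeen` of the
distinct jobs that were seen before. -/
def firstBody : Prog :=
  .sample nLabel rSize ;;
  .rstore aFirst (.var nSamples) (.var rSize) ;;
  incr nSamples ;;
  .rset rSum (.add (.var rSum) (.var rSeen)) ;;
  .branch (.nle (.const 1) (.entry aMark (.var nLabel))) (incr nHits)
    (.nstore aMark (.var nLabel) (.const 1) ;;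
      .rset rSeen (.add (.var rSeen) (.var rSize)) ;;
      .rstore aSize (.var nSeen) (.var rSize) ;;
      .nstore aLabel (.var nSeen) (.var nLabel) ;;
      incr nSeen)

/-- The first sampling stage. -/
def firstProg : Prog := .loop (.rlt (.nat nHits) (.var rGoal)) firstBody

/-- The next boundary of the geometric grid. -/
def gridStep : Prog :=
  .rset rTop (.mul (.var rTop) (.sub (.lit 1) (.var rBeta))) ;;
  incr nLength ;;
  .rstore aGrid (.var nLength) (.var rTop)

/-- The estimate of the total size, and the part of the grid in which all jobs are known. -/
def gridProg : Prog :=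
  .rset rTotal (.mul (.div (.var rSum) (.nat nHits))
    (.add (.lit 1) (.mul (.lit 3) (.var rBeta)))) ;;
  .rset rTop (.var rTotal) ;;
  .rstore aGrid (.const 0) (.var rTop) ;;
  .loop (.rlt (.mul (.mul (.var rBeta) (.var rBeta)) (.var rTotal)) (.var rTop)) gridStep ;;
  .nset nKnown (.var nLength)

/-- The remaining part of the grid; it ends when few samples are below it. -/
def lengthProg : Prog :=
  .nset nCount (.var nSamples) ;;
  .loop (.rlt (.mul (.var rBeta) (.nat nSamples)) (.nat nCount))
    (gridStep ;;
      countLoop nIndex nCount (.rle (.entry aFirst (.var nIndex)) (.var rTop)) (.var nSamples))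

/-- The second sampling stage. -/
def secondProg : Prog :=
  .rset rTarget (.mul (.mul (.mul (.lit 16) (.add (.nat nLength) (.lit 1)))
      (.add (.nat nLength) (.lit 1)))
    (.mul (.add (.nat nSamples) (.lit 1)) (.add (.nat nSamples) (.lit 1)))) ;;
  logProg ;;
  .rset rGoal (.div (.mul (.nat nLength) (.nat nConf)) (.mul (.var rBeta) (.var rBeta))) ;;
  .loop (.rlt (.nat nSecond) (.var rGoal))
    (.sample nLabel rSize ;;
      .rstore aSecond (.var nSecond) (.var rSize) ;;
      incr nSecond)

/-- The `nIndex`-th distinct job of the first stage is above the known part of the grid. -/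
def isKnown : Test := .rlt (.entry aGrid (.var nKnown)) (.entry aSize (.var nIndex))

/-- The jobs that are not known are replaced by sand: equal items of the size `rItem`. -/
def sandProg : Prog :=
  .rset rItem (.mul (.var rBeta) (.var rTotal)) ;;
  .rset rRest (.add (.var rTotal) (.mul (.mul (.var rBeta) (.var rBeta)) (.var rTotal))) ;;
  forLoop nIndex (.var nSeen)
    (.branch isKnown (.rset rRest (.sub (.var rRest) (.entry aSize (.var nIndex)))) .skip) ;;
  .loop (.rlt (.lit 0) (.var rRest))
    (.rstore aItem (.var nSand) (.var rItem) ;;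
      incr nSand ;;
      .rset rRest (.sub (.var rRest) (.var rItem)))

/-- The known jobs of size at most `rItem` are bundled into items. -/
def bundleProg : Prog :=
  .nset nItems (.var nSand) ;;
  forLoop nIndex (.var nSeen)
    (.branch isKnown
      (.branch (.conj (.rle (.entry aSize (.var nIndex)) (.var rItem))
          (.rlt (.entry aItem (.var nOpen)) (.var rItem)))
        .skip
        (.nset nOpen (.var nItems) ;; incr nItems) ;;
      .rstore aItem (.var nOpen)
        (.add (.entry aItem (.var nOpen)) (.entry aSize (.var nIndex))) ;;
      .nstore aEntry (.entry aLabel (.var nIndex)) (.var nOpen))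
      .skip)

/-- The load of a machine in the schedule of the items, and its amount of sand. -/
def loadProg : Prog :=
  .rset rLoad (.lit 0) ;;
  forLoop nIndex (.var nItems)
    (.branch (.neq (.entry aMachine (.var nIndex)) (.var nMachine))
      (.rset rLoad (.add (.var rLoad) (.entry aItem (.var nIndex)))) .skip) ;;
  .branch (.rle (.var rLoad) (.var rMax)) .skip (.rset rMax (.var rLoad)) ;;
  countLoop nIndex nShare (.neq (.entry aMachine (.var nIndex)) (.var nMachine)) (.var nSand)

/-- `nCell` becomes the integral part of `rQuot`; it is computed digit by digit. -/
def floorProg : Prog :=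
  .nset nDigit (.const 0) ;;
  .nstore aPower (.const 0) (.const 1) ;;
  .loop (.rle (.ofNat (.entry aPower (.var nDigit))) (.var rQuot))
    (.nstore aPower (.add (.var nDigit) (.const 1))
        (.add (.entry aPower (.var nDigit)) (.entry aPower (.var nDigit))) ;;
      incr nDigit) ;;
  .nset nCell (.const 0) ;;
  .loop (.nle (.const 1) (.var nDigit))
    (.nset nDigit (.sub (.var nDigit) (.const 1)) ;;
      .branch (.rle (.ofNat (.add (.var nCell) (.entry aPower (.var nDigit)))) (.var rQuot))
        (.nset nCell (.add (.var nCell) (.entry aPower (.var nDigit)))) .skip)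

/-- The size that an expression denotes is in the `nColumn`-th interval of the grid. -/
def inColumn (e : RExp) : Test :=
  .conj (.rlt (.entry aGrid (.add (.var nColumn) (.const 1))) e)
    (.rle e (.entry aGrid (.var nColumn)))

/-- The number of jobs of the `nColumn`-th interval for the machine `nMachine`. Known jobs follow
the schedule of the items; the other jobs are distributed in proportion to the sand. -/
def cellProg : Prog :=
  .branch (.nle (.add (.var nColumn) (.const 1)) (.var nKnown))
    (countLoop nIndex nCell
      (.conj (inColumn (.entry aSize (.var nIndex)))
        (.neq (.entry aMachine (.entry aEntry (.entry aLabel (.var nIndex)))) (.var nMachine)))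
      (.var nSeen))
    (countLoop nIndex nCell (inColumn (.entry aSecond (.var nIndex))) (.var nSecond) ;;
      .rset rQuot (.div
        (.mul (.mul (.div (.nat nShare) (.nat nSand)) (.div (.nat nCell) (.nat nSecond)))
          (.var rTotal))
        (.mul (.sub (.lit 1) (.var rBeta)) (.entry aGrid (.var nColumn)))) ;;
      floorProg ;;
      incr nCell)

/-- One row of the sketch. -/
def rowProg : Prog :=
  forLoop nColumn (.var nLength)
    (cellProg ;; .nstore aCount (.add (.var nRow) (.var nColumn)) (.var nCell)) ;;
  .nset nRow (.add (.var nRow) (.var nLength))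

/-- The scheme is applied to the items, and the sketch is filled row by row. -/
def scheduleProg : Prog :=
  .call aItem (.var nItems) (.div (.var rEps) (.lit 600)) aMachine ;;
  forLoop nMachine (.var nMachines) (loadProg ;; rowProg)

/-- The results are moved to their places. -/
def outputProg : Prog :=
  .rset 0 (.add (.var rMax) (.mul (.mul (.var rBeta) (.var rBeta)) (.var rTotal))) ;;
  .rset 1 (.var rTotal) ;;
  .nset 0 (.var nLength)

/-- The algorithm. -/
def sketchProg : Prog :=
  setupProg ;; firstProg ;; gridProg ;; lengthProg ;; secondProg ;; sandProg ;; bundleProg ;;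
  scheduleProg ;; outputProg

/-! ### Correctness of the parts of the program -/

attribute [simp] wp_seq wp_nset wp_rset wp_nstore wp_rstore wp_sample wp_branch wp_incr wp_skip
  NExp.eval RExp.eval Test.Holds NExp.cost RExp.cost Test.cost
  RExp.lit RExp.nat Test.neq Test.rlt
  MachineState.nset_nvar MachineState.nset_rvar MachineState.nset_narr MachineState.nset_rarr
  MachineState.nset_drawn MachineState.rset_nvar MachineState.rset_rvar MachineState.rset_narr
  MachineState.rset_rarr MachineState.rset_drawn MachineState.nstore_nvar
  MachineState.nstore_rvar MachineState.nstore_narr MachineState.nstore_rarr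
  MachineState.nstore_drawn MachineState.rstore_nvar MachineState.rstore_rvar
  MachineState.rstore_narr MachineState.rstore_rarr MachineState.rstore_drawn
  MachineState.countSample_nvar MachineState.countSample_rvar MachineState.countSample_narr
  MachineState.countSample_rarr MachineState.countSample_drawn

section

variable {m : ℕ} {A : BlackBox m} {samples : ℕ → ℕ × ℝ} {s : MachineState}

theorem wp_logProg (hγ : 0 < s.rvar rGamma) (hx : 0 < s.rvar rTarget) :
    Wp A samples logProg s fun s' k => k ≤ 20 * confidence (s.rvar rGamma) (s.rvar rTarget) + 20 ∧
      s'.nvar nConf = confidence (s.rvar rGamma) (s.rvar rTarget) := by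
  simp only [logProg, wp_seq, wp_rset, wp_nset]
  set N := confidence (s.rvar rGamma) (s.rvar rTarget) with hN
  refine (wp_loop N 8 (fun i s' => s'.nvar nConf = i ∧
    s'.rvar rPower = 2 ^ i * s.rvar rGamma) ?_ ?_ ?_).mono ?_
  · simp
  · rintro i hi s' hf ⟨h1, h2⟩
    have e1 : s'.rvar rTarget = s.rvar rTarget := (hf.rvar _ rfl).trans (by simp)
    refine ⟨?_, ?_⟩
    · simp only [Test.rlt, Test.Holds, RExp.eval, h2, e1, le_mul_two_pow_iff hγ hx]
      omega
    · simp [h1, h2, pow_succ]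
      ring
  · rintro s' hf ⟨h1, h2⟩
    have e1 : s'.rvar rTarget = s.rvar rTarget := (hf.rvar _ rfl).trans (by simp)
    simp only [Test.rlt, Test.Holds, RExp.eval, h2, e1, le_mul_two_pow_iff hγ hx]
    omega
  · rintro s' k hf ⟨hk, h1, -⟩
    simp only [Test.rlt, Test.cost, RExp.cost, NExp.cost] at hk ⊢
    exact ⟨by omega, h1⟩

theorem wp_setupProg {ε γ β : ℝ} (hm : 1 ≤ m) (hε : 0 < ε) (hγ : 0 < γ)
    (hβ : β = ε / (100 * m)) :
    Wp A samples setupProg (inputState m ε γ) fun s' k =>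
      k ≤ 20 * firstConfidence β γ + 60 ∧ s'.rvar rBeta = β ∧
      s'.rvar rGoal = repetitionGoal β γ := by
  have hm' : (0 : ℝ) < m := by exact_mod_cast hm
  have hβ0 : 0 < β := by rw [hβ]; positivity
  simp only [setupProg, wp_seq, wp_rset]
  refine (wp_logProg ?_ ?_).mono ?_
  · simpa [inputState] using hγ
  · simp [inputState]
    exact ⟨hε.ne', by omega⟩
  · rintro s' k hf ⟨hk, hL⟩
    have e1 : s'.rvar rBeta = β := (hf.rvar _ rfl).trans (by simp [inputState, hβ])
    simp [inputState, ← hβ, ← sq] at hk hL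
    simp [e1, hL, repetitionGoal, firstConfidence, ← sq]
    omega

/-- The memory during the first sampling stage, after `i` samples; `D` enumerates the distinct
jobs in the order of their first appearance. -/
structure FirstInv (I : JobInstance) (label : Fin I.n → ℕ) (ω : ℕ → Fin I.n) (D : ℕ → Fin I.n)
    (i : ℕ) (s : MachineState) : Prop where
  drawn : s.drawn = i
  samples : s.nvar nSamples = i
  hits : s.nvar nHits = I.hits ω i
  seen : s.rvar rSeen = ∑ j ∈ I.seen ω i, I.p j
  sum : s.rvar rSum = I.weightSum ω i
  first : ∀ j < i, s.rarr aFirst j = I.p (ω j)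
  mark : ∀ j, 1 ≤ s.narr aMark (label j) ↔ j ∈ I.seen ω i
  inj : Set.InjOn D (Finset.range (s.nvar nSeen))
  image : (Finset.range (s.nvar nSeen)).image D = I.seen ω i
  size : ∀ j < s.nvar nSeen, s.rarr aSize j = I.p (D j)
  label : ∀ j < s.nvar nSeen, s.narr aLabel j = label (D j)

theorem seen_succ {I : JobInstance} (ω : ℕ → Fin I.n) (i : ℕ) :
    I.seen ω (i + 1) = insert (ω i) (I.seen ω i) := by
  rw [JobInstance.seen, Finset.range_add_one, Finset.image_insert]
  rfl

theorem wp_firstBody {I : JobInstance} {label : Fin I.n → ℕ} (hl : Function.Injective label)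
    {ω : ℕ → Fin I.n} {i : ℕ} (h : ∃ D, FirstInv I label ω D i s) :
    Wp A (fun i => (label (ω i), I.p (ω i))) firstBody s fun s' k =>
      k ≤ 40 ∧ ∃ D, FirstInv I label ω D (i + 1) s' := by
  obtain ⟨D, h⟩ := h
  have hw : I.weightSum ω (i + 1) = I.weightSum ω i + ∑ j ∈ I.seen ω i, I.p j := by
    rw [JobInstance.weightSum, Finset.sum_range_succ]
    rfl
  have hmark := h.mark (ω i)
  have hfirst : ∀ j < i + 1, Function.update (s.rarr aFirst) (s.nvar nSamples) (I.p (ω i)) j =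
      I.p (ω j) := fun j hj => by
    rw [h.samples]
    rcases (show j < i ∨ j = i by omega) with hj | rfl
    · rw [Function.update_of_ne (by omega), h.first j hj]
    · simp
  simp only [firstBody, wp_seq, wp_sample, wp_rstore, wp_incr, wp_rset, wp_branch, wp_nstore]
  constructor
  · intro hb
    have hin : ω i ∈ I.seen ω i := hmark.1 (by simpa [h.drawn] using hb)
    have hs : I.seen ω (i + 1) = I.seen ω i := by
      rw [seen_succ, Finset.insert_eq_of_mem hin]
    refine ⟨by simp, D, ?_⟩
    constructor
    · simp [h.drawn]
    · simp [h.samples]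
    · simp [h.hits, JobInstance.hits_succ, hin]
    · simp [h.seen, hs]
    · simp [h.sum, h.seen, hw]
    · simpa [h.drawn] using hfirst
    · simpa [hs] using h.mark
    · simpa using h.inj
    · simpa [hs] using h.image
    · simpa using h.size
    · simpa using h.label
  · intro hb
    have hin : ω i ∉ I.seen ω i := fun hn => hb (by simpa [h.drawn] using hmark.2 hn)
    have hs := seen_succ ω i
    set c := s.nvar nSeen with hc
    have hDne : ∀ j < c, Function.update D c (ω i) j = D j := fun j hj =>
      Function.update_of_ne (by omega) _ _
    refine ⟨by simp, Function.update D c (ω i), ?_⟩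
    constructor
    · simp [h.drawn]
    · simp [h.samples]
    · simp [h.hits, JobInstance.hits_succ, hin]
    · simp [h.seen, h.drawn, hs, Finset.sum_insert hin, add_comm]
    · simp [h.sum, h.seen, hw]
    · simpa [h.drawn] using hfirst
    · intro j
      simp only [MachineState.countSample_narr, MachineState.nset_narr, MachineState.rset_narr,
        MachineState.rstore_narr, MachineState.nstore_narr, NExp.eval,
        MachineState.rset_nvar, MachineState.nset_nvar, MachineState.rstore_nvar,
        MachineState.countSample_nvar, h.drawn, hs, Finset.mem_insert]
      by_cases hj : j = ω i
      · simp [hj]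
      · have : label j ≠ label (ω i) := fun he => hj (hl he)
        simp [this, hj, h.mark j]
    · intro a ha b hb' hab
      simp [← hc] at ha hb'
      rcases (show a < c ∨ a = c by omega) with ha' | rfl <;>
      rcases (show b < c ∨ b = c by omega) with hb'' | rfl
      · rw [hDne a ha', hDne b hb''] at hab
        exact h.inj (by simpa [← hc] using ha') (by simpa [← hc] using hb'') hab
      · rw [hDne a ha', Function.update_self] at hab
        exact absurd (hab ▸ h.image ▸ Finset.mem_image_of_mem D (by simpa [← hc] using ha')) hin
      · rw [hDne b hb'', Function.update_self] at hab
        exact absurd (hab ▸ h.image ▸ Finset.mem_image_of_mem D (by simpa [← hc] using hb'')) hin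
      · rfl
    · simp only [MachineState.nset_nvar, MachineState.nstore_nvar, MachineState.rstore_nvar,
        MachineState.rset_nvar, MachineState.countSample_nvar]
      simp [← hc]
      rw [Finset.range_add_one, Finset.image_insert, Function.update_self, hs, ← h.image, ← hc]
      congr 1
      exact Finset.image_congr fun j hj => hDne j (by simpa using hj)
    · intro j hj
      simp [← hc] at hj ⊢
      rcases (show j < c ∨ j = c by omega) with hj' | rfl
      · rw [Function.update_of_ne (by omega), hDne j hj', h.size j hj']
      · simp [h.drawn]
    · intro j hj
      simp [← hc] at hj ⊢
      rcases (show j < c ∨ j = c by omega) with hj' | rfl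
      · rw [Function.update_of_ne (by omega), hDne j hj', h.label j hj']
      · simp [h.drawn]

theorem wp_firstProg {I : JobInstance} {label : Fin I.n → ℕ} (hl : Function.Injective label)
    {ω : ℕ → Fin I.n} {τ : ℕ} (hr : s.rvar rGoal ≤ I.hits ω τ)
    (hb : ∀ i < τ, (I.hits ω i : ℝ) < s.rvar rGoal) (h0 : ∃ D, FirstInv I label ω D 0 s) :
    Wp A (fun i => (label (ω i), I.p (ω i))) firstProg s fun s' k =>
      k ≤ 50 * τ + 10 ∧ ∃ D, FirstInv I label ω D τ s' := by
  refine (wp_loop τ 40 (fun i s' => ∃ D, FirstInv I label ω D i s') h0 ?_ ?_).mono ?_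
  · rintro i hi s' hf hI
    refine ⟨?_, wp_firstBody hl hI⟩
    obtain ⟨D, hI⟩ := hI
    have e1 : s'.rvar rGoal = s.rvar rGoal := hf.rvar _ rfl
    simpa [hI.hits, e1] using hb i hi
  · rintro s' hf ⟨D, hI⟩
    have e1 : s'.rvar rGoal = s.rvar rGoal := hf.rvar _ rfl
    simpa [hI.hits, e1] using hr
  · rintro s' k hf ⟨hk, hI⟩
    refine ⟨?_, hI⟩
    simp at hk
    omega

end

/-! ### The grid and the second sampling stage -/

section

variable {m : ℕ} {A : BlackBox m} {samples : ℕ → ℕ × ℝ} {s : MachineState}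

/-- The grid below `P` has been computed up to its `i`-th boundary. -/
structure GridInv (P β : ℝ) (i : ℕ) (s : MachineState) : Prop where
  length : s.nvar nLength = i
  top : s.rvar rTop = P * (1 - β) ^ i
  grid : ∀ j ≤ i, s.rarr aGrid j = P * (1 - β) ^ j

theorem wp_gridStep {P β : ℝ} {i : ℕ} (h : GridInv P β i s) (hβ : s.rvar rBeta = β) :
    Wp A samples gridStep s fun s' k => k ≤ 20 ∧ GridInv P β (i + 1) s' := by
  simp only [gridStep, wp_seq, wp_rset, wp_incr, wp_rstore]
  refine ⟨by simp, ?_, ?_, fun j hj => ?_⟩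
  · simp [h.length]
  · simp [h.top, hβ, pow_succ, mul_assoc]
  · simp only [MachineState.rstore_rarr, MachineState.nset_nvar, MachineState.nset_rarr, NExp.eval,
      MachineState.rset_nvar, h.length, MachineState.rset_rarr]
    rcases (show j ≤ i ∨ j = i + 1 by omega) with hj | rfl
    · simp [show j ≠ i + 1 by omega, h.grid j hj]
    · simp [h.top, hβ, pow_succ, mul_assoc]

theorem wp_gridProg {P β : ℝ} (hβ0 : 0 < β) (hβ : s.rvar rBeta = β)
    (hP : s.rvar rSum / s.nvar nHits * (1 + 3 * β) = P) (hP0 : 0 < P) (hl : s.nvar nLength = 0) :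
    Wp A samples gridProg s fun s' k => k ≤ 40 * knownLength β + 80 ∧ s'.rvar rTotal = P ∧
      s'.nvar nKnown = knownLength β ∧ GridInv P β (knownLength β) s' := by
  have key : ∀ i s', GridInv P β i s' → s'.rvar rBeta = β → s'.rvar rTotal = P →
      ((Test.rlt (.mul (.mul (.var rBeta) (.var rBeta)) (.var rTotal)) (.var rTop)).Holds s' ↔
        β ^ 2 < (1 - β) ^ i) := by
    intro i s' h h1 h2
    simp [h.top, h1, h2]
    rw [mul_comm P, mul_lt_mul_iff_left₀ hP0, sq]
  simp only [gridProg, wp_seq, wp_rset, wp_rstore, wp_nset]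
  refine (wp_loop (knownLength β) 20 (GridInv P β) ?_ ?_ ?_).mono ?_
  · refine ⟨by simp [hl], by simp [hβ, hP], fun j hj => ?_⟩
    obtain rfl : j = 0 := by omega
    simp [hβ, hP]
  · intro i hi s' hf hI
    have e1 : s'.rvar rBeta = β := (hf.rvar _ rfl).trans (by simp [hβ])
    have e2 : s'.rvar rTotal = P := (hf.rvar _ rfl).trans (by simp [hP, hβ])
    exact ⟨(key i s' hI e1 e2).2 (JobInstance.lt_pow_of_lt_knownLength hi), wp_gridStep hI e1⟩
  · intro s' hf hI
    have e1 : s'.rvar rBeta = β := (hf.rvar _ rfl).trans (by simp [hβ])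
    have e2 : s'.rvar rTotal = P := (hf.rvar _ rfl).trans (by simp [hP, hβ])
    rw [key _ s' hI e1 e2, not_lt]
    exact JobInstance.knownLength_spec hβ0
  · rintro s' k hf ⟨hk, hI⟩
    refine ⟨?_, ?_, ?_, ?_, ?_, ?_⟩
    · simp at hk ⊢
      omega
    · simpa [hP, hβ] using hf.rvar rTotal rfl
    · simp [hI.length]
    · simpa using hI.length
    · simpa using hI.top
    · simpa using hI.grid

theorem wp_lengthProg {P β : ℝ} {κ t τ : ℕ} (hI : GridInv P β κ s) (hβ : s.rvar rBeta = β)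
    (hβ1 : β < 1) (hs : s.nvar nSamples = τ) (hτ : 0 < τ) (hκ : κ < t)
    (ht : (((Finset.range τ).filter fun j => s.rarr aFirst j ≤ P * (1 - β) ^ t).card : ℝ) ≤ β * τ)
    (hlt : ∀ k, κ < k → k < t → β * τ <
      (((Finset.range τ).filter fun j => s.rarr aFirst j ≤ P * (1 - β) ^ k).card : ℝ)) :
    Wp A samples lengthProg s fun s' k => k ≤ 60 * t * (τ + 1) + 10 ∧ GridInv P β t s' := by
  simp only [lengthProg, wp_seq, wp_nset]
  refine (wp_loop (t - κ) (τ * 20 + 30) (fun i s' => GridInv P β (κ + i) s' ∧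
    s'.nvar nCount = if i = 0 then τ else ((Finset.range τ).filter fun j =>
      s.rarr aFirst j ≤ P * (1 - β) ^ (κ + i)).card) ?_ ?_ ?_).mono ?_
  · exact ⟨⟨by simpa using hI.length, by simpa using hI.top, by simpa using hI.grid⟩, by simp [hs]⟩
  · rintro i hi s' hf ⟨hI, hc⟩
    have e1 : s'.rvar rBeta = β := (hf.rvar _ rfl).trans (by simp [hβ])
    have e2 : s'.nvar nSamples = τ := (hf.nvar _ rfl).trans (by simp [hs])
    have e3 : s'.rarr aFirst = s.rarr aFirst := (hf.rarr _ rfl).trans (by simp)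
    have hτ' : (0 : ℝ) < τ := by exact_mod_cast hτ
    constructor
    · simp [e1, e2, hc]
      split_ifs with h0
      · nlinarith
      · exact hlt _ (by omega) (by omega)
    · rw [wp_seq]
      refine (wp_gridStep hI e1).mono fun s₁ k₁ hf₁ ⟨hk₁, hI₁⟩ => ?_
      refine (wp_countLoop (by norm_num) τ (fun j => s.rarr aFirst j ≤ P * (1 - β) ^ (κ + (i + 1)))
        ?_ ?_).mono ?_
      · intro s₂ hf₂
        exact (hf₂.nvar nSamples rfl).trans ((hf₁.nvar nSamples rfl).trans e2)
      · intro s₂ hf₂ _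
        have e4 : s₂.rarr aFirst = s.rarr aFirst :=
          (hf₂.rarr aFirst rfl).trans ((hf₁.rarr aFirst rfl).trans e3)
        have e5 : s₂.rvar rTop = P * (1 - β) ^ (κ + (i + 1)) :=
          (hf₂.rvar rTop rfl).trans hI₁.top
        simp [e4, e5]
      · rintro s₂ k₂ hf₂ ⟨hk₂, hq⟩
        refine ⟨by simp at hk₂; omega, ⟨(hf₂.nvar nLength rfl).trans hI₁.length,
          (hf₂.rvar rTop rfl).trans hI₁.top, fun j hj => ?_⟩, by simpa using hq⟩
        rw [hf₂.rarr aGrid rfl, hI₁.grid j hj]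
  · rintro s' hf ⟨hI, hc⟩
    have e1 : s'.rvar rBeta = β := (hf.rvar _ rfl).trans (by simp [hβ])
    have e2 : s'.nvar nSamples = τ := (hf.nvar _ rfl).trans (by simp [hs])
    simp [e1, e2, hc, show t - κ ≠ 0 by omega, show κ + (t - κ) = t by omega]
    exact ht
  · rintro s' k hf ⟨hk, hI, -⟩
    rw [show κ + (t - κ) = t by omega] at hI
    refine ⟨?_, hI⟩
    simp at hk ⊢
    have h1 : (t - κ) * (τ * 20 + 30 + 8) ≤ t * (τ * 20 + 38) :=
      Nat.mul_le_mul (by omega) (by omega)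
    nlinarith

theorem wp_secondProg {β γ : ℝ} {t τ d : ℕ} (hγ : 0 < γ) (hβ : s.rvar rBeta = β)
    (hγ' : s.rvar rGamma = γ) (ht : s.nvar nLength = t) (hτ : s.nvar nSamples = τ)
    (hd : s.drawn = d) (h0 : s.nvar nSecond = 0) :
    Wp A samples secondProg s fun s' k =>
      k ≤ 20 * secondConfidence γ t τ + 20 * ⌈(t : ℝ) * secondConfidence γ t τ / β ^ 2⌉₊ + 100 ∧
      s'.nvar nSecond = ⌈(t : ℝ) * secondConfidence γ t τ / β ^ 2⌉₊ ∧
      ∀ j < ⌈(t : ℝ) * secondConfidence γ t τ / β ^ 2⌉₊,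
        s'.rarr aSecond j = (samples (d + j)).2 := by
  set N := ⌈(t : ℝ) * secondConfidence γ t τ / β ^ 2⌉₊ with hN
  simp only [secondProg, wp_seq, wp_rset]
  refine (wp_logProg ?_ ?_).mono ?_
  · simpa [hγ'] using hγ
  · simp [ht, hτ]
    positivity
  · rintro s₁ k₁ hf₁ ⟨hk₁, hL⟩
    have hx : (16 * ((t : ℝ) + 1) * ((t : ℝ) + 1) * (((τ : ℝ) + 1) * ((τ : ℝ) + 1))) =
        16 * ((t : ℝ) + 1) ^ 2 * ((τ : ℝ) + 1) ^ 2 := by ring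
    simp [ht, hτ, hγ', hx] at hk₁ hL
    rw [← secondConfidence] at hk₁ hL
    have e1 : s₁.rvar rBeta = β := (hf₁.rvar _ rfl).trans (by simp [hβ])
    have e2 : s₁.nvar nLength = t := (hf₁.nvar _ rfl).trans (by simp [ht])
    have e3 : s₁.nvar nSecond = 0 := (hf₁.nvar _ rfl).trans (by simp [h0])
    have e4 : s₁.drawn = d := (hf₁.drawn rfl).trans (by simp [hd])
    have e5 : ∀ i : ℕ, ((t : ℝ) * secondConfidence γ t τ / (β * β) ≤ i ↔ N ≤ i) := fun i => by
      rw [hN, Nat.ceil_le, sq]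
    refine (wp_loop N 8 (fun i s' => s'.nvar nSecond = i ∧ s'.drawn = d + i ∧
      ∀ j < i, s'.rarr aSecond j = (samples (d + j)).2) ?_ ?_ ?_).mono ?_
    · simp [e3, e4]
    · rintro i hi s' hf ⟨h1, h2, h3⟩
      have e6 := hf.rvar rGoal rfl
      constructor
      · simp [h1, e6, e2, hL, e1]
        rw [← not_le, e5]
        omega
      · simp [h1, h2, add_assoc]
        intro j hj
        rcases (show j < i ∨ j = i by omega) with hj | rfl
        · rw [Function.update_of_ne (by omega), h3 j hj]
        · simp
    · rintro s' hf ⟨h1, h2, h3⟩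
      have e6 := hf.rvar rGoal rfl
      simp [h1, e6, e2, hL, e1]
      rw [e5]
    · rintro s' k hf ⟨hk, h1, h2, h3⟩
      refine ⟨?_, h1, h3⟩
      simp at hk ⊢
      omega

end

/-! ### Packing the known jobs into items -/

/-- The jobs of `J` are packed into items: the items below `R` consist of sand, the others of the
jobs that `ent` sends to them, and every item that is larger than `2 * θ` is a single job. The
number of items is bounded by their total size. -/
structure Packing {n : ℕ} (p : Fin n → ℝ) (θ : ℝ) (J : Finset (Fin n)) (R N : ℕ) (q : ℕ → ℝ)
    (ent : Fin n → ℕ) : Prop where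
  le : R ≤ N
  sand : ∀ e < R, q e = θ
  mem : ∀ j ∈ J, R ≤ ent j ∧ ent j < N
  size : ∀ e, R ≤ e → e < N → q e = ∑ j ∈ J with ent j = e, p j
  small_or_single : ∀ e, R ≤ e → e < N → q e ≤ 2 * θ ∨ ∃ j, ∀ l ∈ J, ent l = e → l = j
  pos : ∀ e < N, 0 < q e
  card_le : N * θ ≤ 2 * ∑ e ∈ Finset.range N, q e + θ

/-- A packing together with an item `cur` that takes further jobs until its size reaches `θ`. -/
structure OpenPacking {n : ℕ} (p : Fin n → ℝ) (θ : ℝ) (J : Finset (Fin n)) (R N : ℕ) (q : ℕ → ℝ)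
    (ent : Fin n → ℕ) (cur : ℕ) : Prop extends Packing p θ J R N q ent where
  zero : ∀ e, N ≤ e → q e = 0
  cur_lt : cur < N
  potential : N * θ ≤ 2 * ∑ e ∈ Finset.range N, q e + if q cur < θ then θ - 2 * q cur else 0

section

variable {n : ℕ} {p : Fin n → ℝ} {θ : ℝ} {J : Finset (Fin n)} {R N : ℕ} {q : ℕ → ℝ}
  {ent : Fin n → ℕ} {cur : ℕ}

theorem filter_insert_update {j : Fin n} (hj : j ∉ J) (c e : ℕ) :
    ((insert j J).filter fun l => Function.update ent j c l = e) =
      if c = e then insert j (J.filter fun l => ent l = e) else J.filter fun l => ent l = e := by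
  rw [Finset.filter_insert, Function.update_self]
  have : (J.filter fun l => Function.update ent j c l = e) = J.filter fun l => ent l = e :=
    Finset.filter_congr fun l hl => by rw [Function.update_of_ne (by rintro rfl; exact hj hl)]
  rw [this]

theorem OpenPacking.add (h : OpenPacking p θ J R N q ent cur) {j : Fin n} (hj : j ∉ J)
    (hp : 0 < p j) (hpθ : p j ≤ θ) (hq : q cur < θ) :
    OpenPacking p θ (insert j J) R N (Function.update q cur (q cur + p j))
      (Function.update ent j cur) cur := by
  have hRc : R ≤ cur := by
    by_contra! hlt
    linarith [h.sand cur hlt]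
  have hsum : ∑ e ∈ Finset.range N, Function.update q cur (q cur + p j) e =
      ∑ e ∈ Finset.range N, q e + p j := by
    rw [Finset.sum_update_of_mem (Finset.mem_range.2 h.cur_lt),
      ← Finset.add_sum_erase _ q (Finset.mem_range.2 h.cur_lt), Finset.sdiff_singleton_eq_erase]
    ring
  have hne : ∀ l ∈ J, l ≠ j := fun l hl => by rintro rfl; exact hj hl
  have hc0 := h.pos cur h.cur_lt
  have hpot := h.potential
  rw [if_pos hq] at hpot
  refine { le := h.le, sand := fun e he => ?_, mem := fun l hl => ?_, size := fun e he heN => ?_,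
           small_or_single := fun e he heN => ?_, pos := fun e he => ?_, card_le := ?_,
           zero := fun e he => ?_, cur_lt := h.cur_lt, potential := ?_ }
  · rw [Function.update_of_ne (by omega), h.sand e he]
  · rcases Finset.mem_insert.1 hl with rfl | hl'
    · rw [Function.update_self]
      exact ⟨hRc, h.cur_lt⟩
    · rw [Function.update_of_ne (hne l hl')]
      exact h.mem l hl'
  · rw [filter_insert_update hj]
    split_ifs with hce
    · subst hce
      rw [Function.update_self, Finset.sum_insert (by simp [hj]), h.size cur he heN]
      ring
    · rw [Function.update_of_ne (Ne.symm hce), h.size e he heN]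
  · by_cases hce : e = cur
    · subst hce
      left
      rw [Function.update_self]
      linarith
    · rw [Function.update_of_ne hce]
      refine (h.small_or_single e he heN).imp_right fun ⟨j₀, hj₀⟩ => ⟨j₀, fun l hl hle => ?_⟩
      rcases Finset.mem_insert.1 hl with rfl | hl'
      · rw [Function.update_self] at hle
        exact absurd hle.symm hce
      · rw [Function.update_of_ne (hne l hl')] at hle
        exact hj₀ l hl' hle
  · by_cases hce : e = cur
    · subst hce
      rw [Function.update_self]
      linarith
    · rw [Function.update_of_ne hce]
      exact h.pos e he
  · rw [hsum]
    linarith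
  · rw [Function.update_of_ne (by have := h.cur_lt; omega), h.zero e he]
  · rw [hsum, Function.update_self]
    split_ifs <;> linarith

theorem OpenPacking.new (h : OpenPacking p θ J R N q ent cur) (hθ : 0 ≤ θ) {j : Fin n} (hj : j ∉ J)
    (hp : 0 < p j) (hn : ¬ (p j ≤ θ ∧ q cur < θ)) :
    OpenPacking p θ (insert j J) R (N + 1) (Function.update q N (q N + p j))
      (Function.update ent j N) N := by
  have hqN : q N = 0 := h.zero N le_rfl
  rw [hqN, zero_add]
  have hlt : ∀ e < N, Function.update q N (p j) e = q e := fun e he =>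
    Function.update_of_ne (by omega) _ _
  have hsum : ∑ e ∈ Finset.range (N + 1), Function.update q N (p j) e =
      ∑ e ∈ Finset.range N, q e + p j := by
    rw [Finset.sum_range_succ, Function.update_self,
      Finset.sum_congr rfl fun e he => hlt e (Finset.mem_range.1 he)]
  have hne : ∀ l ∈ J, l ≠ j := fun l hl => by rintro rfl; exact hj hl
  have hpot := h.potential
  have hR := h.le
  have hc0 := h.pos cur h.cur_lt
  have hfin : ((N + 1 : ℕ) : ℝ) * θ ≤ 2 * (∑ e ∈ Finset.range N, q e + p j) +
      if p j < θ then θ - 2 * p j else 0 := by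
    push_cast
    rw [not_and_or, not_le, not_lt] at hn
    split_ifs at hpot ⊢ <;> rcases hn with hn | hn <;> linarith
  refine { le := by omega, sand := fun e he => ?_, mem := fun l hl => ?_,
           size := fun e he heN => ?_, small_or_single := fun e he heN => ?_,
           pos := fun e he => ?_, card_le := ?_, zero := fun e he => ?_,
           cur_lt := by omega, potential := ?_ }
  · rw [hlt e (by omega), h.sand e he]
  · rcases Finset.mem_insert.1 hl with rfl | hl'
    · rw [Function.update_self]
      omega
    · rw [Function.update_of_ne (hne l hl')]
      have := h.mem l hl'
      omega
  · rw [filter_insert_update hj]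
    split_ifs with hce
    · subst hce
      have : (J.filter fun l => ent l = N) = ∅ := Finset.filter_eq_empty_iff.2 fun l hl => by
        have := h.mem l hl
        omega
      rw [Function.update_self, this]
      simp
    · rw [hlt e (by omega), h.size e he (by omega)]
  · rcases (show e < N ∨ e = N by omega) with he' | rfl
    · rw [hlt e he']
      refine (h.small_or_single e he he').imp_right fun ⟨j₀, hj₀⟩ => ⟨j₀, fun l hl hle => ?_⟩
      rcases Finset.mem_insert.1 hl with rfl | hl'
      · rw [Function.update_self] at hle
        omega
      · rw [Function.update_of_ne (hne l hl')] at hle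
        exact hj₀ l hl' hle
    · refine Or.inr ⟨j, fun l hl hle => ?_⟩
      rcases Finset.mem_insert.1 hl with rfl | hl'
      · rfl
      · rw [Function.update_of_ne (hne l hl')] at hle
        have := h.mem l hl'
        omega
  · rcases (show e < N ∨ e = N by omega) with he' | rfl
    · rw [hlt e he']
      exact h.pos e he'
    · rwa [Function.update_self]
  · rw [hsum]
    refine hfin.trans ?_
    split_ifs <;> linarith
  · rw [Function.update_of_ne (by omega), h.zero e (by omega)]
  · rw [hsum, Function.update_self]
    exact hfin

end

section

variable {m : ℕ} {A : BlackBox m} {samples : ℕ → ℕ × ℝ} {s : MachineState}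

/-- The distinct jobs of the first stage, in the order `D` of their first appearance. -/
structure SeenList (I : JobInstance) (label : Fin I.n → ℕ) (D : ℕ → Fin I.n) (c : ℕ)
    (s : MachineState) : Prop where
  card : s.nvar nSeen = c
  inj : Set.InjOn D (Finset.range c)
  size : ∀ j < c, s.rarr aSize j = I.p (D j)
  label : ∀ j < c, s.narr aLabel j = label (D j)

theorem SeenList.of_frame {I : JobInstance} {label : Fin I.n → ℕ} {D : ℕ → Fin I.n} {c : ℕ}
    {s s' : MachineState} (h : SeenList I label D c s) (h1 : s'.nvar nSeen = s.nvar nSeen)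
    (h2 : s'.rarr aSize = s.rarr aSize) (h3 : s'.narr aLabel = s.narr aLabel) :
    SeenList I label D c s' :=
  ⟨h1.trans h.card, h.inj, fun j hj => by rw [h2, h.size j hj],
    fun j hj => by rw [h3, h.label j hj]⟩

/-- The jobs of size more than `b` among the first `i` distinct jobs. -/
noncomputable def knownJobs (I : JobInstance) (D : ℕ → Fin I.n) (b : ℝ) (i : ℕ) :
    Finset (Fin I.n) := ((Finset.range i).image D).filter fun j => b < I.p j

theorem knownJobs_succ (I : JobInstance) (D : ℕ → Fin I.n) (b : ℝ) (i : ℕ) :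
    knownJobs I D b (i + 1) =
      if b < I.p (D i) then insert (D i) (knownJobs I D b i) else knownJobs I D b i := by
  rw [knownJobs, Finset.range_add_one, Finset.image_insert, Finset.filter_insert]
  rfl

theorem notMem_knownJobs {I : JobInstance} {D : ℕ → Fin I.n} {c i : ℕ}
    (h : Set.InjOn D (Finset.range c)) (hi : i < c) (b : ℝ) : D i ∉ knownJobs I D b i := by
  intro hm
  obtain ⟨j, hj, hji⟩ := Finset.mem_image.1 (Finset.mem_filter.1 hm).1
  have hj := Finset.mem_range.1 hj
  have := h (by simp; omega) (by simpa using hi) hji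
  omega

theorem wp_sandProg {I : JobInstance} {label : Fin I.n → ℕ} {D : ℕ → Fin I.n} {c : ℕ}
    {P β b : ℝ} (hP : 0 < P) (hβ0 : 0 < β) (hD : SeenList I label D c s)
    (hβ : s.rvar rBeta = β) (hT : s.rvar rTotal = P) (hb : s.rarr aGrid (s.nvar nKnown) = b)
    (h0 : s.nvar nSand = 0) (hq : ∀ e, s.rarr aItem e = 0) {R : ℕ}
    (hR : R = ⌈(P + β ^ 2 * P - ∑ j ∈ knownJobs I D b c, I.p j) / (β * P)⌉₊) :
    Wp A samples sandProg s fun s' k => k ≤ 40 * c + 30 * R + 100 ∧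
      s'.nvar nSand = R ∧ s'.rvar rItem = β * P ∧ (∀ e < R, s'.rarr aItem e = β * P) ∧
      ∀ e, R ≤ e → s'.rarr aItem e = 0 := by
  have hθ : 0 < β * P := by positivity
  simp only [sandProg, wp_seq, wp_rset]
  set s₀ := (s.rset rItem (RExp.eval s (.mul (.var rBeta) (.var rTotal)))).rset rRest
    (RExp.eval (s.rset rItem (RExp.eval s (.mul (.var rBeta) (.var rTotal))))
      (.add (.var rTotal) (.mul (.mul (.var rBeta) (.var rBeta)) (.var rTotal)))) with hs₀
  refine (wp_forLoop c 30 (fun i s' => s'.rvar rRest =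
    P + β ^ 2 * P - ∑ j ∈ knownJobs I D b i, I.p j) ?_ ?_ ?_ ?_).mono ?_
  · rfl
  · intro s' hf
    exact (hf.nvar nSeen rfl).trans (by simpa [hs₀] using hD.card)
  · simp [hs₀, hT, hβ, knownJobs, sq]
  · rintro i hi s' hf hxi hI
    have e1 : s'.rarr aSize i = I.p (D i) :=
      (congrFun (hf.rarr aSize rfl) i).trans (by simpa [hs₀] using hD.size i hi)
    have e2 : s'.rarr aGrid (s'.nvar nKnown) = b := by
      rw [hf.rarr aGrid rfl, hf.nvar nKnown rfl]
      simpa [hs₀] using hb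
    rw [knownJobs_succ]
    simp only [isKnown, wp_branch, wp_rset, wp_skip]
    constructor
    · intro h
      have h : b < I.p (D i) := by simpa [e1, e2, hxi] using h
      rw [if_pos h, Finset.sum_insert (notMem_knownJobs hD.inj hi b)]
      refine ⟨by simp, ?_⟩
      simp [hxi, e1, hI]
      ring
    · intro h
      have h : ¬ b < I.p (D i) := by simpa [e1, e2, hxi] using h
      rw [if_neg h]
      exact ⟨by simp, by simpa using hI⟩
  · rintro s₁ k₁ hf₁ ⟨hk₁, -, hr₁⟩
    set z := P + β ^ 2 * P - ∑ j ∈ knownJobs I D b c, I.p j with hz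
    have e1 : s₁.rvar rItem = β * P := (hf₁.rvar rItem rfl).trans (by simp [hs₀, hβ, hT])
    have e2 : s₁.nvar nSand = 0 := (hf₁.nvar nSand rfl).trans (by simpa [hs₀] using h0)
    have e3 : s₁.rarr aItem = s.rarr aItem := (hf₁.rarr aItem rfl).trans (by simp [hs₀])
    have key : ∀ i : ℕ, 0 < z - i * (β * P) ↔ i < R := fun i => by
      rw [hR, Nat.lt_ceil, lt_div_iff₀ hθ, sub_pos]
    refine (wp_loop R 20 (fun i s' => s'.nvar nSand = i ∧ s'.rvar rRest = z - i * (β * P) ∧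
      (∀ e < i, s'.rarr aItem e = β * P) ∧ ∀ e, i ≤ e → s'.rarr aItem e = 0) ?_ ?_ ?_).mono ?_
    · simp [e2, hr₁, e3, hq]
    · rintro i hi s' hf ⟨h1, h2, h3, h4⟩
      have e4 : s'.rvar rItem = β * P := (hf.rvar rItem rfl).trans e1
      refine ⟨by simpa [h2] using (key i).2 hi, ?_⟩
      simp only [wp_seq, wp_rstore, wp_incr, wp_rset]
      refine ⟨by simp, by simp [h1], ?_, fun e he => ?_, fun e he => ?_⟩
      · simp [h2, e4]
        ring
      · simp [h1, e4]
        rcases (show e < i ∨ e = i by omega) with he | rfl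
        · rw [Function.update_of_ne (by omega), h3 e he]
        · simp
      · simp [h1]
        rw [Function.update_of_ne (by omega), h4 e (by omega)]
    · rintro s' hf ⟨h1, h2, h3, h4⟩
      have := (key R).not.2 (lt_irrefl R)
      simpa [h2] using this
    · rintro s' k hf ⟨hk, h1, -, h3, h4⟩
      refine ⟨?_, h1, (hf.rvar rItem rfl).trans e1, h3, h4⟩
      simp at hk hk₁ ⊢
      omega

theorem wp_bundleProg {I : JobInstance} {label : Fin I.n → ℕ} (hl : Function.Injective label)
    {D : ℕ → Fin I.n} {c : ℕ} {b θ : ℝ} (hD : SeenList I label D c s)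
    (hb : s.rarr aGrid (s.nvar nKnown) = b) (hθ : s.rvar rItem = θ) (hθ0 : 0 < θ) {R : ℕ}
    (hR : s.nvar nSand = R) (hR0 : 0 < R) (hq : ∀ e < R, s.rarr aItem e = θ)
    (hq' : ∀ e, R ≤ e → s.rarr aItem e = 0) (h0 : s.nvar nOpen = 0) :
    Wp A samples bundleProg s fun s' k => k ≤ 70 * c + 30 ∧
      Packing I.p θ (knownJobs I D b c) R (s'.nvar nItems) (s'.rarr aItem)
        (fun j => s'.narr aEntry (label j)) := by
  simp only [bundleProg, wp_seq, wp_nset]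
  refine (wp_forLoop c 60 (fun i s' => OpenPacking I.p θ (knownJobs I D b i) R (s'.nvar nItems)
    (s'.rarr aItem) (fun j => s'.narr aEntry (label j)) (s'.nvar nOpen)) ?_ ?_ ?_ ?_).mono ?_
  · rfl
  · intro s' hf
    exact (hf.nvar nSeen rfl).trans (by simpa using hD.card)
  · have hs : ∑ e ∈ Finset.range R, s.rarr aItem e = R * θ := by
      rw [Finset.sum_congr rfl fun e he => hq e (Finset.mem_range.1 he)]
      simp
    have hRθ : 0 ≤ R * θ := by positivity
    have hk0 : knownJobs I D b 0 = ∅ := by simp [knownJobs]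
    simp only [NExp.eval, MachineState.nset_nvar, MachineState.nset_narr, MachineState.nset_rarr,
      hk0, hR, h0]
    norm_num
    refine { le := le_rfl, sand := hq, mem := by simp, size := by omega,
             small_or_single := by omega, pos := fun e he => by rw [hq e he]; exact hθ0,
             card_le := by rw [hs]; linarith, zero := hq', cur_lt := hR0,
             potential := by rw [hs, hq 0 hR0]; simp; linarith }
  · rintro i hi s' hf hxi hI
    have e1 : s'.rarr aSize i = I.p (D i) :=
      (congrFun (hf.rarr aSize rfl) i).trans (by simpa using hD.size i hi)
    have e2 : s'.rarr aGrid (s'.nvar nKnown) = b := by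
      rw [hf.rarr aGrid rfl, hf.nvar nKnown rfl]
      simpa using hb
    have e3 : s'.narr aLabel i = label (D i) :=
      (congrFun (hf.narr aLabel rfl) i).trans (by simpa using hD.label i hi)
    have e4 : s'.rvar rItem = θ := (hf.rvar rItem rfl).trans (by simpa using hθ)
    have hupd : ∀ v, (fun j => Function.update (s'.narr aEntry) (label (D i)) v (label j)) =
        Function.update (fun j => s'.narr aEntry (label j)) (D i) v := fun v => by
      funext j
      by_cases hj : j = D i
      · simp [hj]
      · rw [Function.update_of_ne (fun he => hj (hl he)), Function.update_of_ne hj]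
    have hnm := notMem_knownJobs hD.inj hi b
    rw [knownJobs_succ]
    simp only [isKnown, wp_branch, wp_seq, wp_nset, wp_incr, wp_rstore, wp_nstore, wp_skip]
    constructor
    · intro h
      have h : b < I.p (D i) := by simpa [e1, e2, hxi] using h
      rw [if_pos h]
      constructor
      · intro h'
        have h' : I.p (D i) ≤ θ ∧ s'.rarr aItem (s'.nvar nOpen) < θ := by
          simpa [e1, e4, hxi] using h'
        refine ⟨by simp, ?_⟩
        simpa [hxi, e1, e3, hupd] using hI.add hnm (I.p_pos _) h'.1 h'.2
      · intro h'
        have h' : ¬ (I.p (D i) ≤ θ ∧ s'.rarr aItem (s'.nvar nOpen) < θ) := by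
          simpa [e1, e4, hxi] using h'
        refine ⟨by simp, ?_⟩
        simpa [hxi, e1, e3, hupd] using hI.new hθ0.le hnm (I.p_pos _) h'
    · intro h
      have h : ¬ b < I.p (D i) := by simpa [e1, e2, hxi] using h
      rw [if_neg h]
      exact ⟨by simp, by simpa using hI⟩
  · rintro s' k hf ⟨hk, -, hI⟩
    refine ⟨?_, hI.toPacking⟩
    simp at hk ⊢
    omega

end

/-! ### The schedule of the items and the cells of the sketch -/

section

variable {m : ℕ} {A : BlackBox m} {samples : ℕ → ℕ × ℝ} {s : MachineState}

theorem wp_floorProg (hx : 0 ≤ s.rvar rQuot) :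
    Wp A samples floorProg s fun s' k => k ≤ 60 * Nat.size ⌊s.rvar rQuot⌋₊ + 60 ∧
      s'.nvar nCell = ⌊s.rvar rQuot⌋₊ := by
  set f := ⌊s.rvar rQuot⌋₊ with hf
  set a := Nat.size f with ha
  have key : ∀ v : ℕ, (v : ℝ) ≤ s.rvar rQuot ↔ v ≤ f := fun v => (Nat.le_floor_iff hx).symm
  simp only [floorProg, wp_seq, wp_nset, wp_nstore]
  refine (wp_loop a 20 (fun i s' => s'.nvar nDigit = i ∧ ∀ j ≤ i, s'.narr aPower j = 2 ^ j)
    ?_ ?_ ?_).mono ?_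
  · simp
  · rintro i hi s' hfr ⟨h1, h2⟩
    have e1 : s'.rvar rQuot = s.rvar rQuot := (hfr.rvar rQuot rfl).trans (by simp)
    constructor
    · simp only [Test.Holds, RExp.eval, NExp.eval, h1, h2 i le_rfl, e1, key]
      exact Nat.lt_size.1 hi
    · simp only [wp_seq, wp_nstore, wp_incr]
      refine ⟨by simp, by simp [h1], fun j hj => ?_⟩
      simp [h1]
      rcases (show j ≤ i ∨ j = i + 1 by omega) with hj' | rfl
      · rw [Function.update_of_ne (by omega), h2 j hj']
      · rw [Function.update_self, h2 i le_rfl, pow_succ]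
        ring
  · rintro s' hfr ⟨h1, h2⟩
    have e1 : s'.rvar rQuot = s.rvar rQuot := (hfr.rvar rQuot rfl).trans (by simp)
    simp only [Test.Holds, RExp.eval, NExp.eval, h1, h2 a le_rfl, e1, key, not_le]
    exact Nat.size_le.1 le_rfl
  · rintro s₁ k₁ hf₁ ⟨hk₁, h1, h2⟩
    have e1 : s₁.rvar rQuot = s.rvar rQuot := (hf₁.rvar rQuot rfl).trans (by simp)
    refine (wp_loop a 20 (fun i s' => s'.nvar nDigit = a - i ∧ s'.nvar nCell ≤ f ∧
      f < s'.nvar nCell + 2 ^ (a - i)) ?_ ?_ ?_).mono ?_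
    · refine ⟨by simp [h1], by simp, ?_⟩
      simpa using Nat.size_le.1 le_rfl
    · rintro i hi s' hfr ⟨h3, h4, h5⟩
      have e2 : s'.rvar rQuot = s.rvar rQuot := (hfr.rvar rQuot rfl).trans (by simpa using e1)
      have e3 : s'.narr aPower (a - i - 1) = 2 ^ (a - i - 1) := by
        rw [hfr.narr aPower rfl]
        simpa using h2 _ (by omega)
      have e4 : (2 : ℕ) ^ (a - i) = 2 ^ (a - i - 1) + 2 ^ (a - i - 1) := by
        rw [← two_mul, ← pow_succ']
        congr 1
        omega
      refine ⟨by simp [h3]; omega, ?_⟩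
      have hkey := key (s'.nvar nCell + 2 ^ (a - i - 1))
      push_cast at hkey
      simp only [wp_seq, wp_nset, wp_branch, wp_skip]
      rw [show a - (i + 1) = a - i - 1 by omega]
      constructor
      · intro h
        have h : s'.nvar nCell + 2 ^ (a - i - 1) ≤ f := by
          rw [← hkey]
          simpa [h3, e3, e2] using h
        simp [h3, e3]
        omega
      · intro h
        have h : ¬ s'.nvar nCell + 2 ^ (a - i - 1) ≤ f := by
          rw [← hkey]
          simpa [h3, e3, e2] using h
        simp [h3]
        omega
    · rintro s' hfr ⟨h3, -, -⟩
      simp [h3]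
    · rintro s' k hfr ⟨hk, -, h4, h5⟩
      simp at hk hk₁ h5 ⊢
      omega

end

/-- What the algorithm knows before it fills the sketch. -/
structure SketchData (I : JobInstance) where
  /-- the estimate of the total processing time -/
  total : ℝ
  β : ℝ
  /-- the number of intervals with known jobs only -/
  known : ℕ
  /-- the number of intervals -/
  length : ℕ
  /-- the jobs that were seen in the first stage -/
  seen : Finset (Fin I.n)
  /-- the number of items that consist of sand -/
  sand : ℕ
  /-- the number of items -/
  items : ℕ
  size : ℕ → ℝ
  /-- the item of a known job -/
  ent : Fin I.n → ℕ
  /-- the schedule of the items -/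
  machine : ℕ → ℕ
  /-- the number of samples in the second stage -/
  second : ℕ
  /-- the processing times that were sampled in the second stage -/
  sample : ℕ → ℝ

namespace SketchData

variable {I : JobInstance} (d : SketchData I)

/-- The boundaries of the intervals. -/
noncomputable def bound (k : ℕ) : ℝ := d.total * (1 - d.β) ^ k

/-- The jobs above the boundary of the known part of the grid. -/
noncomputable def knownSet : Finset (Fin I.n) := d.seen.filter fun j => d.bound d.known < I.p j

/-- The load of machine `i` in the schedule of the items. -/
noncomputable def load (i : ℕ) : ℝ := ∑ e ∈ Finset.range d.items with d.machine e = i, d.size e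

/-- The number of items of sand on machine `i`. -/
def share (i : ℕ) : ℕ := ((Finset.range d.sand).filter fun e => d.machine e = i).card

/-- The number of samples of the second stage in the `k`-th interval. -/
noncomputable def sampleCount (k : ℕ) : ℕ :=
  ((Finset.range d.second).filter fun j =>
    d.bound (k + 1) < d.sample j ∧ d.sample j ≤ d.bound k).card

/-- The estimated number of jobs of the `k`-th interval that machine `i` is to take, before
rounding. -/
noncomputable def quot (i k : ℕ) : ℝ :=
  (d.share i / d.sand) * (d.sampleCount k / d.second) * d.total / ((1 - d.β) * d.bound k)

/-- The entry of the sketch for machine `i` and the `k`-th interval. -/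
noncomputable def cell (i k : ℕ) : ℕ :=
  if k < d.known then (d.seen.filter fun j =>
    (d.bound (k + 1) < I.p j ∧ I.p j ≤ d.bound k) ∧ d.machine (d.ent j) = i).card
  else ⌊d.quot i k⌋₊ + 1

end SketchData

/-- The memory contains the data. -/
structure DataInv {I : JobInstance} (d : SketchData I) (label : Fin I.n → ℕ) (D : ℕ → Fin I.n)
    (c : ℕ) (s : MachineState) : Prop where
  list : SeenList I label D c s
  image : (Finset.range c).image D = d.seen
  total : s.rvar rTotal = d.total
  beta : s.rvar rBeta = d.β
  known : s.nvar nKnown = d.known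
  length : s.nvar nLength = d.length
  grid : ∀ k ≤ d.length, s.rarr aGrid k = d.bound k
  sand : s.nvar nSand = d.sand
  items : s.nvar nItems = d.items
  size : ∀ e < d.items, s.rarr aItem e = d.size e
  ent : ∀ j, s.narr aEntry (label j) = d.ent j
  machine : ∀ e < d.items, s.narr aMachine e = d.machine e
  second : s.nvar nSecond = d.second
  sample : ∀ j < d.second, s.rarr aSecond j = d.sample j

/-- The program does not write the memory of the data. -/
def Prog.keepsData (c : Prog) : Bool :=
  !(c.writesN nSeen || c.writesN nKnown || c.writesN nLength || c.writesN nSand ||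
    c.writesN nItems || c.writesN nSecond || c.writesR rTotal || c.writesR rBeta ||
    c.writesNArr aLabel || c.writesNArr aEntry || c.writesNArr aMachine ||
    c.writesRArr aSize || c.writesRArr aGrid || c.writesRArr aItem || c.writesRArr aSecond)

section

variable {I : JobInstance} {d : SketchData I} {label : Fin I.n → ℕ} {D : ℕ → Fin I.n} {c : ℕ}
  {m : ℕ} {A : BlackBox m} {samples : ℕ → ℕ × ℝ} {s : MachineState}

theorem DataInv.of_frame {s s' : MachineState} (h : DataInv d label D c s) {pr : Prog}
    (hf : Frame pr s s') (hk : pr.keepsData = true) : DataInv d label D c s' := by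
  simp only [Prog.keepsData, Bool.not_eq_true', Bool.or_eq_false_iff] at hk
  obtain ⟨⟨⟨⟨⟨⟨⟨⟨⟨⟨⟨⟨⟨⟨h1, h2⟩, h3⟩, h4⟩, h5⟩, h6⟩, h7⟩, h8⟩, h9⟩, h10⟩, h11⟩, h12⟩, h13⟩,
    h14⟩, h15⟩ := hk
  exact ⟨h.list.of_frame (hf.nvar _ h1) (hf.rarr _ h12) (hf.narr _ h9), h.image,
    (hf.rvar _ h7).trans h.total, (hf.rvar _ h8).trans h.beta, (hf.nvar _ h2).trans h.known,
    (hf.nvar _ h3).trans h.length, fun k hk => by rw [hf.rarr _ h13, h.grid k hk],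
    (hf.nvar _ h4).trans h.sand, (hf.nvar _ h5).trans h.items,
    fun e he => by rw [hf.rarr _ h14, h.size e he], fun j => by rw [hf.narr _ h10, h.ent j],
    fun e he => by rw [hf.narr _ h11, h.machine e he], (hf.nvar _ h6).trans h.second,
    fun j hj => by rw [hf.rarr _ h15, h.sample j hj]⟩

theorem wp_loadProg (h : DataInv d label D c s) (hR : d.sand ≤ d.items) {i : ℕ}
    (hi : s.nvar nMachine = i) :
    Wp A samples loadProg s fun s' k => k ≤ 40 * d.items + 40 * d.sand + 60 ∧
      s'.rvar rMax = max (s.rvar rMax) (d.load i) ∧ s'.nvar nShare = d.share i := by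
  simp only [loadProg, wp_seq, wp_rset]
  have hd0 : DataInv d label D c (s.rset rLoad ((RExp.lit 0).eval s)) :=
    h.of_frame (Exec.rset (A := A) (samples := samples) s rLoad (.lit 0)).frame rfl
  refine (wp_forLoop d.items 20 (fun x s' => s'.rvar rLoad =
    ∑ e ∈ Finset.range x with d.machine e = i, d.size e) ?_ ?_ ?_ ?_).mono ?_
  · rfl
  · intro s' hf
    exact (hd0.of_frame hf rfl).items
  · simp
  · rintro x hx s' hf hxi hI
    have hd := hd0.of_frame hf rfl
    have e1 : s'.nvar nMachine = i := (hf.nvar nMachine rfl).trans (by simpa using hi)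
    have e2 := hd.machine x hx
    have e3 := hd.size x hx
    rw [Finset.range_add_one, Finset.filter_insert]
    simp only [wp_branch, wp_rset, wp_skip]
    constructor
    · intro hb
      have hb : d.machine x = i := by
        have : d.machine x ≤ i ∧ i ≤ d.machine x := by simpa [hxi, e1, e2] using hb
        omega
      rw [if_pos hb, Finset.sum_insert (by simp)]
      refine ⟨by simp, ?_⟩
      simp [hI, hxi, e3, add_comm]
    · intro hb
      have hb : ¬ d.machine x = i := by
        intro hn
        exact hb (by simp [hxi, e1, e2, hn])
      rw [if_neg hb]
      exact ⟨by simp, by simpa using hI⟩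
  · rintro s₁ k₁ hf₁ ⟨hk₁, -, hl₁⟩
    have hd₁ := hd0.of_frame hf₁ rfl
    have e1 : s₁.nvar nMachine = i := (hf₁.nvar nMachine rfl).trans (by simpa using hi)
    have e2 : s₁.rvar rMax = s.rvar rMax := (hf₁.rvar rMax rfl).trans (by simp)
    change _ = d.load i at hl₁
    have hcount : ∀ s₂, DataInv d label D c s₂ → s₂.nvar nMachine = i →
        Wp A samples (countLoop nIndex nShare
          (.neq (.entry aMachine (.var nIndex)) (.var nMachine)) (.var nSand)) s₂
          fun s' k => k ≤ d.sand * 30 + 10 ∧ s'.nvar nShare = d.share i := by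
      intro s₂ hd₂ hi₂
      refine (wp_countLoop (by norm_num) d.sand (fun e => d.machine e = i) ?_ ?_).mono ?_
      · exact fun s' hf => (hd₂.of_frame hf rfl).sand
      · intro s' hf hlt
        have e3 := (hd₂.of_frame hf rfl).machine _ (hlt.trans_le hR)
        have e4 : s'.nvar nMachine = i := (hf.nvar nMachine rfl).trans hi₂
        simp [e3, e4, le_antisymm_iff]
      · rintro s' k hf ⟨hk, hq⟩
        refine ⟨?_, hq⟩
        simp at hk
        omega
    simp only [wp_branch, wp_skip, wp_rset]
    constructor
    · intro hb
      have hb : d.load i ≤ s.rvar rMax := by simpa [hl₁, e2] using hb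
      refine (hcount s₁ hd₁ e1).mono ?_
      rintro s' k hf ⟨hk, hq⟩
      refine ⟨?_, ?_, hq⟩
      · simp at hk₁ ⊢
        omega
      · rw [hf.rvar rMax rfl, e2, max_eq_left hb]
    · intro hb
      have hb : ¬ d.load i ≤ s.rvar rMax := by simpa [hl₁, e2] using hb
      refine (hcount _ (hd₁.of_frame (Exec.rset (A := A) (samples := samples) s₁ rMax
        (.var rLoad)).frame rfl) (by simpa using e1)).mono ?_
      rintro s' k hf ⟨hk, hq⟩
      refine ⟨?_, ?_, hq⟩
      · simp at hk₁ ⊢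
        omega
      · rw [hf.rvar rMax rfl, max_eq_right (by linarith)]
        simpa using hl₁

/-- The conditions under which the cells are computed correctly. -/
structure SketchData.Regular (d : SketchData I) (F : ℕ) : Prop where
  total_pos : 0 < d.total
  beta_pos : 0 < d.β
  beta_lt_one : d.β < 1
  sand_le : d.sand ≤ d.items
  ent_lt : ∀ j ∈ d.knownSet, d.ent j < d.items
  /-- The number of binary digits that the computation of the cells needs. -/
  digits : ∀ k < d.length, d.total / ((1 - d.β) * d.bound k) < 2 ^ F

theorem SketchData.Regular.bound_pos {F : ℕ} (hd : d.Regular F) (k : ℕ) : 0 < d.bound k :=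
  mul_pos hd.total_pos (pow_pos (sub_pos.2 hd.beta_lt_one) k)

theorem SketchData.Regular.bound_anti {F : ℕ} (hd : d.Regular F) {k l : ℕ} (h : k ≤ l) :
    d.bound l ≤ d.bound k :=
  mul_le_mul_of_nonneg_left (pow_le_pow_of_le_one (by linarith [hd.beta_lt_one])
    (by linarith [hd.beta_pos]) h) hd.total_pos.le

theorem SketchData.Regular.quot_nonneg {F : ℕ} (hd : d.Regular F) (i k : ℕ) :
    0 ≤ d.quot i k := by
  have h1 := hd.bound_pos k
  have h2 := hd.total_pos
  have h3 := sub_pos.2 hd.beta_lt_one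
  rw [SketchData.quot]
  positivity

theorem SketchData.Regular.size_quot_le {F : ℕ} (hd : d.Regular F) (i : ℕ) {k : ℕ}
    (hk : k < d.length) : Nat.size ⌊d.quot i k⌋₊ ≤ F := by
  have h1 := hd.bound_pos k
  have h2 := hd.total_pos
  have h3 := sub_pos.2 hd.beta_lt_one
  rw [Nat.size_le, Nat.floor_lt (hd.quot_nonneg i k)]
  push_cast
  refine lt_of_le_of_lt ?_ (hd.digits k hk)
  rw [SketchData.quot, mul_div_assoc]
  refine mul_le_of_le_one_left (by positivity) (mul_le_one₀ ?_ (by positivity) ?_)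
  · refine div_le_one_of_le₀ (Nat.cast_le.2 ?_) (Nat.cast_nonneg _)
    exact (Finset.card_filter_le _ _).trans (Finset.card_range _).le
  · refine div_le_one_of_le₀ (Nat.cast_le.2 ?_) (Nat.cast_nonneg _)
    exact (Finset.card_filter_le _ _).trans (Finset.card_range _).le

theorem wp_cellProg (h : DataInv d label D c s) {F : ℕ} (hd : d.Regular F) {i k₀ : ℕ}
    (hi : s.nvar nMachine = i) (hs : s.nvar nShare = d.share i) (hk₀ : s.nvar nColumn = k₀)
    (hlt : k₀ < d.length) :
    Wp A samples cellProg s fun s' k => k ≤ 60 * c + 60 * d.second + 60 * F + 200 ∧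
      s'.nvar nCell = d.cell i k₀ := by
  simp only [cellProg, wp_branch, wp_seq]
  constructor
  · intro hb
    have hb : k₀ < d.known := by
      simp [hk₀, h.known] at hb
      omega
    refine (wp_countLoop (by norm_num) c (fun x => (d.bound (k₀ + 1) < I.p (D x) ∧
      I.p (D x) ≤ d.bound k₀) ∧ d.machine (d.ent (D x)) = i) ?_ ?_).mono ?_
    · exact fun s' hf => (h.of_frame hf rfl).list.card
    · intro s' hf hx
      have h' := h.of_frame hf rfl
      have e1 : s'.nvar nMachine = i := (hf.nvar nMachine rfl).trans hi
      have e2 : s'.nvar nColumn = k₀ := (hf.nvar nColumn rfl).trans hk₀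
      have e3 := h'.list.size _ hx
      have e4 := h'.list.label _ hx
      have e5 := h'.grid k₀ hlt.le
      have e6 := h'.grid (k₀ + 1) hlt
      simp only [inColumn, Test.Holds, Test.neq, Test.rlt, RExp.eval, NExp.eval, e1, e2, e3, e4,
        e5, e6, h'.ent, not_le]
      refine and_congr_right fun hin => ?_
      have hkn : D (s'.nvar nIndex) ∈ d.knownSet := by
        refine Finset.mem_filter.2 ⟨h.image ▸ Finset.mem_image_of_mem D (Finset.mem_range.2 hx), ?_⟩
        exact (hd.bound_anti (show k₀ + 1 ≤ d.known by omega)).trans_lt hin.1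
      rw [h'.machine _ (hd.ent_lt _ hkn), le_antisymm_iff]
    · rintro s' k hf ⟨hk, hq⟩
      refine ⟨?_, ?_⟩
      · simp [inColumn] at hk ⊢
        omega
      · rw [hq, SketchData.cell, if_pos hb, ← h.image, Finset.filter_image,
          Finset.card_image_of_injOn (h.list.inj.mono fun x hx => by
            have := Finset.mem_filter.1 (Finset.mem_coe.1 hx)
            exact Finset.mem_coe.2 this.1)]
  · intro hb
    have hb : ¬ k₀ < d.known := by
      simp [hk₀, h.known] at hb
      omega
    refine (wp_countLoop (by norm_num) d.second (fun x => d.bound (k₀ + 1) < d.sample x ∧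
      d.sample x ≤ d.bound k₀) ?_ ?_).mono ?_
    · exact fun s' hf => (h.of_frame hf rfl).second
    · intro s' hf hx
      have h' := h.of_frame hf rfl
      have e2 : s'.nvar nColumn = k₀ := (hf.nvar nColumn rfl).trans hk₀
      have e3 := h'.sample _ hx
      have e5 := h'.grid k₀ hlt.le
      have e6 := h'.grid (k₀ + 1) hlt
      simp only [inColumn, Test.Holds, Test.rlt, RExp.eval, NExp.eval, e2, e3, e5, e6, not_le]
    · rintro s₁ k₁ hf₁ ⟨hk₁, hq₁⟩
      have h₁ := h.of_frame hf₁ rfl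
      have e1 : s₁.nvar nShare = d.share i := (hf₁.nvar nShare rfl).trans hs
      have e2 : s₁.nvar nColumn = k₀ := (hf₁.nvar nColumn rfl).trans hk₀
      change _ = d.sampleCount k₀ at hq₁
      rw [wp_rset]
      have e3 : ∀ e, e = RExp.eval s₁ (.div (.mul (.mul (.div (.nat nShare) (.nat nSand))
          (.div (.nat nCell) (.nat nSecond))) (.var rTotal))
          (.mul (.sub (.lit 1) (.var rBeta)) (.entry aGrid (.var nColumn)))) →
          e = d.quot i k₀ := by
        rintro e rfl
        simp [e1, e2, hq₁, h₁.sand, h₁.second, h₁.total, h₁.beta, h₁.grid k₀ hlt.le,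
          SketchData.quot]
      generalize hE : RExp.eval s₁ (.div (.mul (.mul (.div (.nat nShare) (.nat nSand))
          (.div (.nat nCell) (.nat nSecond))) (.var rTotal))
          (.mul (.sub (.lit 1) (.var rBeta)) (.entry aGrid (.var nColumn)))) = E
      obtain rfl := e3 E hE.symm
      refine (wp_floorProg (by simpa using hd.quot_nonneg i k₀)).mono ?_
      rintro s₂ k₂ hf₂ ⟨hk₂, hq₂⟩
      rw [wp_incr]
      have hsz := hd.size_quot_le i hlt
      simp at hk₂ hq₂
      refine ⟨?_, ?_⟩
      · simp [inColumn] at hk₁ ⊢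
        omega
      · simp [hq₂, SketchData.cell, hb]

end

section

variable {I : JobInstance} {d : SketchData I} {label : Fin I.n → ℕ} {D : ℕ → Fin I.n} {c : ℕ}
  {m : ℕ} {A : BlackBox m} {samples : ℕ → ℕ × ℝ} {s : MachineState}

theorem wp_rowProg (h : DataInv d label D c s) {F : ℕ} (hd : d.Regular F) {i : ℕ}
    (hi : s.nvar nMachine = i) (hs : s.nvar nShare = d.share i)
    (hrow : s.nvar nRow = i * d.length)
    (hc : ∀ x < i * d.length, s.narr aCount x = d.cell (x / d.length) (x % d.length)) :
    Wp A samples rowProg s fun s' k =>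
      k ≤ d.length * (60 * c + 60 * d.second + 60 * F + 230) + 30 ∧
      s'.nvar nRow = (i + 1) * d.length ∧
      ∀ x < (i + 1) * d.length, s'.narr aCount x = d.cell (x / d.length) (x % d.length) := by
  simp only [rowProg, wp_seq]
  refine (wp_forLoop d.length (60 * c + 60 * d.second + 60 * F + 210) (fun k s' =>
    ∀ x < i * d.length + k, s'.narr aCount x = d.cell (x / d.length) (x % d.length))
    ?_ ?_ ?_ ?_).mono ?_
  · rfl
  · exact fun s' hf => (h.of_frame hf rfl).length
  · simpa using hc
  · rintro k hk s' hf hxk hI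
    have h' := h.of_frame hf rfl
    rw [wp_seq]
    refine (wp_cellProg h' hd ((hf.nvar nMachine rfl).trans hi) ((hf.nvar nShare rfl).trans hs)
      hxk hk).mono ?_
    rintro s₁ k₁ hf₁ ⟨hk₁, hq⟩
    have e1 : s₁.nvar nRow = i * d.length :=
      (hf₁.nvar nRow rfl).trans ((hf.nvar nRow rfl).trans hrow)
    have e2 : s₁.nvar nColumn = k := (hf₁.nvar nColumn rfl).trans hxk
    have e3 : s₁.narr aCount = s'.narr aCount := hf₁.narr aCount rfl
    rw [wp_nstore]
    refine ⟨by simp; omega, fun x hx => ?_⟩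
    simp [e1, e2, e3, hq]
    rcases (show x < i * d.length + k ∨ x = i * d.length + k by omega) with hx | rfl
    · rw [Function.update_of_ne (by omega), hI x hx]
    · rw [Function.update_self, mul_comm i, Nat.mul_add_div (by omega), Nat.mul_add_mod,
        Nat.div_eq_of_lt hk, Nat.mod_eq_of_lt hk, add_zero]
  · rintro s₁ k₁ hf₁ ⟨hk₁, -, hI₁⟩
    have h₁ := h.of_frame hf₁ rfl
    have e1 : s₁.nvar nRow = i * d.length := (hf₁.nvar nRow rfl).trans hrow
    rw [wp_nset]
    refine ⟨?_, ?_, ?_⟩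
    · simp at hk₁ ⊢
      rw [show 60 * c + 60 * d.second + 60 * F + 210 + 1 + 7 =
        60 * c + 60 * d.second + 60 * F + 218 by ring] at hk₁
      nlinarith
    · simp [e1, h₁.length]
      ring
    · intro x hx
      rw [add_mul, one_mul] at hx
      simpa using hI₁ x hx

theorem wp_machineLoop (h : DataInv d label D c s) {F : ℕ} (hd : d.Regular F)
    (hm : s.nvar nMachines = m) (hrow : s.nvar nRow = 0) (hmax : s.rvar rMax = 0) :
    Wp A samples (forLoop nMachine (.var nMachines) (loadProg ;; rowProg)) s fun s' k =>
      k ≤ m * (80 * d.items + d.length * (60 * c + 60 * d.second + 60 * F + 230) + 100) + 10 ∧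
      (∀ i < m, d.load i ≤ s'.rvar rMax) ∧
      (s'.rvar rMax = 0 ∨ ∃ i < m, s'.rvar rMax = d.load i) ∧
      ∀ i < m, ∀ k < d.length, s'.narr aCount (i * d.length + k) = d.cell i k := by
  refine (wp_forLoop m (80 * d.items + d.length * (60 * c + 60 * d.second + 60 * F + 230) + 90)
    (fun i s' => s'.nvar nRow = i * d.length ∧
      (∀ x < i * d.length, s'.narr aCount x = d.cell (x / d.length) (x % d.length)) ∧
      (∀ l < i, d.load l ≤ s'.rvar rMax) ∧ (s'.rvar rMax = 0 ∨ ∃ l < i, s'.rvar rMax = d.load l))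
    ?_ ?_ ?_ ?_).mono ?_
  · rfl
  · exact fun s' hf => (hf.nvar nMachines rfl).trans hm
  · simp [hrow, hmax]
  · rintro i hi s' hf hxi ⟨h1, h2, h3, h4⟩
    have h' := h.of_frame hf rfl
    rw [wp_seq]
    refine (wp_loadProg h' hd.sand_le hxi).mono ?_
    rintro s₁ k₁ hf₁ ⟨hk₁, hmax₁, hs₁⟩
    have h₁ := h'.of_frame hf₁ rfl
    refine (wp_rowProg h₁ hd ((hf₁.nvar nMachine rfl).trans hxi) hs₁
      ((hf₁.nvar nRow rfl).trans h1) (fun x hx => by rw [hf₁.narr aCount rfl, h2 x hx])).mono ?_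
    rintro s₂ k₂ hf₂ ⟨hk₂, hr₂, hc₂⟩
    have e1 : s₂.rvar rMax = max (s'.rvar rMax) (d.load i) := (hf₂.rvar rMax rfl).trans hmax₁
    have hle := hd.sand_le
    refine ⟨by omega, by simpa using hr₂, by simpa using hc₂, fun l hl => ?_, ?_⟩
    · rw [MachineState.nset_rvar, e1]
      rcases (show l < i ∨ l = i by omega) with hl | rfl
      · exact (h3 l hl).trans (le_max_left _ _)
      · exact le_max_right _ _
    · rw [MachineState.nset_rvar, e1]
      rcases max_choice (s'.rvar rMax) (d.load i) with he | he
      · rw [he]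
        exact h4.imp_right fun ⟨l, hl, hle⟩ => ⟨l, by omega, hle⟩
      · exact Or.inr ⟨i, by omega, he⟩
  · rintro s' k hf ⟨hk, -, -, h2, h3, h4⟩
    refine ⟨?_, h3, h4, fun i hi k hk => ?_⟩
    · simp at hk ⊢
      rw [show 80 * d.items + d.length * (60 * c + 60 * d.second + 60 * F + 230) + 90 + 1 + 7 =
        80 * d.items + d.length * (60 * c + 60 * d.second + 60 * F + 230) + 98 by ring] at hk
      nlinarith
    · have hx : i * d.length + k < m * d.length := by
        have : (i + 1) * d.length ≤ m * d.length := Nat.mul_le_mul_right _ hi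
        rw [add_mul, one_mul] at this
        omega
      rw [h2 _ hx, mul_comm i, Nat.mul_add_div (by omega), Nat.mul_add_mod,
        Nat.div_eq_of_lt hk, Nat.mod_eq_of_lt hk, add_zero]

end

/-- The data that the algorithm computes, for a first stage of length `τ`. -/
structure SketchData.Computed {I : JobInstance} (d : SketchData I) {m : ℕ} (A : BlackBox m)
    (ε β γ : ℝ) (ω : ℕ → Fin I.n) (τ : ℕ) : Prop where
  total : d.total = I.totalEstimate β ω τ
  beta : d.β = β
  known : d.known = knownLength β
  length : d.length = I.sketchLength β ω τ
  seen : d.seen = I.seen ω τ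
  second : d.second = I.secondCount β γ ω τ
  sample : ∀ j < d.second, d.sample j = I.p (ω (τ + j))
  sand : d.sand = ⌈(d.total + β ^ 2 * d.total - ∑ j ∈ d.knownSet, I.p j) / (β * d.total)⌉₊
  packing : Packing I.p (β * d.total) d.knownSet d.sand d.items d.size d.ent
  machine : ∀ e (h : e < d.items),
    d.machine e = A.schedule d.items (fun i => d.size i) (ε / 600) ⟨e, h⟩

/-- The final memory of the algorithm. -/
structure SketchData.Output {I : JobInstance} (d : SketchData I) (m : ℕ) (s : MachineState) :
    Prop where
  length : s.nvar 0 = d.length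
  top : s.rvar 1 = d.total
  width : s.rvar 2 = d.β
  cells : ∀ i < m, ∀ k < d.length, s.narr 0 (i * d.length + k) = d.cell i k
  value : ∃ M, s.value = M + d.β ^ 2 * d.total ∧ (∀ i < m, d.load i ≤ M) ∧
    (M = 0 ∨ ∃ i < m, M = d.load i)

theorem sum_le_totalEstimate {I : JobInstance} {β γ : ℝ} {ω : ℕ → Fin I.n} {τ : ℕ}
    (hst : I.FirstStage β γ ω τ) (J : Finset (Fin I.n)) :
    ∑ j ∈ J, I.p j ≤ I.totalEstimate β ω τ :=
  (Finset.sum_le_univ_sum_of_nonneg fun j => (I.p_pos j).le).trans hst.total_le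

theorem wp_sketchProg {I : JobInstance} {label : Fin I.n → ℕ} (hl : Function.Injective label)
    {m : ℕ} {A : BlackBox m} {ε β γ : ℝ} (hm : 1 ≤ m) (hε : 0 < ε) (hε1 : ε < 1) (hγ : 0 < γ)
    (hγ1 : γ < 1) (hβ : β = ε / (100 * m)) {ω : ℕ → Fin I.n} {τ : ℕ}
    (hst : I.FirstStage β γ ω τ) {F : ℕ}
    (hF : 1 < (1 - β) ^ I.sketchLength β ω τ * 2 ^ F) :
    Wp A (fun i => (label (ω i), I.p (ω i))) sketchProg (inputState m ε γ) fun s' k =>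
      ∃ d : SketchData I, d.Computed A ε β γ ω τ ∧ d.Output m s' ∧
        k ≤ 20 * firstConfidence β γ + 300 * τ + 40 * knownLength β +
          60 * d.length * (τ + 1) + 20 * secondConfidence γ d.length τ + 20 * d.second +
          31 * d.items +
          m * (80 * d.items + d.length * (60 * τ + 60 * d.second + 60 * F + 230) + 100) +
          A.steps d.items (fun i => d.size i) (ε / 600) + 1000 := by
  have hm' : (1 : ℝ) ≤ m := by exact_mod_cast hm
  have hβ0 : 0 < β := by rw [hβ]; positivity
  have hβ1 : β ≤ 1 / 100 := by
    rw [hβ, div_le_div_iff₀ (by positivity) (by norm_num)]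
    linarith
  have hP : 0 < I.totalEstimate β ω τ := I.total_pos.trans_le hst.total_le
  set P := I.totalEstimate β ω τ with hPdef
  set t := I.sketchLength β ω τ with ht
  set κ := knownLength β with hκ
  simp only [sketchProg, wp_seq]
  refine (wp_setupProg hm hε hγ hβ).mono ?_
  rintro s₁ k₁ hf₁ ⟨hk₁, hb₁, hg₁⟩
  have hτ0 : 0 < τ := by
    have h1 : (0 : ℝ) < I.hits ω τ := by
      have h2 := JobInstance.firstConfidence_pos hβ0 hβ1 hγ hγ1
      have h3 := JobInstance.repetitionGoal_ge (γ := γ) hβ0 hβ1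
      have h4 : (1 : ℝ) ≤ firstConfidence β γ := by exact_mod_cast h2
      linarith [hst.reached]
    have h2 := JobInstance.hits_le ω τ
    have h3 : 0 < I.hits ω τ := by exact_mod_cast h1
    omega
  -- the first stage
  have hinit : FirstInv I label ω (fun _ => ⟨0, I.n_pos⟩) 0 s₁ := by
    have e3 : s₁.nvar nSeen = 0 := hf₁.nvar nSeen rfl
    refine ⟨hf₁.drawn rfl, hf₁.nvar nSamples rfl, hf₁.nvar nHits rfl, ?_, ?_, by simp, ?_,
      by simp [e3], by simp [e3, JobInstance.seen], by simp [e3], by simp [e3]⟩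
    · rw [hf₁.rvar rSeen rfl]
      simp [inputState, JobInstance.seen]
    · rw [hf₁.rvar rSum rfl]
      simp [inputState, JobInstance.weightSum]
    · intro j
      rw [hf₁.narr aMark rfl]
      simp [inputState, JobInstance.seen]
  refine (wp_firstProg hl (by rw [hg₁]; exact hst.reached) (by rw [hg₁]; exact hst.before)
    ⟨_, hinit⟩).mono ?_
  rintro s₂ k₂ hf₂ ⟨hk₂, D, hI₂⟩
  have hb₂ : s₂.rvar rBeta = β := (hf₂.rvar rBeta rfl).trans hb₁
  set c := s₂.nvar nSeen with hc
  have hcτ : c ≤ τ := by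
    have h1 := Finset.card_image_of_injOn hI₂.inj
    rw [hI₂.image, Finset.card_range] at h1
    rw [hc, ← h1]
    exact Finset.card_image_le.trans (Finset.card_range _).le
  have hlist₂ : SeenList I label D c s₂ := ⟨rfl, hI₂.inj, hI₂.size, hI₂.label⟩
  -- the grid
  refine (wp_gridProg hβ0 hb₂ (P := P) (by rw [hI₂.sum, hI₂.hits]; rfl) hP
    ((hf₂.nvar nLength rfl).trans (hf₁.nvar nLength rfl))).mono ?_
  rintro s₃ k₃ hf₃ ⟨hk₃, hT₃, hκ₃, hG₃⟩
  have hb₃ : s₃.rvar rBeta = β := (hf₃.rvar rBeta rfl).trans hb₂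
  have hfirst : ∀ j < τ, s₃.rarr aFirst j = I.p (ω j) := fun j hj => by
    rw [hf₃.rarr aFirst rfl, hI₂.first j hj]
  have hset : ∀ b : ℝ, ((Finset.range τ).filter fun j => s₃.rarr aFirst j ≤ b) =
      (Finset.range τ).filter fun j => I.p (ω j) ≤ b := fun b =>
    Finset.filter_congr fun j hj => by rw [hfirst j (Finset.mem_range.1 hj)]
  have hτ₃ : s₃.nvar nSamples = τ := (hf₃.nvar nSamples rfl).trans hI₂.samples
  refine (wp_lengthProg hG₃ hb₃ (by linarith) hτ₃ hτ0 hst.length_gt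
    (by rw [hset]; exact hst.length_count) (fun k hk hkt => ?_)).mono ?_
  · rw [hset]
    by_contra! hcon
    exact Nat.notMem_of_lt_sInf hkt ⟨hk, hcon⟩
  rintro s₄ k₄ hf₄ ⟨hk₄, hG₄⟩
  -- the second stage
  refine (wp_secondProg (d := τ) (t := t) (τ := τ) hγ ((hf₄.rvar rBeta rfl).trans hb₃)
    ((hf₄.rvar rGamma rfl).trans ((hf₃.rvar rGamma rfl).trans ((hf₂.rvar rGamma rfl).trans
      (hf₁.rvar rGamma rfl)))) hG₄.length ((hf₄.nvar nSamples rfl).trans hτ₃)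
    ((hf₄.drawn rfl).trans ((hf₃.drawn rfl).trans hI₂.drawn))
    ((hf₄.nvar nSecond rfl).trans ((hf₃.nvar nSecond rfl).trans ((hf₂.nvar nSecond rfl).trans
      (hf₁.nvar nSecond rfl))))).mono ?_
  rintro s₅ k₅ hf₅ ⟨hk₅, hn₅, hs₅⟩
  set n₂ := ⌈(t : ℝ) * secondConfidence γ t τ / β ^ 2⌉₊ with hn₂
  -- the items
  have hb₅ : s₅.rvar rBeta = β := (hf₅.rvar rBeta rfl).trans ((hf₄.rvar rBeta rfl).trans hb₃)
  have hT₅ : s₅.rvar rTotal = P := (hf₅.rvar rTotal rfl).trans ((hf₄.rvar rTotal rfl).trans hT₃)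
  have hκ₅ : s₅.nvar nKnown = κ := (hf₅.nvar nKnown rfl).trans ((hf₄.nvar nKnown rfl).trans hκ₃)
  have hgr₅ : ∀ k ≤ t, s₅.rarr aGrid k = P * (1 - β) ^ k := fun k hk => by
    rw [hf₅.rarr aGrid rfl, hG₄.grid k hk]
  have hlist₅ : SeenList I label D c s₅ := ((hlist₂.of_frame (hf₃.nvar _ rfl) (hf₃.rarr _ rfl)
    (hf₃.narr _ rfl)).of_frame (hf₄.nvar _ rfl) (hf₄.rarr _ rfl) (hf₄.narr _ rfl)).of_frame
    (hf₅.nvar _ rfl) (hf₅.rarr _ rfl) (hf₅.narr _ rfl)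
  have hκt : κ < t := hst.length_gt
  set b := P * (1 - β) ^ κ with hb
  have hJ : knownJobs I D b c = (I.seen ω τ).filter fun j => b < I.p j := by
    rw [knownJobs, hI₂.image]
  set R := ⌈(P + β ^ 2 * P - ∑ j ∈ knownJobs I D b c, I.p j) / (β * P)⌉₊ with hR
  refine (wp_sandProg hP hβ0 hlist₅ hb₅ hT₅ (by rw [hκ₅, hgr₅ κ hκt.le])
    ((hf₅.nvar nSand rfl).trans ((hf₄.nvar nSand rfl).trans ((hf₃.nvar nSand rfl).trans
      ((hf₂.nvar nSand rfl).trans (hf₁.nvar nSand rfl)))))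
    (fun e => by
      rw [hf₅.rarr aItem rfl, hf₄.rarr aItem rfl, hf₃.rarr aItem rfl, hf₂.rarr aItem rfl,
        hf₁.rarr aItem rfl]
      rfl) hR).mono ?_
  rintro s₆ k₆ hf₆ ⟨hk₆, hR₆, hθ₆, hq₆, hq₆'⟩
  have hR0 : 0 < R := by
    rw [hR, Nat.ceil_pos]
    have := sum_le_totalEstimate hst (knownJobs I D b c)
    have h2 : 0 < β ^ 2 * P := by positivity
    exact div_pos (by linarith) (by positivity)
  have hlist₆ := hlist₅.of_frame (hf₆.nvar _ rfl) (hf₆.rarr _ rfl) (hf₆.narr _ rfl)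
  refine (wp_bundleProg hl hlist₆ (b := b)
    (by rw [hf₆.nvar nKnown rfl, hf₆.rarr aGrid rfl, hκ₅, hgr₅ κ hκt.le]) hθ₆ (by positivity)
    hR₆ hR0 hq₆ hq₆' ((hf₆.nvar nOpen rfl).trans ((hf₅.nvar nOpen rfl).trans
      ((hf₄.nvar nOpen rfl).trans ((hf₃.nvar nOpen rfl).trans ((hf₂.nvar nOpen rfl).trans
      (hf₁.nvar nOpen rfl))))))).mono ?_
  rintro s₇ k₇ hf₇ ⟨hk₇, hpack⟩
  -- the schedule of the items
  have hε₇ : s₇.rvar rEps = ε := (hf₇.rvar rEps rfl).trans ((hf₆.rvar rEps rfl).trans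
    ((hf₅.rvar rEps rfl).trans ((hf₄.rvar rEps rfl).trans ((hf₃.rvar rEps rfl).trans
    ((hf₂.rvar rEps rfl).trans (hf₁.rvar rEps rfl))))))
  set N := s₇.nvar nItems with hN
  obtain ⟨d, hd⟩ : ∃ d : SketchData I, d = {
    total := P, β := β, known := κ, length := t, seen := I.seen ω τ, sand := R, items := N,
    size := s₇.rarr aItem, ent := fun j => s₇.narr aEntry (label j),
    machine := fun e => if h : e < N then
      A.schedule N (fun i => s₇.rarr aItem i) (ε / 600) ⟨e, h⟩ else 0,
    second := n₂, sample := s₅.rarr aSecond } := ⟨_, rfl⟩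
  have hJd : d.knownSet = knownJobs I D b c := by rw [hJ, hd]; rfl
  have hcomp : d.Computed A ε β γ ω τ := by
    refine ⟨by rw [hd], by rw [hd], by rw [hd], by rw [hd], by rw [hd], by rw [hd]; rfl,
      ?_, ?_, ?_, ?_⟩
    · rw [hd]
      exact hs₅
    · rw [hJd, hd]
    · rw [hJd, hd]
      exact hpack
    · subst hd
      exact fun e he => dif_pos he
  have hreg : d.Regular F := by
    refine ⟨by rw [hd]; exact hP, by rw [hd]; exact hβ0, by rw [hd]; exact (by linarith : β < 1),
      by rw [hd]; exact hpack.le, ?_, ?_⟩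
    · intro j hj
      rw [hJd] at hj
      rw [hd]
      exact (hpack.mem j hj).2
    · intro k hk
      rw [hd] at hk ⊢
      change P / ((1 - β) * (P * (1 - β) ^ k)) < 2 ^ F
      have h1β : 0 < 1 - β := by linarith
      rw [div_lt_iff₀ (by positivity)]
      have h1 : (1 - β) ^ t ≤ (1 - β) ^ (k + 1) :=
        pow_le_pow_of_le_one h1β.le (by linarith) hk
      have h2 : 1 < (1 - β) ^ (k + 1) * 2 ^ F :=
        hF.trans_le (mul_le_mul_of_nonneg_right h1 (by positivity))
      calc P = P * 1 := (mul_one P).symm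
        _ < P * ((1 - β) ^ (k + 1) * 2 ^ F) := mul_lt_mul_of_pos_left h2 hP
        _ = _ := by ring
  simp only [scheduleProg, wp_seq]
  refine ⟨_, _, Exec.call s₇ aItem (.var nItems) (.div (.var rEps) (.lit 600)) aMachine, ?_⟩
  have hα : (RExp.div (.var rEps) (.lit 600)).eval s₇ = ε / 600 := by simp [hε₇]
  rw [hα]
  change Wp A _ _ (s₇.nfill aMachine N
    (fun i => (A.schedule N (s₇.rprefix aItem N) (ε / 600) i : ℕ))) _
  set s₈ := s₇.nfill aMachine N
    (fun i => (A.schedule N (s₇.rprefix aItem N) (ε / 600) i : ℕ)) with hs₈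
  have hinv : DataInv d label D c s₈ := by
    rw [hd]
    refine ⟨(hlist₆.of_frame (hf₇.nvar _ rfl) (hf₇.rarr _ rfl) (hf₇.narr _ rfl)).of_frame rfl rfl
      rfl, hI₂.image, ?_, ?_, ?_, ?_, ?_, ?_, rfl, fun _ _ => rfl, fun _ => rfl, ?_, ?_, ?_⟩
    · exact (hf₇.rvar rTotal rfl).trans ((hf₆.rvar rTotal rfl).trans hT₅)
    · exact (hf₇.rvar rBeta rfl).trans ((hf₆.rvar rBeta rfl).trans hb₅)
    · exact (hf₇.nvar nKnown rfl).trans ((hf₆.nvar nKnown rfl).trans hκ₅)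
    · exact (hf₇.nvar nLength rfl).trans ((hf₆.nvar nLength rfl).trans
        ((hf₅.nvar nLength rfl).trans hG₄.length))
    · intro k hk
      change s₇.rarr aGrid k = _
      rw [hf₇.rarr aGrid rfl, hf₆.rarr aGrid rfl, hgr₅ k hk]
      rfl
    · exact (hf₇.nvar nSand rfl).trans hR₆
    · intro e he
      have he : e < N := he
      rw [hs₈]
      simp only [MachineState.nfill, Function.update_self]
      rw [dif_pos he, dif_pos he]
      rfl
    · exact (hf₇.nvar nSecond rfl).trans ((hf₆.nvar nSecond rfl).trans hn₅)
    · intro j _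
      change s₇.rarr aSecond j = _
      rw [hf₇.rarr aSecond rfl, hf₆.rarr aSecond rfl]
  refine (wp_machineLoop hinv hreg ?_ ?_ ?_).mono ?_
  · exact (hf₇.nvar 0 rfl).trans ((hf₆.nvar 0 rfl).trans
      ((hf₅.nvar 0 rfl).trans ((hf₄.nvar 0 rfl).trans ((hf₃.nvar 0 rfl).trans
      ((hf₂.nvar 0 rfl).trans (hf₁.nvar 0 rfl))))))
  · exact (hf₇.nvar nRow rfl).trans ((hf₆.nvar nRow rfl).trans
      ((hf₅.nvar nRow rfl).trans ((hf₄.nvar nRow rfl).trans ((hf₃.nvar nRow rfl).trans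
      ((hf₂.nvar nRow rfl).trans (hf₁.nvar nRow rfl))))))
  · exact (hf₇.rvar rMax rfl).trans ((hf₆.rvar rMax rfl).trans
      ((hf₅.rvar rMax rfl).trans ((hf₄.rvar rMax rfl).trans ((hf₃.rvar rMax rfl).trans
      ((hf₂.rvar rMax rfl).trans (hf₁.rvar rMax rfl))))))
  rintro s₉ k₉ hf₉ ⟨hk₉, hmax₉, hmax₉', hc₉⟩
  have hinv₉ := hinv.of_frame hf₉ rfl
  simp only [outputProg, wp_seq, wp_rset, wp_nset]
  refine ⟨d, hcomp, ⟨?_, ?_, ?_, ?_, s₉.rvar rMax, ?_, hmax₉, hmax₉'⟩, ?_⟩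
  · simp [hinv₉.length]
  · simp [hinv₉.total]
  · simp [hinv₉.beta]
  · simpa using hc₉
  · simp [MachineState.value, hinv₉.beta, hinv₉.total, sq]
  · have e1 : d.length = t := by rw [hd]
    have e2 : d.second = n₂ := by rw [hd]
    have e3 : d.items = N := by rw [hd]
    have e4 : (fun i : Fin d.items => d.size i) = fun i : Fin d.items => s₇.rarr aItem i := by
      rw [hd]
    have hRN : R ≤ N := hpack.le
    have hmul : d.length * (60 * c + 60 * d.second + 60 * F + 230) ≤
        d.length * (60 * τ + 60 * d.second + 60 * F + 230) :=
      Nat.mul_le_mul_left _ (by omega)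
    have hmul' : m * (80 * d.items + d.length * (60 * c + 60 * d.second + 60 * F + 230) + 100) ≤
        m * (80 * d.items + d.length * (60 * τ + 60 * d.second + 60 * F + 230) + 100) :=
      Nat.mul_le_mul_left _ (by omega)
    have hsteps : A.steps (NExp.eval s₇ (.var nItems)) (s₇.rprefix aItem
        (NExp.eval s₇ (.var nItems))) (ε / 600) =
        A.steps d.items (fun i => d.size i) (ε / 600) := by
      rw [e4, e3]
      rfl
    rw [hsteps]
    rw [← ht, ← e1] at hk₄
    have hk₅' : k₅ ≤ 20 * secondConfidence γ d.length τ + 20 * d.second + 100 := by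
      rw [e2, e1]
      exact hk₅
    have e6 : NExp.eval s₇ (.var nItems) = d.items := e3.symm
    rw [e6]
    simp only [NExp.cost, RExp.cost, RExp.lit]
    rw [← e3] at hRN
    clear_value s₈ N R n₂
    omega

/-! ### Schedules that are generated from a sketch -/

theorem exists_assignment {ι : Type*} [DecidableEq ι] {m : ℕ} (hm : 0 < m) (J : Finset ι)
    (cap : Fin m → ℕ) (h : J.card ≤ ∑ i, cap i) :
    ∃ f : ι → Fin m, ∀ i, (J.filter fun j => f j = i).card ≤ cap i := by
  induction J using Finset.induction_on with
  | empty => exact ⟨fun _ => ⟨0, hm⟩, by simp⟩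
  | insert a J ha ih =>
    rw [Finset.card_insert_of_notMem ha] at h
    obtain ⟨f, hf⟩ := ih (by omega)
    obtain ⟨i₀, hi₀⟩ : ∃ i, (J.filter fun j => f j = i).card < cap i := by
      by_contra! hcon
      have h1 := Finset.sum_le_sum fun i (_ : i ∈ Finset.univ) => hcon i
      rw [← Finset.card_eq_sum_card_fiberwise fun j _ =>
        Finset.mem_coe.2 (Finset.mem_univ (f j))] at h1
      omega
    refine ⟨Function.update f a i₀, fun i => ?_⟩
    have hfil : (J.filter fun j => Function.update f a i₀ j = i) = J.filter fun j => f j = i :=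
      Finset.filter_congr fun j hj => by rw [Function.update_of_ne (by rintro rfl; exact ha hj)]
    rw [Finset.filter_insert, Function.update_self, hfil]
    split_ifs with hi
    · subst hi
      exact (Finset.card_insert_le _ _).trans hi₀
    · exact hf i

namespace SketchSchedule

variable {m : ℕ} (σ : SketchSchedule m)

theorem jobsIn_unique {n : ℕ} {p : Fin n → ℝ} (h0 : 0 < σ.top) (h1 : 0 < σ.δ) (h2 : σ.δ < 1)
    {k l : Fin σ.len} {j : Fin n} (hk : j ∈ σ.jobsIn p k) (hl : j ∈ σ.jobsIn p l) : k = l := by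
  have key : ∀ k l : Fin σ.len, j ∈ σ.jobsIn p k → j ∈ σ.jobsIn p l → ¬ k < l := by
    intro k l hk hl hlt
    simp only [jobsIn, Finset.mem_filter, Finset.mem_univ, true_and] at hk hl
    have h3 : (1 - σ.δ) ^ (l : ℕ) ≤ (1 - σ.δ) ^ ((k : ℕ) + 1) :=
      pow_le_pow_of_le_one (by linarith) (by linarith) hlt
    nlinarith [hk.1, hl.2]
  exact le_antisymm (not_lt.1 (key l k hl hk)) (not_lt.1 (key k l hk hl))

theorem exists_generates {n : ℕ} (hm : 0 < m) (p : Fin n → ℝ) (h0 : 0 < σ.top) (h1 : 0 < σ.δ)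
    (h2 : σ.δ < 1) : ∃ S, σ.Generates p S := by
  classical
  have : Nonempty (Fin m) := ⟨⟨0, hm⟩⟩
  have hmax : ∀ k, ∃ i₀ : Fin m, ∀ i, σ.count i k ≤ σ.count i₀ k := fun k =>
    Finite.exists_max fun i => σ.count i k
  choose i₀ hi₀ using hmax
  have hf : ∀ k, ∃ f : Fin n → Fin m, ∀ i, ((σ.jobsIn p k).filter fun j => f j = i).card ≤
      σ.count i k + if i = i₀ k then (σ.jobsIn p k).card - σ.estimate k else 0 := fun k => by
    refine exists_assignment hm _ _ ?_
    rw [Finset.sum_add_distrib, Finset.sum_ite_eq' Finset.univ (i₀ k), if_pos (Finset.mem_univ _)]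
    change _ ≤ σ.estimate k + _
    omega
  choose f hf using hf
  refine ⟨fun j => if h : ∃ k, j ∈ σ.jobsIn p k then f h.choose j else ⟨0, hm⟩, fun k _ =>
    ⟨i₀ k, hi₀ k, fun i => ?_⟩⟩
  refine le_of_eq_of_le (congrArg _ (Finset.filter_congr fun j hj => ?_)) (hf k i)
  have hex : ∃ k, j ∈ σ.jobsIn p k := ⟨k, hj⟩
  simp only [dif_pos hex, σ.jobsIn_unique h0 h1 h2 hex.choose_spec hj]

/-- The excess of the number of jobs over the estimate is the only source of additional load. -/
theorem Generates.card_le {σ : SketchSchedule m} {n : ℕ} {p : Fin n → ℝ} {S : Fin n → Fin m}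
    (h : σ.Generates p S) (k : Fin σ.len) (i : Fin m) :
    ((σ.jobsIn p k).filter fun j => S j = i).card ≤
      σ.count i k + ((σ.jobsIn p k).card - σ.estimate k) := by
  rcases Nat.eq_zero_or_pos (σ.estimate k) with h0 | h0
  · have := Finset.card_filter_le (σ.jobsIn p k) fun j => S j = i
    omega
  · obtain ⟨i₀, -, hle⟩ := h k h0
    refine (hle i).trans (Nat.add_le_add_left ?_ _)
    split_ifs <;> omega

end SketchSchedule

/-! ### The schedule of the items -/

section

variable {n : ℕ} {p : Fin n → ℝ} {θ : ℝ} {J : Finset (Fin n)} {R N : ℕ} {q : ℕ → ℝ}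
  {ent : Fin n → ℕ}

/-- The total size of the items on a machine, or of any other set of items. -/
theorem Packing.sum_filter (h : Packing p θ J R N q ent) (P : ℕ → Prop) [DecidablePred P] :
    ∑ e ∈ Finset.range N with P e, q e =
      ((Finset.range R).filter P).card * θ + ∑ j ∈ J with P (ent j), p j := by
  have hsplit : (Finset.range N).filter P =
      (Finset.range R).filter P ∪ (Finset.Ico R N).filter P := by
    rw [← Finset.filter_union, Finset.range_eq_Ico, Finset.range_eq_Ico,
      Finset.Ico_union_Ico_eq_Ico (Nat.zero_le _) h.le]
  have hdisj : Disjoint ((Finset.range R).filter P) ((Finset.Ico R N).filter P) := by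
    rw [Finset.disjoint_left]
    intro e he he'
    simp at he he'
    omega
  rw [hsplit, Finset.sum_union hdisj]
  congr 1
  · rw [Finset.sum_congr rfl fun e he => h.sand e (Finset.mem_range.1 (Finset.mem_filter.1 he).1),
      Finset.sum_const, nsmul_eq_mul]
  · have hmaps : ∀ j ∈ J.filter fun j => P (ent j), ent j ∈ (Finset.Ico R N).filter P := by
      intro j hj
      rw [Finset.mem_filter] at hj
      simp [h.mem j hj.1, hj.2]
    rw [← Finset.sum_fiberwise_of_maps_to hmaps]
    refine Finset.sum_congr rfl fun e he => ?_
    simp only [Finset.mem_filter, Finset.mem_Ico] at he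
    rw [h.size e he.1.1 he.1.2, Finset.filter_filter]
    refine Finset.sum_congr (Finset.filter_congr fun j _ => ?_) fun _ _ => rfl
    constructor
    · rintro rfl
      exact ⟨he.2, rfl⟩
    · exact fun hj => hj.2

theorem Packing.sum_size (h : Packing p θ J R N q ent) :
    ∑ e ∈ Finset.range N, q e = R * θ + ∑ j ∈ J, p j := by
  simpa using h.sum_filter fun _ => True

/-- An item that is larger than `2 * θ` is a single job. -/
theorem Packing.exists_job (h : Packing p θ J R N q ent) (hθ : 0 < θ) {e : ℕ} (he : e < N)
    (hq : 2 * θ < q e) : ∃ j ∈ J, ent j = e ∧ q e = p j := by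
  have hR : R ≤ e := by
    by_contra! hlt
    rw [h.sand e hlt] at hq
    linarith
  obtain ⟨j₀, hj₀⟩ : (J.filter fun j => ent j = e).Nonempty := by
    rw [Finset.nonempty_iff_ne_empty]
    intro h0
    have := h.size e hR he
    rw [h0, Finset.sum_empty] at this
    linarith [h.pos e he]
  have hj := Finset.mem_filter.1 hj₀
  refine ⟨j₀, hj.1, hj.2, ?_⟩
  obtain h1 | ⟨j₁, h1⟩ := h.small_or_single e hR he
  · linarith
  · have : (J.filter fun j => ent j = e) = {j₀} := by
      ext l
      rw [Finset.mem_singleton]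
      constructor
      · intro hl
        have hl := Finset.mem_filter.1 hl
        rw [h1 l hl.1 hl.2, h1 j₀ hj.1 hj.2]
      · rintro rfl
        exact hj₀
    rw [h.size e hR he, this, Finset.sum_singleton]

theorem sum_fin_filter (N : ℕ) (q : ℕ → ℝ) (P : ℕ → Prop) [DecidablePred P] :
    ∑ e ∈ (Finset.univ : Finset (Fin N)).filter (fun e : Fin N => P e), q e =
      ∑ e ∈ Finset.range N with P e, q e := by
  rw [Finset.sum_filter, Finset.sum_filter, Finset.sum_range]

/-- Packing the jobs into items hardly increases the optimum: items that are larger than `2 * θ`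
are single jobs and follow an optimal schedule, and list scheduling handles the others. -/
theorem Packing.opt_le (h : Packing p θ J R N q ent) {m : ℕ} (hm : 0 < m) (hθ : 0 < θ)
    (hp : ∀ j, 0 < p j) {η : ℝ} (hη : 0 ≤ η)
    (htot : ∑ e ∈ Finset.range N, q e + m * (2 * θ) ≤ m * (optMakespan m p + η)) :
    optMakespan m (fun e : Fin N => q e) ≤ optMakespan m p + η := by
  classical
  obtain ⟨S, hS⟩ := exists_makespan_eq_opt hm p
  set f : ℕ → Fin m := fun e =>
    if h : ∃ j ∈ J, ent j = e ∧ q e = p j then S h.choose else ⟨0, hm⟩ with hf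
  have hbase : ∀ i, ∑ e ∈ ((Finset.range N).filter fun e => 2 * θ < q e) with f e = i, q e ≤
      optMakespan m p + η := by
    intro i
    have hmaps : ∀ j ∈ J.filter fun j => S j = i, ent j ∈ Finset.range N := fun j hj =>
      Finset.mem_range.2 (h.mem j (Finset.mem_filter.1 hj).1).2
    have h1 : ∑ j ∈ J with S j = i, p j ≤ optMakespan m p := by
      rw [← hS]
      exact (Finset.sum_le_sum_of_subset_of_nonneg
        (Finset.filter_subset_filter _ (Finset.subset_univ J)) fun j _ _ => (hp j).le).trans
        (load_le_makespan p S i)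
    rw [← Finset.sum_fiberwise_of_maps_to hmaps] at h1
    have hnn : ∀ e, 0 ≤ ∑ j ∈ J.filter (fun j => S j = i) with ent j = e, p j := fun e =>
      Finset.sum_nonneg fun j _ => (hp j).le
    refine le_trans ?_ (h1.trans (by linarith))
    refine le_trans (Finset.sum_le_sum fun e he => ?_) (Finset.sum_le_sum_of_subset_of_nonneg
      ((Finset.filter_subset _ _).trans (Finset.filter_subset _ _)) fun e _ _ => hnn e)
    simp only [Finset.mem_filter, Finset.mem_range] at he
    have hex := h.exists_job hθ he.1.1 he.1.2
    have hfe : S hex.choose = i := by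
      rw [← he.2, hf]
      simp only [dif_pos hex]
    obtain ⟨h2, h3, h4⟩ := hex.choose_spec
    rw [h4]
    exact Finset.single_le_sum (f := p) (fun j _ => (hp j).le)
      (Finset.mem_filter.2 ⟨Finset.mem_filter.2 ⟨h2, hfe⟩, h3⟩)
  obtain ⟨g, -, hg⟩ := exists_greedy_extension hm q _ f (2 * θ) _ hbase
    ((Finset.range N).filter fun e => ¬ 2 * θ < q e) (Finset.disjoint_filter_filter_not _ _ _)
    (fun e he => not_lt.1 (Finset.mem_filter.1 he).2)
    (fun e he => (h.pos e (Finset.mem_range.1 (Finset.mem_filter.1 he).1)).le)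
    (by rwa [Finset.filter_union_filter_not_eq])
  rw [Finset.filter_union_filter_not_eq] at hg
  refine (optMakespan_le _ fun e : Fin N => g e).trans (makespan_le hm fun i => ?_)
  rw [sum_fin_filter N q fun e => g e = i]
  exact hg i

end

/-! ### The value of the schedule of the items -/

open JobInstance

theorem sum_card_filter_eq {α : Type*} {m : ℕ} (s : Finset α) (g : α → ℕ) (h : ∀ a ∈ s, g a < m) :
    ∑ i : Fin m, (s.filter fun a => g a = i).card = s.card := by
  rw [Fin.sum_univ_eq_sum_range (fun i => (s.filter fun a => g a = i).card) m]
  exact (Finset.card_eq_sum_card_fiberwise fun a ha => by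
    simpa using h a ha).symm

namespace SketchData

section

variable {I : JobInstance} {d : SketchData I} {m : ℕ} {A : BlackBox m} {ε β γ : ℝ}
  {ω : ℕ → Fin I.n} {τ : ℕ}

/-- The load of machine `i` from known jobs. -/
noncomputable def knownLoad (d : SketchData I) (i : ℕ) : ℝ :=
  ∑ j ∈ d.knownSet with d.machine (d.ent j) = i, I.p j

theorem Computed.bound_eq (hc : d.Computed A ε β γ ω τ) (k : ℕ) :
    d.bound k = d.total * (1 - β) ^ k := by rw [bound, hc.beta]

theorem Computed.total_le (hc : d.Computed A ε β γ ω τ) (hst : I.FirstStage β γ ω τ) :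
    I.total ≤ d.total := hc.total ▸ hst.total_le

theorem Computed.le_total (hc : d.Computed A ε β γ ω τ) (hst : I.FirstStage β γ ω τ) :
    d.total ≤ (1 + 6 * β) * I.total := hc.total ▸ hst.le_total

theorem Computed.total_pos (hc : d.Computed A ε β γ ω τ) (hst : I.FirstStage β γ ω τ) :
    0 < d.total := I.total_pos.trans_le (hc.total_le hst)

theorem Computed.load_eq (hc : d.Computed A ε β γ ω τ) (i : ℕ) :
    d.load i = d.share i * (β * d.total) + d.knownLoad i :=
  hc.packing.sum_filter fun e => d.machine e = i

theorem Computed.machine_lt (hc : d.Computed A ε β γ ω τ) {e : ℕ} (he : e < d.items) :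
    d.machine e < m := by
  rw [hc.machine e he]
  exact Fin.is_lt _

theorem Computed.sum_known_le (hc : d.Computed A ε β γ ω τ) (hst : I.FirstStage β γ ω τ) :
    ∑ j ∈ d.knownSet, I.p j ≤ d.total :=
  (Finset.sum_le_univ_sum_of_nonneg fun j => (I.p_pos j).le).trans (hc.total_le hst)

theorem Computed.sum_share (hc : d.Computed A ε β γ ω τ) :
    ∑ i : Fin m, d.share i = d.sand := by
  simpa [share] using sum_card_filter_eq (m := m) (Finset.range d.sand) d.machine fun e he =>
    hc.machine_lt ((Finset.mem_range.1 he).trans_le hc.packing.le)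

/-- The first intervals only contain jobs that were seen. -/
theorem Computed.half_lt_bound_known (hc : d.Computed A ε β γ ω τ) (hst : I.FirstStage β γ ω τ)
    (hβ : 0 < β) (hβ1 : β ≤ 1 / 100) : β ^ 2 / 2 * I.total ≤ d.bound d.known := by
  have hP := hc.total_pos hst
  have h0 := knownLength_pos hβ hβ1
  have h1 := lt_pow_of_lt_knownLength (β := β) (k := knownLength β - 1) (by omega)
  have h2 : (1 - β) ^ knownLength β = (1 - β) ^ (knownLength β - 1) * (1 - β) := by
    rw [← pow_succ]
    congr 1
    omega
  rw [hc.bound_eq, hc.known, h2]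
  have h3 : β ^ 2 / 2 ≤ (1 - β) ^ (knownLength β - 1) * (1 - β) := by nlinarith [sq_nonneg β]
  calc _ ≤ β ^ 2 / 2 * d.total := mul_le_mul_of_nonneg_left (hc.total_le hst) (by positivity)
    _ ≤ _ := by rw [mul_comm]; exact mul_le_mul_of_nonneg_left h3 hP.le

theorem Computed.mem_knownSet (hc : d.Computed A ε β γ ω τ) (hst : I.FirstStage β γ ω τ)
    (hβ : 0 < β) (hβ1 : β ≤ 1 / 100) (j : Fin I.n) :
    j ∈ d.knownSet ↔ d.bound d.known < I.p j := by
  rw [knownSet, Finset.mem_filter]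
  refine ⟨fun h => h.2, fun h => ⟨?_, h⟩⟩
  rw [hc.seen]
  exact hst.mem_seen j ((hc.half_lt_bound_known hst hβ hβ1).trans h.le)

theorem Computed.bound_known_le (hc : d.Computed A ε β γ ω τ) (hst : I.FirstStage β γ ω τ)
    (hβ : 0 < β) : d.bound d.known ≤ β ^ 2 * d.total := by
  rw [hc.bound_eq, hc.known, mul_comm]
  exact mul_le_mul_of_nonneg_right (knownLength_spec hβ) (hc.total_pos hst).le

theorem Computed.rest_le_sand (hc : d.Computed A ε β γ ω τ) (hst : I.FirstStage β γ ω τ)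
    (hβ : 0 < β) :
    d.total + β ^ 2 * d.total - ∑ j ∈ d.knownSet, I.p j ≤ d.sand * (β * d.total) := by
  have hP := hc.total_pos hst
  rw [hc.sand, ← div_le_iff₀ (by positivity)]
  exact Nat.le_ceil _

theorem Computed.sand_pos (hc : d.Computed A ε β γ ω τ) (hst : I.FirstStage β γ ω τ)
    (hβ : 0 < β) : 0 < d.sand := by
  have hP := hc.total_pos hst
  have h1 := hc.sum_known_le hst
  have h2 : 0 < β ^ 2 * d.total := by positivity
  rw [hc.sand, Nat.ceil_pos]
  exact div_pos (by linarith) (by positivity)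

theorem Computed.sum_size_le (hc : d.Computed A ε β γ ω τ) (hst : I.FirstStage β γ ω τ)
    (hβ : 0 < β) :
    ∑ e ∈ Finset.range d.items, d.size e ≤ d.total + β ^ 2 * d.total + β * d.total := by
  have hP := hc.total_pos hst
  have h1 := hc.sum_known_le hst
  have h2 : 0 < β ^ 2 * d.total := by positivity
  have h3 := Nat.ceil_lt_add_one (a := (d.total + β ^ 2 * d.total - ∑ j ∈ d.knownSet, I.p j) /
    (β * d.total)) (div_nonneg (by linarith) (by positivity))
  rw [← hc.sand, ← sub_lt_iff_lt_add, lt_div_iff₀ (by positivity)] at h3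
  rw [hc.packing.sum_size]
  linarith

theorem Computed.le_sum_size (hc : d.Computed A ε β γ ω τ) (hst : I.FirstStage β γ ω τ)
    (hβ : 0 < β) :
    d.total ≤ ∑ e ∈ Finset.range d.items, d.size e := by
  have hP := hc.total_pos hst
  have h2 : 0 < β ^ 2 * d.total := by positivity
  rw [hc.packing.sum_size]
  linarith [hc.rest_le_sand hst hβ]

theorem Computed.items_le (hc : d.Computed A ε β γ ω τ) (hst : I.FirstStage β γ ω τ)
    (hβ : 0 < β) (hβ1 : β ≤ 1 / 100) : (d.items : ℝ) ≤ 6 / β := by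
  have hP := hc.total_pos hst
  have h1 := hc.packing.card_le
  have h2 := hc.sum_size_le hst hβ
  have h3 : (d.items : ℝ) * β * d.total ≤ 6 * d.total := by
    have : (2 * β ^ 2 + 3 * β) * d.total ≤ 4 * d.total :=
      mul_le_mul_of_nonneg_right (by nlinarith) hP.le
    linarith
  rw [le_div_iff₀ hβ]
  exact le_of_mul_le_mul_right h3 hP

/-- The width of the intervals is chosen such that it is negligible even for the total processing
time. -/
theorem width_mul_total_le (I : JobInstance) {m : ℕ} (hm : 1 ≤ m) {ε β : ℝ} (hε : 0 < ε)
    (hβ : β = ε / (100 * m)) : β * I.total ≤ ε / 100 * optMakespan m I.p := by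
  have hm' : (0 : ℝ) < m := by exact_mod_cast hm
  have h : ε / 100 * optMakespan m I.p = β * (m * optMakespan m I.p) := by
    rw [hβ]
    field_simp
  rw [h]
  exact mul_le_mul_of_nonneg_left (I.total_le_mul_opt hm) (by rw [hβ]; positivity)

theorem Computed.opt_items_le (hc : d.Computed A ε β γ ω τ) (hst : I.FirstStage β γ ω τ)
    (hm : 1 ≤ m) (hβ : 0 < β) (hβ1 : β ≤ 1 / 100) :
    optMakespan m (fun e : Fin d.items => d.size e) ≤ optMakespan m I.p + 10 * β * I.total := by
  have hm' : (1 : ℝ) ≤ m := by exact_mod_cast hm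
  have hP := hc.total_pos hst
  have hT := I.total_pos
  have h1 := hc.le_total hst
  have h2 := hc.sum_size_le hst hβ
  have h3 := I.total_le_mul_opt hm
  refine hc.packing.opt_le hm (by positivity) I.p_pos (by positivity) ?_
  have h4 : β * d.total ≤ β * (1.06 * I.total) :=
    mul_le_mul_of_nonneg_left (h1.trans (mul_le_mul_of_nonneg_right (by linarith) hT.le)) hβ.le
  have h5 : β ^ 2 * d.total ≤ 0.01 * (β * d.total) := by
    rw [sq, mul_assoc]
    exact mul_le_mul_of_nonneg_right (by linarith) (by positivity)
  have h6 : m * (β * d.total) ≤ m * (β * (1.06 * I.total)) :=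
    mul_le_mul_of_nonneg_left h4 (by linarith)
  have h7 : 0 < β * I.total := by positivity
  have h8 : β * I.total ≤ m * (β * I.total) := le_mul_of_one_le_left h7.le hm'
  linarith

/-- The schedule of the items that the black box returns. -/
noncomputable def itemSchedule (d : SketchData I) (A : BlackBox m) (ε : ℝ) :
    Fin d.items → Fin m := A.schedule d.items (fun i => d.size i) (ε / 600)

theorem Computed.load_eq_sum (hc : d.Computed A ε β γ ω τ) (i : Fin m) :
    d.load i = ∑ e with d.itemSchedule A ε e = i, d.size e := by
  rw [load, ← sum_fin_filter]
  refine Finset.sum_congr (Finset.filter_congr fun e _ => ?_) fun _ _ => rfl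
  rw [hc.machine e e.2, itemSchedule, Fin.ext_iff]

theorem Computed.makespan_eq (hc : d.Computed A ε β γ ω τ) (hst : I.FirstStage β γ ω τ)
    (hm : 1 ≤ m) (hβ : 0 < β) {M : ℝ} (hM : ∀ i < m, d.load i ≤ M)
    (hM' : M = 0 ∨ ∃ i < m, M = d.load i) :
    makespan (fun e : Fin d.items => d.size e) (d.itemSchedule A ε) = M := by
  apply le_antisymm
  · exact makespan_le hm fun i => by
      rw [← hc.load_eq_sum i]
      exact hM i i.2
  · rcases hM' with rfl | ⟨i, hi, rfl⟩
    · have h1 := sum_le_mul_makespan (fun e : Fin d.items => d.size e) (d.itemSchedule A ε)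
      rw [Fin.sum_univ_eq_sum_range d.size] at h1
      have h2 : 0 < m * makespan (fun e : Fin d.items => d.size e) (d.itemSchedule A ε) := by
        linarith [hc.le_sum_size hst hβ, hc.total_pos hst]
      exact (pos_of_mul_pos_right h2 (Nat.cast_nonneg m)).le
    · rw [hc.load_eq_sum ⟨i, hi⟩]
      exact load_le_makespan _ _ _

theorem Computed.makespan_items_le (hc : d.Computed A ε β γ ω τ) (hst : I.FirstStage β γ ω τ)
    (hA : A.IsApproxScheme) (hm : 1 ≤ m) (hε : 0 < ε) (hε1 : ε < 1) (hβ : β = ε / (100 * m)) :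
    makespan (fun e : Fin d.items => d.size e) (d.itemSchedule A ε) ≤
      (1 + ε / 5) * optMakespan m I.p := by
  have hm' : (1 : ℝ) ≤ m := by exact_mod_cast hm
  have hβ0 : 0 < β := by rw [hβ]; positivity
  have hβ1 : β ≤ 1 / 100 := by
    rw [hβ, div_le_div_iff₀ (by positivity) (by norm_num)]
    linarith
  have h1 := hA d.items (fun e => d.size e) (ε / 600) (fun e => hc.packing.pos e e.2)
    (by positivity) (by linarith)
  have h2 := hc.opt_items_le hst hm hβ0 hβ1
  have h3 := width_mul_total_le I hm hε hβ
  have h4 : 0 ≤ optMakespan m I.p :=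
    (pos_of_mul_pos_right (I.total_pos.trans_le (I.total_le_mul_opt hm)) (by linarith)).le
  refine h1.trans ?_
  have h5 : optMakespan m (fun e : Fin d.items => d.size e) ≤ (1 + ε / 10) * optMakespan m I.p := by
    linarith
  refine (mul_le_mul_of_nonneg_left h5 (by positivity)).trans ?_
  rw [← mul_assoc]
  exact mul_le_mul_of_nonneg_right (by nlinarith) h4

/-- The known jobs follow the schedule of the items, and list scheduling handles the others. -/
theorem Computed.opt_le (hc : d.Computed A ε β γ ω τ) (hst : I.FirstStage β γ ω τ)
    (hm : 1 ≤ m) (hβ : 0 < β) (hβ1 : β ≤ 1 / 100) :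
    optMakespan m I.p ≤ makespan (fun e : Fin d.items => d.size e) (d.itemSchedule A ε) +
      β ^ 2 * d.total := by
  classical
  set M := makespan (fun e : Fin d.items => d.size e) (d.itemSchedule A ε) with hM
  have hP := hc.total_pos hst
  set f : Fin I.n → Fin m := fun j =>
    if h : d.ent j < d.items then d.itemSchedule A ε ⟨d.ent j, h⟩ else ⟨0, hm⟩ with hf
  have hfi : ∀ i, ∀ j ∈ d.knownSet, f j = i ↔ d.machine (d.ent j) = i := fun i j hj => by
    have h1 := (hc.packing.mem j hj).2
    rw [hc.machine _ h1, hf]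
    simp only [dif_pos h1, itemSchedule, Fin.ext_iff]
  have hbase : ∀ i, ∑ j ∈ d.knownSet with f j = i, I.p j ≤ M + β ^ 2 * d.total := by
    intro i
    have h1 := load_le_makespan (fun e : Fin d.items => d.size e) (d.itemSchedule A ε) i
    rw [← hc.load_eq_sum, hc.load_eq, knownLoad] at h1
    rw [Finset.filter_congr (hfi i)]
    have h2 : 0 ≤ d.share i * (β * d.total) := by positivity
    have h3 : 0 ≤ β ^ 2 * d.total := by positivity
    linarith
  have hsmall : ∀ j ∈ d.knownSetᶜ, I.p j ≤ β ^ 2 * d.total := fun j hj => by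
    rw [Finset.mem_compl, hc.mem_knownSet hst hβ hβ1, not_lt] at hj
    exact hj.trans (hc.bound_known_le hst hβ)
  have htot : ∑ j, I.p j + m * (β ^ 2 * d.total) ≤ m * (M + β ^ 2 * d.total) := by
    have h1 := sum_le_mul_makespan (fun e : Fin d.items => d.size e) (d.itemSchedule A ε)
    rw [Fin.sum_univ_eq_sum_range d.size] at h1
    have h2 : ∑ j, I.p j ≤ d.total := hc.total_le hst
    linarith [hc.le_sum_size hst hβ]
  obtain ⟨g, -, hg⟩ := exists_greedy_extension hm I.p d.knownSet f (β ^ 2 * d.total) _ hbase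
    d.knownSetᶜ disjoint_compl_right hsmall (fun j _ => (I.p_pos j).le)
    (by rwa [Finset.union_compl])
  rw [Finset.union_compl] at hg
  exact (optMakespan_le _ g).trans (makespan_le hm hg)

end

end SketchData

/-! ### The schedules that are generated from the sketch -/

namespace SketchData

/-- The sketch schedule that the data describe. -/
noncomputable def sketch {I : JobInstance} (d : SketchData I) (m : ℕ) : SketchSchedule m where
  top := d.total
  δ := d.β
  len := d.length
  count := fun i k => d.cell i k

theorem Output.sketch_eq {I : JobInstance} {d : SketchData I} {m : ℕ} {s : MachineState}
    (h : d.Output m s) : s.sketch m = d.sketch m := by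
  have key : ∀ L, L = d.length → (⟨d.total, d.β, L, fun i k => s.narr 0 ((i : ℕ) * L + k)⟩ :
      SketchSchedule m) = d.sketch m := by
    rintro _ rfl
    rw [sketch, SketchSchedule.mk.injEq]
    refine ⟨rfl, rfl, rfl, heq_of_eq ?_⟩
    funext i k
    exact h.cells i i.2 k k.2
  rw [MachineState.sketch, h.top, h.width]
  exact key _ h.length

section

variable {I : JobInstance} {d : SketchData I} {m : ℕ} {A : BlackBox m} {ε β γ : ℝ}
  {ω : ℕ → Fin I.n} {τ : ℕ}

theorem mem_interval {k : ℕ} {j : Fin I.n} :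
    j ∈ I.interval d.total d.β k ↔ d.bound (k + 1) < I.p j ∧ I.p j ≤ d.bound k := by
  simp [interval, bound]

theorem bound_anti (h0 : 0 ≤ d.total) (h1 : 0 ≤ d.β) (h2 : d.β ≤ 1) {k l : ℕ} (h : k ≤ l) :
    d.bound l ≤ d.bound k :=
  mul_le_mul_of_nonneg_left (pow_le_pow_of_le_one (by linarith) (by linarith) h) h0

/-- The intervals of the grid are disjoint and adjacent. -/
theorem sum_interval (h0 : 0 ≤ d.total) (h1 : 0 ≤ d.β) (h2 : d.β ≤ 1) (g : Fin I.n → ℝ)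
    (Q : Fin I.n → Prop) [DecidablePred Q] {a b : ℕ} (hab : a ≤ b) :
    ∑ k ∈ Finset.Ico a b, ∑ j ∈ I.interval d.total d.β k with Q j, g j =
      ∑ j with (d.bound b < I.p j ∧ I.p j ≤ d.bound a) ∧ Q j, g j := by
  induction b, hab using Nat.le_induction with
  | base =>
    rw [Finset.Ico_self, Finset.sum_empty, Finset.filter_false_of_mem, Finset.sum_empty]
    rintro j - ⟨h, -⟩
    linarith
  | succ b hab ih =>
    have hb := bound_anti (d := d) h0 h1 h2 hab
    have hb' := bound_anti (d := d) h0 h1 h2 (Nat.le_succ b)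
    rw [Finset.sum_Ico_succ_top hab, ih, ← Finset.sum_union]
    · refine Finset.sum_congr ?_ fun _ _ => rfl
      ext j
      simp only [Finset.mem_union, Finset.mem_filter, Finset.mem_univ, true_and, mem_interval]
      constructor
      · rintro (⟨⟨h3, h4⟩, h5⟩ | ⟨⟨h3, h4⟩, h5⟩)
        · exact ⟨⟨hb'.trans_lt h3, h4⟩, h5⟩
        · exact ⟨⟨h3, h4.trans hb⟩, h5⟩
      · rintro ⟨⟨h3, h4⟩, h5⟩
        rcases lt_or_ge (d.bound b) (I.p j) with h6 | h6
        · exact Or.inl ⟨⟨h6, h4⟩, h5⟩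
        · exact Or.inr ⟨⟨h3, h6⟩, h5⟩
    · rw [Finset.disjoint_left]
      intro j hj hj'
      simp only [Finset.mem_filter, Finset.mem_univ, true_and, mem_interval] at hj hj'
      linarith [hj.1.1, hj'.1.2]

theorem bound_succ (d : SketchData I) (k : ℕ) : d.bound (k + 1) = (1 - d.β) * d.bound k := by
  rw [bound, bound, pow_succ]
  ring

theorem sum_bound (d : SketchData I) {a b : ℕ} (hab : a ≤ b) :
    d.β * ∑ k ∈ Finset.Ico a b, d.bound k = d.bound a - d.bound b := by
  induction b, hab using Nat.le_induction with
  | base => simp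
  | succ b hab ih =>
    rw [Finset.sum_Ico_succ_top hab, mul_add, ih, bound_succ]
    ring

/-- In the first intervals, the entries of the sketch are the numbers of jobs in the schedule of
the items. -/
theorem Computed.cell_of_lt (hc : d.Computed A ε β γ ω τ) (hst : I.FirstStage β γ ω τ)
    (hβ : 0 < β) (hβ1 : β ≤ 1 / 100) (i : ℕ) {k : ℕ} (hk : k < d.known) :
    d.cell i k = ((I.interval d.total d.β k).filter fun j => d.machine (d.ent j) = i).card := by
  rw [cell, if_pos hk]
  congr 1
  ext j
  simp only [Finset.mem_filter, mem_interval]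
  refine ⟨fun h => h.2, fun h => ⟨?_, h⟩⟩
  have h1 := bound_anti (d := d) (hc.total_pos hst).le (by rw [hc.beta]; exact hβ.le)
    (by rw [hc.beta]; linarith) (show k + 1 ≤ d.known from hk)
  exact (Finset.mem_filter.1 ((hc.mem_knownSet hst hβ hβ1 j).2 (h1.trans_lt h.1.1))).1

theorem Computed.estimate_of_lt (hc : d.Computed A ε β γ ω τ) (hst : I.FirstStage β γ ω τ)
    (hβ : 0 < β) (hβ1 : β ≤ 1 / 100) {k : Fin d.length} (hk : k < d.known) :
    (d.sketch m).estimate k = (I.interval d.total d.β k).card := by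
  change ∑ i : Fin m, d.cell i k = _
  simp only [hc.cell_of_lt hst hβ hβ1 _ hk]
  refine sum_card_filter_eq _ (fun j => d.machine (d.ent j)) fun j hj => ?_
  have h1 := bound_anti (d := d) (hc.total_pos hst).le (by rw [hc.beta]; exact hβ.le)
    (by rw [hc.beta]; linarith) (show (k : ℕ) + 1 ≤ d.known from hk)
  exact hc.machine_lt (hc.packing.mem j
    ((hc.mem_knownSet hst hβ hβ1 j).2 (h1.trans_lt (mem_interval.1 hj).1))).2

theorem sum_filter_interval_le (k : ℕ) (Q : Fin I.n → Prop) [DecidablePred Q] :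
    ∑ j ∈ I.interval d.total d.β k with Q j, I.p j ≤
      ((I.interval d.total d.β k).filter Q).card * d.bound k := by
  refine (Finset.sum_le_card_nsmul _ _ (d.bound k) fun j hj => ?_).trans (by rw [nsmul_eq_mul])
  exact (mem_interval.1 (Finset.mem_filter.1 hj).1).2

theorem le_sum_filter_interval (k : ℕ) (Q : Fin I.n → Prop) [DecidablePred Q] :
    ((I.interval d.total d.β k).filter Q).card * ((1 - d.β) * d.bound k) ≤
      ∑ j ∈ I.interval d.total d.β k with Q j, I.p j := by
  rw [← bound_succ, ← nsmul_eq_mul]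
  refine Finset.card_nsmul_le_sum _ _ _ fun j hj => ?_
  exact (mem_interval.1 (Finset.mem_filter.1 hj).1).1.le

theorem Computed.load_known_le (hc : d.Computed A ε β γ ω τ) (hst : I.FirstStage β γ ω τ)
    (hβ : 0 < β) (hβ1 : β ≤ 1 / 100) {S : Fin I.n → Fin m} (hS : (d.sketch m).Generates I.p S)
    (i : Fin m) (k : Fin d.length) (hk : k < d.known) :
    (1 - β) * ∑ j ∈ I.interval d.total d.β k with S j = i, I.p j ≤
      ∑ j ∈ I.interval d.total d.β k with d.machine (d.ent j) = i, I.p j := by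
  have h1 := hS.card_le k i
  rw [hc.estimate_of_lt hst hβ hβ1 hk] at h1
  change ((I.interval d.total d.β k).filter fun j => S j = i).card ≤
    d.cell i k + ((I.interval d.total d.β k).card - _) at h1
  rw [hc.cell_of_lt hst hβ hβ1 _ hk, Nat.sub_self, add_zero] at h1
  have hb : 0 ≤ d.bound k := by
    rw [hc.bound_eq]
    exact mul_nonneg (hc.total_pos hst).le (pow_nonneg (by linarith) _)
  have h1' : (((I.interval d.total d.β k).filter fun j => S j = i).card : ℝ) ≤
    ((I.interval d.total d.β k).filter fun j => d.machine (d.ent j) = i).card := by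
    exact_mod_cast h1
  have h2 := sum_filter_interval_le (d := d) k fun j => S j = i
  have h3 := le_sum_filter_interval (d := d) k fun j => d.machine (d.ent j) = i
  have hβe : 1 - d.β = 1 - β := by rw [hc.beta]
  rw [hβe] at h3
  refine le_trans ?_ h3
  calc _ ≤ (1 - β) * (_ * d.bound k) := mul_le_mul_of_nonneg_left h2 (by linarith)
    _ = _ * ((1 - β) * d.bound k) := by ring
    _ ≤ _ := mul_le_mul_of_nonneg_right h1' (mul_nonneg (by linarith) hb)

/-- The load from the jobs of a later interval: the share of machine `i` in the sand, the surplus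
jobs, and one job that makes up for rounding. -/
theorem Computed.load_unknown_le (hc : d.Computed A ε β γ ω τ) (hst : I.FirstStage β γ ω τ)
    (hβ : 0 < β) (hβ1 : β ≤ 1 / 100) {S : Fin I.n → Fin m} (hS : (d.sketch m).Generates I.p S)
    (i : Fin m) (k : Fin d.length) (hk : d.known ≤ k) {η : ℝ}
    (hX : |(d.sampleCount k : ℝ) / d.second - I.mass (I.interval d.total d.β k)| ≤
      β * I.mass (I.interval d.total d.β k) + η) :
    (1 - β) * ∑ j ∈ I.interval d.total d.β k with S j = i, I.p j ≤
      (d.share i / d.sand) * ((1 + β) * I.mass (I.interval d.total d.β k) + η) * d.total +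
      (β * I.mass (I.interval d.total d.β k) + η) * d.total + d.bound k := by
  have hP := hc.total_pos hst
  have hb : 0 < d.bound k := by
    rw [hc.bound_eq]
    exact mul_pos hP (pow_pos (by linarith) _)
  set f := I.mass (I.interval d.total d.β k) with hf
  set x : ℝ := (d.sampleCount k : ℝ) / d.second with hx
  have hf0 : 0 ≤ f := I.mass_nonneg _
  obtain ⟨hX1, hX2⟩ := abs_le.1 hX
  have hB : 0 < (1 - β) * d.bound k := mul_pos (by linarith) hb
  have hcell : ∀ i, d.cell i k = ⌊d.quot i k⌋₊ + 1 := fun i => by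
    rw [cell, if_neg (not_lt.2 hk)]
  have hquot : ∀ i, d.quot i k * ((1 - β) * d.bound k) = d.share i / d.sand * x * d.total := by
    intro i
    rw [quot, hc.beta, div_mul_cancel₀ _ hB.ne']
  -- the estimated number of jobs
  have hest : x * d.total ≤ (d.sketch m).estimate k * ((1 - β) * d.bound k) := by
    have h1 : ∑ i : Fin m, d.quot i k ≤ (d.sketch m).estimate k := by
      change _ ≤ ((∑ i : Fin m, d.cell i k : ℕ) : ℝ)
      push_cast
      refine Finset.sum_le_sum fun i _ => ?_
      rw [hcell]
      push_cast
      exact (Nat.lt_floor_add_one _).le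
    refine le_trans ?_ (mul_le_mul_of_nonneg_right h1 hB.le)
    rw [Finset.sum_mul]
    simp only [hquot]
    rw [← Finset.sum_mul, ← Finset.sum_mul, ← Finset.sum_div]
    have h2 : ∑ i : Fin m, (d.share i : ℝ) = d.sand := by exact_mod_cast hc.sum_share
    have h3 : (d.sand : ℝ) ≠ 0 := by exact_mod_cast (hc.sand_pos hst hβ).ne'
    rw [h2, div_self h3, one_mul]
  -- the number of jobs
  have hcard : ((I.interval d.total d.β k).card : ℝ) * ((1 - β) * d.bound k) ≤ f * d.total := by
    have h1 := le_sum_filter_interval (d := d) k fun _ => True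
    rw [Finset.filter_true, hc.beta] at h1
    have h2 : ∑ j ∈ I.interval d.total β k, I.p j = f * I.total := by
      rw [hf, I.mass_eq, hc.beta, div_mul_cancel₀ _ I.total_pos.ne']
    rw [hc.beta]
    exact (h1.trans h2.le).trans (mul_le_mul_of_nonneg_left (hc.total_le hst) hf0)
  have hsur : (((I.interval d.total d.β k).card - (d.sketch m).estimate k : ℕ) : ℝ) *
      ((1 - β) * d.bound k) ≤ (β * f + η) * d.total := by
    rcases _root_.le_total (I.interval d.total d.β k).card ((d.sketch m).estimate k) with h | h
    · rw [Nat.sub_eq_zero_of_le h, Nat.cast_zero, zero_mul]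
      exact mul_nonneg (le_trans (abs_nonneg _) hX) hP.le
    · rw [Nat.cast_sub h, sub_mul]
      have : (f - x) * d.total ≤ (β * f + η) * d.total :=
        mul_le_mul_of_nonneg_right (by linarith) hP.le
      linarith
  have h1 := hS.card_le k i
  change ((I.interval d.total d.β k).filter fun j => S j = i).card ≤
    d.cell i k + ((I.interval d.total d.β k).card - _) at h1
  rw [hcell] at h1
  have h1' : (((I.interval d.total d.β k).filter fun j => S j = i).card : ℝ) ≤
      d.quot i k + 1 + ((I.interval d.total d.β k).card - (d.sketch m).estimate k : ℕ) := by
    have h2 : (⌊d.quot i k⌋₊ : ℝ) ≤ d.quot i k := Nat.floor_le (by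
      rw [quot, hc.beta]
      positivity)
    have h3 : (((I.interval d.total d.β k).filter fun j => S j = i).card : ℝ) ≤
        ⌊d.quot i k⌋₊ + 1 + ((I.interval d.total d.β k).card - (d.sketch m).estimate k : ℕ) := by
      exact_mod_cast h1
    linarith
  have hr : 0 ≤ (d.share i / d.sand : ℝ) * d.total := by positivity
  have h4 : (d.share i / d.sand : ℝ) * x * d.total ≤
      d.share i / d.sand * ((1 + β) * f + η) * d.total := by
    have := mul_le_mul_of_nonneg_left (show x ≤ (1 + β) * f + η by linarith) hr
    linarith
  have h5 := mul_le_mul_of_nonneg_right h1' hB.le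
  rw [add_mul, add_mul, hquot] at h5
  have h6 := sum_filter_interval_le (d := d) k fun j => S j = i
  have h7 := mul_le_mul_of_nonneg_left h6 (show 0 ≤ 1 - β by linarith)
  have h8 : 0 ≤ β * d.bound k := by positivity
  linarith

theorem Computed.load_le (hc : d.Computed A ε β γ ω τ) (hst : I.FirstStage β γ ω τ)
    (hβ : 0 < β) (hβ1 : β ≤ 1 / 100) {S : Fin I.n → Fin m} (hS : (d.sketch m).Generates I.p S)
    (i : Fin m) {η : ℝ} (hη : d.length * η ≤ β) (hη0 : 0 ≤ η)
    (hX : ∀ k < d.length, |(d.sampleCount k : ℝ) / d.second -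
      I.mass (I.interval d.total d.β k)| ≤ β * I.mass (I.interval d.total d.β k) + η) :
    ∑ j with S j = i, I.p j ≤ (1 + 10 * β) * d.load i + 9 * β * I.total := by
  have hP := hc.total_pos hst
  have hT := I.total_pos
  have hb0 : 0 ≤ d.β := by rw [hc.beta]; exact hβ.le
  have hb1 : d.β ≤ 1 := by rw [hc.beta]; linarith
  have hκ : d.known ≤ d.length := by
    rw [hc.known, hc.length]
    exact hst.length_gt.le
  set f := fun k => I.mass (I.interval d.total d.β k) with hf
  set r : ℝ := d.share i / d.sand with hr
  have hR : (0 : ℝ) < d.sand := by exact_mod_cast hc.sand_pos hst hβ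
  have hr0 : 0 ≤ r := by positivity
  have hr1 : r ≤ 1 := div_le_one_of_le₀ (Nat.cast_le.2
    ((Finset.card_filter_le _ _).trans (Finset.card_range _).le)) hR.le
  -- the jobs below the grid
  have hlow : ∑ j with S j = i ∧ I.p j ≤ d.bound d.length, I.p j ≤ 4 * β * I.total := by
    have h1 := hst.mass_rest
    rw [← hc.total, ← hc.length, ← hc.bound_eq, I.mass_eq, div_le_iff₀ hT] at h1
    refine le_trans (Finset.sum_le_sum_of_subset_of_nonneg (fun j hj => ?_)
      fun j _ _ => (I.p_pos j).le) h1
    rw [mem_below]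
    exact (Finset.mem_filter.1 hj).2.2
  -- the known jobs
  have hknown : (1 - β) * ∑ k ∈ Finset.Ico 0 d.known, ∑ j ∈ I.interval d.total d.β k with S j = i,
      I.p j ≤ d.knownLoad i := by
    have hstep : ∀ k ∈ Finset.Ico 0 d.known,
        (1 - β) * ∑ j ∈ I.interval d.total d.β k with S j = i, I.p j ≤
          ∑ j ∈ I.interval d.total d.β k with d.machine (d.ent j) = i, I.p j := fun k hk =>
      hc.load_known_le hst hβ hβ1 hS i ⟨k, (Finset.mem_Ico.1 hk).2.trans_le hκ⟩
        (Finset.mem_Ico.1 hk).2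
    rw [Finset.mul_sum]
    refine (Finset.sum_le_sum hstep).trans ?_
    rw [sum_interval hP.le hb0 hb1 _ _ (Nat.zero_le _), knownLoad]
    refine Finset.sum_le_sum_of_subset_of_nonneg (fun j hj => ?_) fun j _ _ => (I.p_pos j).le
    rw [Finset.mem_filter] at hj ⊢
    exact ⟨(hc.mem_knownSet hst hβ hβ1 j).2 hj.2.1.1, hj.2.2⟩
  -- the other jobs of the grid
  have hunknown : (1 - β) * ∑ k ∈ Finset.Ico d.known d.length,
      ∑ j ∈ I.interval d.total d.β k with S j = i, I.p j ≤
      r * ((1 + β) * ∑ k ∈ Finset.Ico d.known d.length, f k + β) * d.total +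
      (β * ∑ k ∈ Finset.Ico d.known d.length, f k + β) * d.total + β * d.total := by
    have hηs : ∑ k ∈ Finset.Ico d.known d.length, η ≤ β := by
      refine le_trans ?_ hη
      rw [Finset.sum_const, nsmul_eq_mul, Nat.card_Ico]
      exact mul_le_mul_of_nonneg_right (Nat.cast_le.2 (Nat.sub_le _ _)) hη0
    have hbs : ∑ k ∈ Finset.Ico d.known d.length, d.bound k ≤ β * d.total := by
      have h1 := d.sum_bound hκ
      have h2 := hc.bound_known_le hst hβ
      have h3 : 0 ≤ d.bound d.length := by
        rw [hc.bound_eq]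
        exact mul_nonneg hP.le (pow_nonneg (by linarith) _)
      rw [hc.beta] at h1
      refine le_of_mul_le_mul_left ?_ hβ
      rw [h1, ← mul_assoc, ← sq]
      linarith
    have hstep : ∀ k ∈ Finset.Ico d.known d.length,
        (1 - β) * ∑ j ∈ I.interval d.total d.β k with S j = i, I.p j ≤
          r * ((1 + β) * f k + η) * d.total + (β * f k + η) * d.total + d.bound k := fun k hk =>
      hc.load_unknown_le hst hβ hβ1 hS i ⟨k, (Finset.mem_Ico.1 hk).2⟩ (Finset.mem_Ico.1 hk).1
        (hX k (Finset.mem_Ico.1 hk).2)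
    rw [Finset.mul_sum]
    refine (Finset.sum_le_sum hstep).trans ?_
    rw [Finset.sum_add_distrib, Finset.sum_add_distrib, ← Finset.sum_mul, ← Finset.sum_mul,
      ← Finset.mul_sum, Finset.sum_add_distrib, Finset.sum_add_distrib, ← Finset.mul_sum,
      ← Finset.mul_sum]
    have h1 : ∀ c, (c + ∑ k ∈ Finset.Ico d.known d.length, η) * d.total ≤ (c + β) * d.total :=
      fun c => mul_le_mul_of_nonneg_right (by linarith) hP.le
    have h2 := mul_le_mul_of_nonneg_left
      (h1 ((1 + β) * ∑ k ∈ Finset.Ico d.known d.length, f k)) hr0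
    have h3 := h1 (β * ∑ k ∈ Finset.Ico d.known d.length, f k)
    simp only [hf] at h2 h3 ⊢
    linarith
  -- the sand stands for the unknown jobs
  set F := ∑ k ∈ Finset.Ico d.known d.length, f k with hF
  have hF0 : 0 ≤ F := Finset.sum_nonneg fun k _ => I.mass_nonneg _
  have hFT : F * I.total ≤ I.total - ∑ j ∈ d.knownSet, I.p j := by
    have h1 : F * I.total = ∑ k ∈ Finset.Ico d.known d.length,
        ∑ j ∈ I.interval d.total d.β k with True, I.p j := by
      rw [hF, Finset.sum_mul]
      refine Finset.sum_congr rfl fun k _ => ?_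
      simp only [hf]
      rw [I.mass_eq, div_mul_cancel₀ _ hT.ne', Finset.filter_true]
    have h2 : I.total = ∑ j ∈ d.knownSet, I.p j + ∑ j ∈ d.knownSetᶜ, I.p j :=
      (Finset.sum_add_sum_compl _ _).symm
    rw [h1, sum_interval hP.le hb0 hb1 _ _ hκ]
    have h3 : ∑ j with (d.bound d.length < I.p j ∧ I.p j ≤ d.bound d.known) ∧ True, I.p j ≤
        ∑ j ∈ d.knownSetᶜ, I.p j := by
      refine Finset.sum_le_sum_of_subset_of_nonneg (fun j hj => ?_) fun j _ _ => (I.p_pos j).le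
      rw [Finset.mem_compl, hc.mem_knownSet hst hβ hβ1, not_lt]
      exact (Finset.mem_filter.1 hj).2.1.2
    linarith
  have hF1 : F ≤ 1 := by
    have h1 : 0 ≤ ∑ j ∈ d.knownSet, I.p j := Finset.sum_nonneg fun j _ => (I.p_pos j).le
    refine le_of_mul_le_mul_right ?_ hT
    linarith
  have hsand : r * F * d.total ≤ (1 + 6 * β) * (d.share i * (β * d.total)) := by
    have h1 := hc.rest_le_sand hst hβ
    have h2 := hc.total_le hst
    have h3 : 0 ≤ β ^ 2 * d.total := by positivity
    have h4 : F * I.total ≤ d.sand * (β * d.total) := by linarith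
    have h5 : F * d.total ≤ (1 + 6 * β) * (d.sand * (β * d.total)) := by
      have h6 := mul_le_mul_of_nonneg_left (hc.le_total hst) hF0
      have h7 := mul_le_mul_of_nonneg_left h4 (show 0 ≤ 1 + 6 * β by linarith)
      linarith
    have h8 := mul_le_mul_of_nonneg_left h5 hr0
    have h9 : r * ((1 + 6 * β) * (d.sand * (β * d.total))) =
        (1 + 6 * β) * (d.share i * (β * d.total)) := by
      rw [hr]
      field_simp
    linarith
  -- the jobs of machine `i`
  have hsplit : ∑ j with S j = i, I.p j = ∑ j with S j = i ∧ I.p j ≤ d.bound d.length, I.p j +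
      (∑ k ∈ Finset.Ico 0 d.known, ∑ j ∈ I.interval d.total d.β k with S j = i, I.p j +
        ∑ k ∈ Finset.Ico d.known d.length,
          ∑ j ∈ I.interval d.total d.β k with S j = i, I.p j) := by
    rw [Finset.sum_Ico_consecutive _ (Nat.zero_le _) hκ,
      sum_interval hP.le hb0 hb1 _ _ (Nat.zero_le _),
      ← Finset.sum_filter_add_sum_filter_not (Finset.univ.filter fun j => S j = i)
        (fun j => I.p j ≤ d.bound d.length), Finset.filter_filter, Finset.filter_filter]
    congr 1
    refine Finset.sum_congr (Finset.filter_congr fun j _ => ?_) fun _ _ => rfl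
    have h1 : I.p j ≤ d.bound 0 := by
      rw [bound, pow_zero, mul_one]
      exact (Finset.single_le_sum (f := I.p) (fun l _ => (I.p_pos l).le)
        (Finset.mem_univ j)).trans (hc.total_le hst)
    rw [not_le]
    tauto
  rw [hsplit, hc.load_eq]
  have hs0 : 0 ≤ d.share i * (β * d.total) := by positivity
  have hk0 : 0 ≤ d.knownLoad i := Finset.sum_nonneg fun j _ => (I.p_pos j).le
  set a := ∑ j with S j = i ∧ I.p j ≤ d.bound d.length, I.p j
  set b := ∑ k ∈ Finset.Ico 0 d.known, ∑ j ∈ I.interval d.total d.β k with S j = i, I.p j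
  set c := ∑ k ∈ Finset.Ico d.known d.length, ∑ j ∈ I.interval d.total d.β k with S j = i, I.p j
  set u := d.share i * (β * d.total)
  have hbP : 0 ≤ β * d.total := by positivity
  have h1 : r * (β * d.total) ≤ β * d.total := mul_le_of_le_one_left hbP hr1
  have h2 : β * F * d.total ≤ β * d.total := by
    have := mul_le_mul_of_nonneg_left hF1 hbP
    linarith
  have h3 : β * d.total ≤ 1.06 * (β * I.total) := by
    have h4 := mul_le_mul_of_nonneg_left (hc.le_total hst) hβ.le
    have h5 : 0 ≤ β * I.total := by positivity
    nlinarith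
  have h4 : (1 + β) * (r * F * d.total) ≤ (1 + β) * ((1 + 6 * β) * u) :=
    mul_le_mul_of_nonneg_left hsand (by linarith)
  have h5 : (1 - β) * (b + c) ≤ d.knownLoad i + (1 + β) * ((1 + 6 * β) * u) +
      4.24 * (β * I.total) := by linarith
  have h6 : (1 + β) * ((1 + 6 * β) * u) ≤ (1 - β) * ((1 + 10 * β) * u) := by
    have h10 : (1 + β) * (1 + 6 * β) ≤ (1 - β) * (1 + 10 * β) := by nlinarith
    linarith [mul_le_mul_of_nonneg_right h10 hs0]
  have h7 : d.knownLoad i ≤ (1 - β) * ((1 + 10 * β) * d.knownLoad i) := by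
    rw [← mul_assoc]
    exact le_mul_of_one_le_left hk0 (by nlinarith)
  have h8 : 4.24 * (β * I.total) ≤ (1 - β) * (5 * (β * I.total)) := by
    have h10 : 4.24 ≤ (1 - β) * 5 := by linarith
    have h11 : 0 ≤ β * I.total := by positivity
    linarith [mul_le_mul_of_nonneg_right h10 h11]
  have h9 : b + c ≤ (1 + 10 * β) * u + (1 + 10 * β) * d.knownLoad i + 5 * (β * I.total) := by
    refine le_of_mul_le_mul_left ?_ (show 0 < 1 - β by linarith)
    linarith
  linarith

/-- The counts of the second stage are concentrated. -/
theorem Computed.abs_sampleCount_sub_le (hc : d.Computed A ε β γ ω τ) {L H : ℕ} {k : ℕ}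
    (hs : 0 < d.second) (hβ : 0 < β) (hH : τ + d.second ≤ H)
    (h : I.Concentrated (I.secondStage β γ τ k) H β L ω) :
    |(d.sampleCount k : ℝ) / d.second - I.mass (I.interval d.total d.β k)| ≤
      β * I.mass (I.interval d.total d.β k) + L / (β * d.second) := by
  have hn : (0 : ℝ) < d.second := by exact_mod_cast hs
  have hset : ∀ i, I.secondStage β γ τ k i ω =
      if τ ≤ i ∧ i < τ + d.second then I.interval d.total d.β k else ∅ := fun i => by
    rw [secondStage, hc.second, hc.total, hc.beta]
  have hsum : ∀ g : ℕ → ℝ, ∑ i ∈ Finset.range H, (if τ ≤ i ∧ i < τ + d.second then g i else 0) =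
      ∑ j ∈ Finset.range d.second, g (τ + j) := fun g => by
    have hfil : ((Finset.range H).filter fun i => τ ≤ i ∧ i < τ + d.second) =
        Finset.Ico τ (τ + d.second) := by
      ext i
      simp only [Finset.mem_filter, Finset.mem_range, Finset.mem_Ico]
      omega
    rw [← Finset.sum_filter, hfil, Finset.sum_Ico_eq_sum_range, Nat.add_sub_cancel_left]
  have h1 : I.hitCount (I.secondStage β γ τ k) H ω = d.sampleCount k := by
    have h2 : ∀ i, (if ω i ∈ I.secondStage β γ τ k i ω then (1 : ℝ) else 0) =
        if τ ≤ i ∧ i < τ + d.second then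
          if ω i ∈ I.interval d.total d.β k then 1 else 0 else 0 := fun i => by
      rw [hset]
      split_ifs <;> simp_all
    rw [hitCount, Finset.sum_congr rfl fun i _ => h2 i, hsum, ← Finset.sum_filter,
      Finset.sum_const, nsmul_eq_mul, mul_one, sampleCount]
    congr 2
    refine Finset.filter_congr fun j hj => ?_
    rw [mem_interval, hc.sample j (Finset.mem_range.1 hj)]
  have h2 : I.hitMass (I.secondStage β γ τ k) H ω =
      d.second * I.mass (I.interval d.total d.β k) := by
    have h3 : ∀ i, I.mass (I.secondStage β γ τ k i ω) =
        if τ ≤ i ∧ i < τ + d.second then I.mass (I.interval d.total d.β k) else 0 := fun i => by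
      rw [hset]
      split_ifs
      · rfl
      · simp [mass]
    rw [hitMass, Finset.sum_congr rfl fun i _ => h3 i, hsum, Finset.sum_const, nsmul_eq_mul,
      Finset.card_range]
  rw [Concentrated, h1, h2] at h
  have e1 : (d.sampleCount k : ℝ) / d.second - I.mass (I.interval d.total d.β k) =
      (d.sampleCount k - d.second * I.mass (I.interval d.total d.β k)) / d.second := by
    field_simp
  rw [e1, abs_div, abs_of_pos hn, div_le_iff₀ hn]
  refine h.trans (le_of_eq ?_)
  field_simp

end

end SketchData

/-! ### Accuracy of the output -/

namespace SketchData

theorem Computed.accuracy {I : JobInstance} {d : SketchData I} {m : ℕ} {A : BlackBox m}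
    {ε β γ : ℝ} {ω : ℕ → Fin I.n} {τ : ℕ} (hc : d.Computed A ε β γ ω τ)
    (hst : I.FirstStage β γ ω τ) (hA : A.IsApproxScheme) (hm : 1 ≤ m) (hε : 0 < ε) (hε1 : ε < 1)
    (hγ : 0 < γ) (hγ1 : γ < 1) (hβ : β = ε / (100 * m)) {T : Finset (Fin I.n)} {H : ℕ}
    (htyp : I.Typical β γ T H ω) (hH : τ + I.secondCount β γ ω τ ≤ H) (hτ : τ < H)
    (hH' : I.sketchLength β ω τ ≤ H) {s : MachineState} (hout : d.Output m s) :
    optMakespan m I.p ≤ s.value ∧ s.value ≤ (1 + ε) * optMakespan m I.p ∧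
      ∀ S : Fin I.n → Fin m, (s.sketch m).Generates I.p S →
        makespan I.p S ≤ (1 + 3 * ε) * optMakespan m I.p := by
  have hm' : (1 : ℝ) ≤ m := by exact_mod_cast hm
  have hβ0 : 0 < β := by rw [hβ]; positivity
  have hβε : β ≤ ε / 100 := by
    rw [hβ]
    exact div_le_div_of_nonneg_left hε.le (by norm_num) (by linarith)
  have hβ1 : β ≤ 1 / 100 := by linarith
  have hT := I.total_pos
  have hO : 0 < optMakespan m I.p :=
    pos_of_mul_pos_right (I.total_pos.trans_le (I.total_le_mul_opt hm)) (by linarith)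
  have hw := width_mul_total_le I hm hε hβ
  obtain ⟨M, hv, hM, hM'⟩ := hout.value
  have hMeq := hc.makespan_eq hst hm hβ0 hM hM'
  have hMle := hc.makespan_items_le hst hA hm hε hε1 hβ
  have hopt := hc.opt_le hst hm hβ0 hβ1
  rw [hMeq] at hMle hopt
  have hεO : 0 < ε * optMakespan m I.p := by positivity
  have hβT : 0 < β * I.total := by positivity
  have hrest : β ^ 2 * d.total ≤ β * I.total := by
    have h1 := mul_le_mul_of_nonneg_left (hc.le_total hst) (show 0 ≤ β ^ 2 by positivity)
    have h2 : β * (1 + 6 * β) ≤ 1 := by nlinarith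
    nlinarith [mul_le_mul_of_nonneg_right h2 hβT.le]
  have hvalue : s.value = M + β ^ 2 * d.total := by rw [hv, hc.beta]
  refine ⟨by linarith, by linarith, fun S hS => ?_⟩
  rw [hout.sketch_eq] at hS
  -- the second stage has enough samples for all intervals
  have ht : 0 < d.length := by
    rw [hc.length]
    exact (Nat.zero_le _).trans_lt hst.length_gt
  set L := secondConfidence γ d.length τ with hL
  have hL1 : 1 ≤ L := one_le_confidence hγ hγ1 (by
    have h1 : (1 : ℝ) ≤ ((d.length : ℝ) + 1) ^ 2 := 
      one_le_pow₀ (by linarith [Nat.cast_nonneg (α := ℝ) d.length])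
    have h2 : (1 : ℝ) ≤ ((τ : ℝ) + 1) ^ 2 := one_le_pow₀ (by linarith [Nat.cast_nonneg (α := ℝ) τ])
    nlinarith)
  have hsec : (d.length : ℝ) * L / β ^ 2 ≤ d.second := by
    rw [hc.second, hL, hc.length]
    exact Nat.le_ceil _
  have hsec0 : (0 : ℝ) < d.second := lt_of_lt_of_le (by positivity) hsec
  have hη : (d.length : ℝ) * (L / (β * d.second)) ≤ β := by
    rw [div_le_iff₀ (by positivity)] at hsec
    rw [mul_div_assoc', div_le_iff₀ (by positivity)]
    linarith
  have hX : ∀ k < d.length, |(d.sampleCount k : ℝ) / d.second -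
      I.mass (I.interval d.total d.β k)| ≤
      β * I.mass (I.interval d.total d.β k) + L / (β * d.second) := by
    intro k hk
    refine (hc.abs_sampleCount_sub_le (by exact_mod_cast hsec0) hβ0 (by rwa [hc.second])
      (htyp.second τ hτ k (by rw [hc.length] at hk; omega))).trans ?_
    have h1 : secondConfidence γ k τ ≤ L := by
      refine confidence_mono hγ (by positivity) ?_
      gcongr
    gcongr
  refine makespan_le hm fun i => ?_
  refine (hc.load_le hst hβ0 hβ1 hS i hη (by positivity) hX).trans ?_
  have h1 : (1 + 10 * β) * d.load i ≤ (1 + 10 * β) * ((1 + ε / 5) * optMakespan m I.p) :=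
    mul_le_mul_of_nonneg_left ((hM i i.2).trans hMle) (by linarith)
  have h2 : (1 + 10 * β) * ((1 + ε / 5) * optMakespan m I.p) ≤
      (1 + ε) * optMakespan m I.p := by
    rw [← mul_assoc]
    exact mul_le_mul_of_nonneg_right (by nlinarith) hO.le
  linarith

end SketchData

/-! ### Running time and size of the sketch -/

theorem one_le_log {Z : ℝ} (hZ : 3 ≤ Z) : 1 ≤ Real.log Z := by
  rw [Real.le_log_iff_exp_le (by linarith)]
  linarith [Real.exp_one_lt_d9]

theorem confidence_le {γ y Z : ℝ} (hZ : 3 ≤ Z) (hy : 0 < y / γ) {a : ℕ} (h : y / γ ≤ Z ^ a) :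
    (confidence γ y : ℝ) ≤ 2 * a * Real.log Z + 1 := by
  have h1 : Real.log (y / γ) ≤ a * Real.log Z := by
    rw [← Real.log_pow]
    exact Real.log_le_log hy h
  have h2 : 0 ≤ a * Real.log Z := mul_nonneg (Nat.cast_nonneg a) (by linarith [one_le_log hZ])
  have h3 : Real.logb 2 (y / γ) ≤ 2 * a * Real.log Z := by
    rw [Real.logb, div_le_iff₀ (Real.log_pos (by norm_num))]
    nlinarith [Real.log_two_gt_d9]
  refine (Nat.cast_le.2 (Nat.ceil_mono h3)).trans (Nat.ceil_lt_add_one (by linarith)).le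

theorem le_pow_of_three_le {Z c y : ℝ} (hZ : 3 ≤ Z) {a b : ℕ} (hc : c ≤ 3 ^ a) (hy0 : 0 ≤ y)
    (hy : y ≤ Z ^ b) : c * y ≤ Z ^ (a + b) := by
  rw [pow_add]
  exact mul_le_mul (hc.trans (pow_le_pow_left₀ (by norm_num) hZ a)) hy hy0 (by positivity)

namespace JobInstance

section

variable {I : JobInstance} {β γ x : ℝ} {ω : ℕ → Fin I.n} {τ : ℕ}

/-- The length of the grid. -/
theorem FirstStage.length_bound (hst : I.FirstStage β γ ω τ) (hx : 1 ≤ x)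
    (hβ : β = 1 / (100 * x)) {Z : ℝ} (hZ : 3 ≤ Z) (hnx : I.n * x ≤ Z) :
    (I.sketchLength β ω τ : ℝ) ≤ 1202 * (x * Real.log Z) := by
  have hn : (1 : ℝ) ≤ I.n := by exact_mod_cast I.n_pos
  have hβ0 : 0 < β := by rw [hβ]; positivity
  have hβ1 : β ≤ 1 / 100 := by
    rw [hβ]
    exact div_le_div_of_nonneg_left (by norm_num) (by norm_num) (by linarith)
  have hlog := one_le_log hZ
  set t := I.sketchLength β ω τ
  have h1 : Real.log (β ^ 2 / (4 * I.n)) ≤ (t - 2 : ℕ) * Real.log (1 - β) := by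
    rw [← Real.log_pow]
    exact Real.log_le_log (by positivity) hst.length_le
  have h2 : Real.log (1 - β) ≤ -β := by
    linarith [Real.log_le_sub_one_of_pos (show 0 < 1 - β by linarith)]
  have h3 : β ^ 2 / (4 * I.n) = (40000 * (I.n * x * x))⁻¹ := by
    rw [hβ]
    field_simp
    norm_num
  have h4 : Real.log (40000 * (I.n * x * x)) ≤ 12 * Real.log Z := by
    have h5 : 40000 * (I.n * x * x) ≤ Z ^ (10 + 2) := by
      refine le_pow_of_three_le hZ (by norm_num) (by positivity) ?_
      rw [sq]
      exact mul_le_mul hnx (by nlinarith) (by linarith) (by linarith)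
    have h6 := Real.log_le_log (by positivity) h5
    rw [Real.log_pow] at h6
    simpa using h6
  rw [h3, Real.log_inv] at h1
  have h5 : ((t - 2 : ℕ) : ℝ) * β ≤ 12 * Real.log Z := by
    have := mul_le_mul_of_nonneg_left h2 (Nat.cast_nonneg (α := ℝ) (t - 2))
    linarith
  have h6 : ((t - 2 : ℕ) : ℝ) ≤ 1200 * (x * Real.log Z) := by
    rw [hβ, mul_one_div, div_le_iff₀ (by positivity)] at h5
    linarith
  have h7 : (t : ℝ) ≤ (t - 2 : ℕ) + 2 := by
    have : t ≤ t - 2 + 2 := by omega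
    exact_mod_cast this
  have h8 : 1 ≤ x * Real.log Z := one_le_mul_of_one_le_of_one_le hx hlog
  linarith

/-- All further quantities that enter the running time. -/
theorem FirstStage.bounds (hst : I.FirstStage β γ ω τ) (hγ : 0 < γ) (hγ1 : γ < 1) (hx : 1 ≤ x)
    (hβ : β = 1 / (100 * x)) {Z : ℝ} (hZ : Z = 2 + I.n * x / γ) :
    (firstConfidence β γ : ℝ) ≤ 31 * Real.log Z ∧
    (τ : ℝ) ≤ 2 * 10 ^ 8 * (√(I.n : ℝ) * x ^ 2 * Real.log Z) ∧
    (secondConfidence γ (I.sketchLength β ω τ) τ : ℝ) ≤ 140 * Real.log Z ∧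
    (I.secondCount β γ ω τ : ℝ) ≤ 2 * 10 ^ 9 * (x ^ 3 * Real.log Z ^ 2) := by
  have hn : (1 : ℝ) ≤ I.n := by exact_mod_cast I.n_pos
  have hβ0 : 0 < β := by rw [hβ]; positivity
  have hβ1 : β ≤ 1 / 100 := by
    rw [hβ]
    exact div_le_div_of_nonneg_left (by norm_num) (by norm_num) (by linarith)
  have hnx : 1 ≤ I.n * x := one_le_mul_of_one_le_of_one_le hn hx
  have hnxγ : I.n * x / γ ≤ Z := by linarith
  have hnxγ' : I.n * x ≤ I.n * x / γ := by
    rw [le_div_iff₀ hγ]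
    nlinarith
  have hZ3 : 3 ≤ Z := by linarith
  have hxZ : x ≤ Z := by nlinarith
  have hnZ : I.n ≤ Z := by nlinarith
  have hxγZ : x / γ ≤ Z := by
    refine le_trans ?_ hnxγ
    gcongr
    nlinarith
  have hγZ : 1 / γ ≤ Z := by
    refine le_trans ?_ hxγZ
    gcongr
  have hΛ := one_le_log hZ3
  have hΛZ : Real.log Z ≤ Z := by linarith [Real.log_le_sub_one_of_pos (show 0 < Z by linarith)]
  set Λ := Real.log Z with hΛdef
  have hr : 1 ≤ √(I.n : ℝ) := Real.one_le_sqrt.2 hn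
  have hrZ : √(I.n : ℝ) ≤ Z := (Real.sqrt_le_self_iff.2 (Or.inr hn)).trans hnZ
  set r := √(I.n : ℝ)
  have hL0 : (firstConfidence β γ : ℝ) ≤ 31 * Λ := by
    have h1 : 32 / β ^ 2 / γ = 320000 * (x * (x / γ)) := by
      rw [hβ]
      field_simp
      norm_num
    have h2 := confidence_le hZ3 (y := 32 / β ^ 2) (γ := γ) (a := 13 + 2) (by positivity) (by
      rw [h1]
      refine le_pow_of_three_le hZ3 (by norm_num) (by positivity) ?_
      rw [sq]
      exact mul_le_mul hxZ hxγZ (by positivity) (by linarith))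
    rw [← firstConfidence] at h2
    push_cast at h2
    linarith
  have hK : repetitionGoal β γ ≤ 10 ^ 7 * (x ^ 2 * Λ) := by
    have h1 : repetitionGoal β γ = 320000 * x ^ 2 * firstConfidence β γ := by
      rw [repetitionGoal, hβ]
      field_simp
      ring
    rw [h1]
    have h2 := mul_le_mul_of_nonneg_left hL0 (show 0 ≤ 320000 * x ^ 2 by positivity)
    have h3 : 0 ≤ x ^ 2 * Λ := by positivity
    linarith
  have hx2 : 1 ≤ x ^ 2 := one_le_pow₀ hx
  have hτ : (τ : ℝ) ≤ 2 * 10 ^ 8 * (r * x ^ 2 * Λ) := by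
    have h1 : (τ : ℝ) ≤ 2 * I.halfHorizon β γ := by exact_mod_cast hst.le_horizon
    have hK0 : 0 ≤ repetitionGoal β γ := by rw [repetitionGoal]; positivity
    have h2 : (I.halfHorizon β γ : ℝ) < 8 * r * repetitionGoal β γ + 1 :=
      Nat.ceil_lt_add_one (by positivity)
    have h3 : r * repetitionGoal β γ ≤ r * (10 ^ 7 * (x ^ 2 * Λ)) :=
      mul_le_mul_of_nonneg_left hK (by linarith)
    have h4 : 1 ≤ r * x ^ 2 * Λ :=
      one_le_mul_of_one_le_of_one_le (one_le_mul_of_one_le_of_one_le hr hx2) hΛ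
    linarith
  have ht := hst.length_bound hx hβ hZ3 (by linarith)
  rw [← hΛdef] at ht
  set t := I.sketchLength β ω τ with htdef
  have hxΛ : 1 ≤ x * Λ := one_le_mul_of_one_le_of_one_le hx hΛ
  have hL2 : (secondConfidence γ t τ : ℝ) ≤ 140 * Λ := by
    have h1 : (t : ℝ) + 1 ≤ Z ^ (7 + 2) := by
      have : 1203 * (x * Λ) ≤ Z ^ (7 + 2) := by
        refine le_pow_of_three_le hZ3 (by norm_num) (by linarith) ?_
        rw [sq]
        exact mul_le_mul hxZ hΛZ (by linarith) (by linarith)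
      linarith
    have h2 : (τ : ℝ) + 1 ≤ Z ^ (18 + 4) := by
      have h3 : 3 * 10 ^ 8 * (r * x ^ 2 * Λ) ≤ Z ^ (18 + 4) := by
        refine le_pow_of_three_le hZ3 (by norm_num) (by positivity) ?_
        have h5 : x ^ 2 ≤ Z ^ 2 := pow_le_pow_left₀ (by linarith) hxZ 2
        calc r * x ^ 2 * Λ ≤ Z * Z ^ 2 * Z := by gcongr
          _ = Z ^ 4 := by ring
      have h4 : 1 ≤ r * x ^ 2 * Λ :=
        one_le_mul_of_one_le_of_one_le (one_le_mul_of_one_le_of_one_le hr hx2) hΛ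
      linarith
    have h3 : 16 * ((t : ℝ) + 1) ^ 2 * ((τ : ℝ) + 1) ^ 2 / γ ≤ Z ^ 66 := by
      have h4 : (16 : ℝ) ≤ Z ^ 3 :=
        le_trans (by norm_num) (pow_le_pow_left₀ (by norm_num) hZ3 3)
      have h5 := pow_le_pow_left₀ (by positivity) h1 2
      have h6 := pow_le_pow_left₀ (by positivity) h2 2
      rw [div_eq_mul_one_div]
      calc _ ≤ Z ^ 3 * (Z ^ (7 + 2)) ^ 2 * (Z ^ (18 + 4)) ^ 2 * Z := by gcongr
        _ = Z ^ 66 := by ring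
    have h4 := confidence_le hZ3 (by positivity) h3
    rw [← secondConfidence] at h4
    push_cast at h4
    linarith
  refine ⟨hL0, hτ, hL2, ?_⟩
  have h1 : (t : ℝ) * secondConfidence γ t τ / β ^ 2 ≤
      1202 * (x * Λ) * (140 * Λ) * (10000 * x ^ 2) := by
    have h2 : (t : ℝ) * secondConfidence γ t τ / β ^ 2 =
        t * secondConfidence γ t τ * (10000 * x ^ 2) := by
      rw [hβ]
      field_simp
      norm_num
    rw [h2]
    gcongr
  have h2 : (I.secondCount β γ ω τ : ℝ) < (t : ℝ) * secondConfidence γ t τ / β ^ 2 + 1 :=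
    Nat.ceil_lt_add_one (by positivity)
  have h3 : 1 ≤ x ^ 3 * Λ ^ 2 :=
    one_le_mul_of_one_le_of_one_le (one_le_pow₀ hx) (one_le_pow₀ hΛ)
  linarith

/-- The number of binary digits that the computation of the sketch needs. -/
theorem FirstStage.exists_digits (hst : I.FirstStage β γ ω τ) (hx : 1 ≤ x)
    (hβ : β = 1 / (100 * x)) {Z : ℝ} (hZ : 3 ≤ Z) (hnx : I.n * x ≤ Z) :
    ∃ F : ℕ, 1 < (1 - β) ^ I.sketchLength β ω τ * 2 ^ F ∧ (F : ℝ) ≤ 30 * Real.log Z := by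
  have hn : (1 : ℝ) ≤ I.n := by exact_mod_cast I.n_pos
  have hβ0 : 0 < β := by rw [hβ]; positivity
  have hβ1 : β ≤ 1 / 100 := by
    rw [hβ]
    exact div_le_div_of_nonneg_left (by norm_num) (by norm_num) (by linarith)
  have hlog := one_le_log hZ
  have h1 : (1 - β) ^ 2 * (β ^ 2 / (4 * I.n)) ≤ (1 - β) ^ I.sketchLength β ω τ := by
    calc _ ≤ (1 - β) ^ 2 * (1 - β) ^ (I.sketchLength β ω τ - 2) :=
          mul_le_mul_of_nonneg_left hst.length_le (by positivity)
      _ = (1 - β) ^ (2 + (I.sketchLength β ω τ - 2)) := (pow_add _ _ _).symm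
      _ ≤ _ := pow_le_pow_of_le_one (by linarith) (by linarith) (by omega)
  refine ⟨confidence 1 (8 * I.n / β ^ 2), ?_, ?_⟩
  · have h2 := (le_mul_two_pow_iff one_pos (x := 8 * I.n / β ^ 2) (by positivity) _).2 le_rfl
    rw [mul_one] at h2
    have h3 := mul_le_mul h1 h2 (by positivity) (pow_nonneg (by linarith) _)
    refine lt_of_lt_of_le ?_ h3
    have h4 : (1 - β) ^ 2 * (β ^ 2 / (4 * I.n)) * (8 * I.n / β ^ 2) = 2 * (1 - β) ^ 2 := by
      field_simp
      ring
    rw [h4]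
    nlinarith
  · have h2 : 8 * I.n / β ^ 2 / 1 = 80000 * (I.n * x * x) := by
      rw [hβ]
      field_simp
      norm_num
    have h3 := confidence_le hZ (y := 8 * I.n / β ^ 2) (γ := 1) (a := 11 + 2) (by positivity) (by
      rw [h2]
      refine le_pow_of_three_le hZ (by norm_num) (by positivity) ?_
      rw [sq]
      exact mul_le_mul hnx (by nlinarith) (by linarith) (by linarith))
    push_cast at h3
    linarith

end

end JobInstance

/-! ### The algorithm as a whole -/

/-- The running time in terms of the bounds for its ingredients. -/
theorem running_time_le {k L₀ τ κ t L₂ n₂ N F m a u v : ℝ} (hm : 1 ≤ m) (hu : 1 ≤ u) (hv : 1 ≤ v)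
    (hk : k ≤ 20 * L₀ + 300 * τ + 40 * κ + 60 * t * (τ + 1) + 20 * L₂ + 20 * n₂ + 31 * N +
      m * (80 * N + t * (60 * τ + 60 * n₂ + 60 * F + 230) + 100) + a + 1000)
    (hL₀ : L₀ ≤ 31 * u) (hτ : τ ≤ 2 * 10 ^ 8 * u) (hκ : κ ≤ 1202 * v) (ht : t ≤ 1202 * v)
    (hL₂ : L₂ ≤ 140 * u) (hn₂ : n₂ ≤ 2 * 10 ^ 9 * u) (hN : N ≤ 600 * u) (hF : F ≤ 30 * u)
    (hτ0 : 0 ≤ τ) (hn0 : 0 ≤ n₂) (hF0 : 0 ≤ F) : k ≤ 10 ^ 15 * (m * v * u) + a := by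
  have hv0 : 0 ≤ v := by linarith
  have h1 : t * (60 * τ + 60 * n₂ + 60 * F + 230) ≤ 1202 * v * (14 * 10 ^ 10 * u) :=
    mul_le_mul ht (by linarith) (by positivity) (by positivity)
  have h2 : t * (τ + 1) ≤ 1202 * v * (3 * 10 ^ 8 * u) :=
    mul_le_mul ht (by linarith) (by positivity) (by positivity)
  have hvu : u ≤ v * u := le_mul_of_one_le_left (by linarith) hv
  have hvu' : v ≤ v * u := le_mul_of_one_le_right (by linarith) hu
  have hw : v * u ≤ m * v * u := by
    rw [mul_assoc]
    exact le_mul_of_one_le_left (by linarith) hm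
  have h3 : m * (80 * N + t * (60 * τ + 60 * n₂ + 60 * F + 230) + 100) ≤
      m * (2 * 10 ^ 14 * (v * u)) :=
    mul_le_mul_of_nonneg_left (by linarith) (by linarith)
  linarith

theorem JobInstance.ofReal_le_sampleLaw {I : JobInstance} {γ : ℝ} (hγ : 0 ≤ γ)
    {G S : Set (ℕ → Fin I.n)} (hG : I.sampleLaw Gᶜ ≤ ENNReal.ofReal γ) (h : G ⊆ S) :
    ENNReal.ofReal (1 - γ) ≤ I.sampleLaw S := by
  have : MeasureTheory.IsProbabilityMeasure I.sampleLaw := by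
    rw [JobInstance.sampleLaw]
    infer_instance
  rw [ENNReal.ofReal_sub _ hγ, ENNReal.ofReal_one, tsub_le_iff_right,
    ← MeasureTheory.measure_univ (μ := I.sampleLaw)]
  calc I.sampleLaw Set.univ ≤ I.sampleLaw (S ∪ Gᶜ) := MeasureTheory.measure_mono fun ω _ => by
        by_cases hω : ω ∈ G
        · exact Or.inl (h hω)
        · exact Or.inr hω
    _ ≤ I.sampleLaw S + I.sampleLaw Gᶜ := MeasureTheory.measure_union_le _ _
    _ ≤ _ := by gcongr

theorem theorem2 :
    ∃ (prog : Prog) (C c : ℝ) (d : ℕ), 0 < C ∧ 1 ≤ c ∧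
      ∀ (m : ℕ) (ε γ : ℝ), 1 ≤ m → 0 < ε → ε < 1 → 0 < γ → γ < 1 →
      ∀ (A : BlackBox m) (tA : ℕ → ℝ → ℝ), A.IsApproxScheme → A.RunsInTime tA →
      ∀ (I : JobInstance) (label : Fin I.n → ℕ), Function.Injective label →
        ENNReal.ofReal (1 - γ) ≤ I.sampleLaw {ω |
          ∃ (s : MachineState) (k : ℕ),
            Exec A (fun i => (label (ω i), I.p (ω i))) prog (inputState m ε γ) s k ∧
            -- the running time
            (k : ℝ) ≤ C * ((m : ℝ) ^ 5 / ε ^ 4 * √(I.n : ℝ) + tA ⌈c * (m / ε)⌉₊ (ε / c)) *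
              Real.log (2 + I.n * m / (ε * γ)) ^ d ∧
            -- the approximation
            optMakespan m I.p ≤ s.value ∧ s.value ≤ (1 + ε) * optMakespan m I.p ∧
            -- the sketch schedule and its size
            0 < (s.sketch m).top ∧ 0 < (s.sketch m).δ ∧ (s.sketch m).δ < 1 ∧
            ((s.sketch m).size : ℝ) ≤
              C * ((m : ℝ) ^ 2 / ε ^ 2) * Real.log (2 + I.n * m / ε) ∧
            -- the schedules that it generates
            (∃ S : Fin I.n → Fin m, (s.sketch m).Generates I.p S) ∧
            ∀ S : Fin I.n → Fin m, (s.sketch m).Generates I.p S →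
              makespan I.p S ≤ (1 + 3 * ε) * optMakespan m I.p} := by
  -- there are at most `6 / β = 600 * m / ε` items, and the black box has accuracy `ε / 600`
  refine ⟨sketchProg, 10 ^ 15, 600, 3, by norm_num, by norm_num, ?_⟩
  intro m ε γ hm hε hε1 hγ hγ1 A tA hA htA I label hl
  have hm' : (1 : ℝ) ≤ m := by exact_mod_cast hm
  have hn : (1 : ℝ) ≤ I.n := by exact_mod_cast I.n_pos
  set x : ℝ := m / ε with hx
  have hx1 : 1 ≤ x := by rw [hx, le_div_iff₀ hε]; linarith
  have hmx : (m : ℝ) ≤ x := by rw [hx, le_div_iff₀ hε]; nlinarith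
  obtain ⟨β, hβ⟩ : ∃ β, β = 1 / (100 * x) := ⟨_, rfl⟩
  have hβm : β = ε / (100 * m) := by
    rw [hβ, hx]
    field_simp
  have hβ0 : 0 < β := by rw [hβ]; positivity
  have hβ1 : β ≤ 1 / 100 := by
    rw [hβ]
    exact div_le_div_of_nonneg_left (by norm_num) (by norm_num) (by linarith)
  obtain ⟨T, hT, hT'⟩ := I.exists_tail (c := 4 * β) (by linarith) (by linarith)
  -- the two arguments of the logarithms
  set Z : ℝ := 2 + I.n * x / γ with hZ
  set Z' : ℝ := 2 + I.n * x with hZ'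
  have hnx : 1 ≤ I.n * x := one_le_mul_of_one_le_of_one_le hn hx1
  have hnxγ : I.n * x ≤ I.n * x / γ := by
    rw [le_div_iff₀ hγ]
    nlinarith
  have hZ3 : 3 ≤ Z := by linarith
  have hZ3' : 3 ≤ Z' := by linarith
  have eZ : 2 + I.n * m / (ε * γ) = Z := by
    rw [hZ, hx]
    field_simp
  have eZ' : 2 + I.n * m / ε = Z' := by
    rw [hZ', hx, mul_div_assoc]
  rw [eZ, eZ']
  have hΛ := one_le_log hZ3
  set Λ := Real.log Z with hΛdef
  set r := √(I.n : ℝ) with hr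
  have hr1 : 1 ≤ r := Real.one_le_sqrt.2 hn
  set u := x ^ 3 * Λ ^ 2 * r with hu
  have hx3 : 1 ≤ x ^ 3 := one_le_pow₀ hx1
  have hΛ2 : 1 ≤ Λ ^ 2 := one_le_pow₀ hΛ
  have hu0 : x ^ 3 * Λ ^ 2 ≤ u := le_mul_of_one_le_right (by positivity) hr1
  have hΛu : Λ ≤ u := by
    have h1 : Λ ^ 2 ≤ x ^ 3 * Λ ^ 2 := le_mul_of_one_le_left (by positivity) hx3
    nlinarith
  have hxu : x ≤ u := by
    have h1 : x ^ 3 ≤ x ^ 3 * Λ ^ 2 := le_mul_of_one_le_right (by positivity) hΛ2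
    have h2 : x ≤ x ^ 3 := le_self_pow₀ hx1 (by norm_num)
    linarith
  have hru : r * x ^ 2 * Λ ≤ u := by
    have h1 : x ^ 2 * Λ ≤ x ^ 3 * Λ ^ 2 := by
      gcongr
      · norm_num
      · exact le_self_pow₀ hΛ (by norm_num)
    calc r * x ^ 2 * Λ = r * (x ^ 2 * Λ) := mul_assoc _ _ _
      _ ≤ r * (x ^ 3 * Λ ^ 2) := mul_le_mul_of_nonneg_left h1 (by linarith)
      _ = u := by rw [hu]; ring
  have hv1 : 1 ≤ x * Λ := one_le_mul_of_one_le_of_one_le hx1 hΛ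
  -- a bound for the whole sampling process
  set H : ℕ := ⌈10 ^ 10 * u + 1202 * (x * Λ)⌉₊ + 1 with hH
  have hHle : 10 ^ 10 * u + 1202 * (x * Λ) ≤ ((H - 1 : ℕ) : ℝ) := by
    rw [hH, Nat.add_sub_cancel]
    exact Nat.le_ceil _
  refine I.ofReal_le_sampleLaw hγ.le (G := {ω | I.Typical β γ T H ω})
    (I.sampleLaw_not_typical_le hβ0 hβ1 hγ T H) fun ω hω => ?_
  have htyp : I.Typical β γ T H ω := hω
  obtain ⟨τ, hst⟩ := htyp.exists_firstStage hβ0 hβ1 hγ hγ1 hT hT'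
  obtain ⟨hL₀, hτ, hL₂, hn₂⟩ := hst.bounds hγ hγ1 hx1 hβ hZ
  have ht' := hst.length_bound hx1 hβ hZ3' (by linarith)
  have ht := hst.length_bound hx1 hβ hZ3 (by linarith)
  obtain ⟨F, hF, hFle⟩ := hst.exists_digits hx1 hβ hZ3 (by linarith)
  rw [← hΛdef] at hL₀ hτ hL₂ hn₂ ht hFle
  have hsum : τ + I.secondCount β γ ω τ + I.sketchLength β ω τ ≤ H - 1 := by
    have h1 : (τ : ℝ) + I.secondCount β γ ω τ + I.sketchLength β ω τ ≤ ((H - 1 : ℕ) : ℝ) := by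
      linarith
    exact_mod_cast h1
  obtain ⟨s, k, hexec, d, hc, hout, hk⟩ := wp_sketchProg (A := A) hl hm hε hε1 hγ hγ1 hβm hst hF
  obtain ⟨hacc1, hacc2, hacc3⟩ := hc.accuracy hst hA hm hε hε1 hγ hγ1 hβm htyp (by omega) (by omega)
    (by omega) hout
  have hitems := hc.items_le hst hβ0 hβ1
  have hitems' : (d.items : ℝ) ≤ 600 * x := by
    refine hitems.trans (le_of_eq ?_)
    rw [hβ]
    field_simp
    norm_num
  have hsk := hout.sketch_eq
  have htop : 0 < (d.sketch m).top := hc.total_pos hst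
  have hδ : (d.sketch m).δ = β := hc.beta
  refine ⟨s, k, hexec, ?_, hacc1, hacc2, ?_, ?_, ?_, ?_, ?_, hacc3⟩
  · have hsteps : (A.steps d.items (fun i => d.size i) (ε / 600) : ℝ) ≤ tA ⌈600 * x⌉₊ (ε / 600) :=
      htA _ _ _ _ (by exact_mod_cast hitems'.trans (Nat.le_ceil _))
        (fun e => hc.packing.pos e e.2) (by positivity) (by linarith)
    have hk' := (Nat.cast_le (α := ℝ)).2 hk
    push_cast at hk'
    have hκt : (knownLength β : ℝ) ≤ I.sketchLength β ω τ := by exact_mod_cast hst.length_gt.le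
    have h1 := running_time_le hm' (hΛ.trans hΛu) hv1 hk' (by linarith) (by linarith)
      (by linarith) (by rw [hc.length]; linarith) (by rw [hc.length]; linarith)
      (by rw [hc.second]; linarith) (by linarith) (by linarith) (Nat.cast_nonneg _)
      (Nat.cast_nonneg _) (Nat.cast_nonneg _)
    have e1 : (m : ℝ) * (x * Λ) * u = (m : ℝ) ^ 5 / ε ^ 4 * r * Λ ^ 3 := by
      rw [hu, hx]
      field_simp
    rw [e1] at h1
    refine h1.trans ?_
    have h2 : 0 ≤ tA ⌈600 * x⌉₊ (ε / 600) := (Nat.cast_nonneg _).trans hsteps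
    have h3 : tA ⌈600 * x⌉₊ (ε / 600) ≤ tA ⌈600 * x⌉₊ (ε / 600) * Λ ^ 3 :=
      le_mul_of_one_le_right h2 (one_le_pow₀ hΛ)
    linarith
  · rwa [hsk]
  · rw [hsk, hδ]
    exact hβ0
  · rw [hsk, hδ]
    linarith
  · have e1 : ((s.sketch m).size : ℝ) = m * I.sketchLength β ω τ + 3 := by
      rw [hsk, SketchSchedule.size]
      change ((m * d.length + 3 : ℕ) : ℝ) = _
      rw [hc.length]
      push_cast
      ring
    have e2 : (m : ℝ) ^ 2 / ε ^ 2 = x ^ 2 := by rw [hx, div_pow]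
    rw [e1, e2]
    have hΛ' := one_le_log hZ3'
    have h1 : (m : ℝ) * I.sketchLength β ω τ ≤ x * (1202 * (x * Real.log Z')) := by gcongr
    have h2 : 1 ≤ x ^ 2 * Real.log Z' :=
      one_le_mul_of_one_le_of_one_le (one_le_pow₀ hx1) hΛ'
    linarith
  · rw [hsk]
    exact (d.sketch m).exists_generates hm I.p htop (by rw [hδ]; exact hβ0)
      (by rw [hδ]; linarith)
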